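/- Let $X$ be a complete geodesic metric space which is tree-graded with respect to a collection $\mathcal P$ of closed geodesic subsets (called pieces). This means that any two different pieces have at most one common point, and that every simple geodesic triangle in $X$ (a simple loop composed of three geodesics, where geodesics of length $0$ are allowed, so that a point is such a triangle) is contained in one piece. Suppose that the pieces are non-empty and locally uniformly contractible: for every $\varepsilon>0$ there is $\delta\in(0,\varepsilon]$ such that for every $M\in\mathcal P$ and every $m\in M$, the ball $B_M(m,\delta)$ of $M$ is contractible inside the ball $B_M(m,\varepsilon)$, i.e. the inclusion $B_M(m,\delta)\to B_M(m,\varepsilon)$ is homotopic to a constant map. Then the fundamental group of $X$ is the free product of the fundamental groups of the pieces. More precisely, for every $x\in X$ and every choice of base points $y_M\in M$, $M\in\mathcal P$, there are paths $\gamma_M$ in $X$ from $x$ to $y_M$ such that the homomorphism $$\mathop{*}_{M\in\mathcal P}\pi_1(M,y_M)\longrightarrow \pi_1(X,x)$$ which on each factor $\pi_1(M,y_M)$ is $[p]\mapsto[\gamma_M\, p\,\gamma_M^{-1}]$ is an isomorphism. -/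

import Mathlib

/-- `f` restricted to `[a, b]` is a geodesic (an isometric embedding of the interval). -/
def IsGeodesicOn {X : Type*} [MetricSpace X] (f : ℝ → X) (a b : ℝ) : Prop :=
  ∀ u ∈ Set.Icc a b, ∀ v ∈ Set.Icc a b, dist (f u) (f v) = |u - v|

/-- Every two points of `A` are joined by a geodesic contained in `A`. -/
def IsGeodesicSubset {X : Type*} [MetricSpace X] (A : Set X) : Prop :=
  ∀ a ∈ A, ∀ b ∈ A, ∃ f : ℝ → X, IsGeodesicOn f 0 (dist a b) ∧
    f 0 = a ∧ f (dist a b) = b ∧ f '' Set.Icc 0 (dist a b) ⊆ A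

/-- The restriction of `f` to `[0, l]` is a simple geodesic triangle: a simple loop, parametrized
by arc length, composed of the three geodesics `f|[0, s]`, `f|[s, t]`, `f|[t, l]`. Geodesics of
length `0` are allowed; in particular a point is a simple geodesic triangle (`l = 0`). -/
structure IsSimpleGeodesicTriangle {X : Type*} [MetricSpace X] (f : ℝ → X) (s t l : ℝ) :
    Prop where
  zero_le : 0 ≤ s
  le_mid : s ≤ t
  le_end : t ≤ l
  side₁ : IsGeodesicOn f 0 s
  side₂ : IsGeodesicOn f s t
  side₃ : IsGeodesicOn f t l
  closed : f 0 = f l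
  simple : Set.InjOn f (Set.Ico 0 l)

/-- `X` is tree-graded with respect to the collection of pieces `P`. -/
structure IsTreeGraded (X : Type*) [MetricSpace X] (P : Set (Set X)) : Prop where
  complete : CompleteSpace X
  geodesic : IsGeodesicSubset (Set.univ : Set X)
  isClosed_piece : ∀ M ∈ P, IsClosed M
  geodesic_piece : ∀ M ∈ P, IsGeodesicSubset M
  inter_subsingleton : ∀ M ∈ P, ∀ N ∈ P, M ≠ N → (M ∩ N).Subsingleton
  triangle : ∀ (f : ℝ → X) (s t l : ℝ), IsSimpleGeodesicTriangle f s t l →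
    ∃ M ∈ P, f '' Set.Icc 0 l ⊆ M

/-- A family of metric spaces is locally uniformly contractible if for every `ε > 0` there is
`δ > 0`, the same for all members and all points, such that every ball of radius `δ` can be
contracted to a point inside the concentric ball of radius `ε`. -/
def LocallyUniformlyContractible {ι : Type*} (Y : ι → Type*) [∀ i, MetricSpace (Y i)] : Prop :=
  ∀ ε : ℝ, 0 < ε → ∃ δ : ℝ, 0 < δ ∧ ∃ h : δ ≤ ε, ∀ (i : ι) (y : Y i),
    (ContinuousMap.inclusion (Metric.ball_subset_ball h) :
      C(Metric.ball y δ, Metric.ball y ε)).Nullhomotopic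

/-- The homomorphism `π₁(M, y) → π₁(X, x)` induced by the inclusion of the subset `M` in `X`
and a path `γ` in `X` from `x` to `y`: the class of a loop `p` goes to that of `γ p γ⁻¹`. -/
noncomputable def piOneInclusion {X : Type*} [TopologicalSpace X] (M : Set X) (y : M) {x : X}
    (γ : Path x (y : X)) : FundamentalGroup M y →* FundamentalGroup X x :=
  (FundamentalGroup.fundamentalGroupMulEquivOfPath γ).symm.toMonoidHom.comp
    (FundamentalGroup.map (⟨Subtype.val, continuous_subtype_val⟩ : C(M, X)) y)

/-! Tree-gradedness gives each point `a` a gate in every piece `M`: a point of `M` through which `a`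
reaches all of `M`. If `a` and `b` have different gates in `M`, every geodesic from `a` to `b`
passes through both. At most one piece gives three points `x`, `a`, `b` three different gates (it
separates them); if none does, the three points have a median.

Contractibility of the pieces makes `X` locally simply connected in a controlled way. Two geodesics
with the same ends differ only over gaps, and over each gap they lie in one piece, where they can be
filled; small gaps have small fillings, so the fillings glue. A short triangle is a tripod whose
centre is a triangle in a piece, and infinite dyadic subdivision then shows that every small path is
homotopic to the geodesic joining its ends (`exists_radius`).

Fix a combing: geodesics from `x` to all points which inside each piece follow a prescribed geodesic
from the gate of `x` (a ray). The path to the base point of a piece is its combing line.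

Surjectivity: cut a loop into small arcs and join the division points to `x` by combing lines. This
writes it as a product of loops over short geodesics from `a` to `b`. If `M` separates `x`, `a`,
`b`, the parts of such a loop outside `M` cancel and it comes from the fundamental group of `M`;
otherwise the combing lines agree up to the median and the loop is trivial
(`combLoop_mem_of_short`).

Injectivity: a left inverse is built. For close `a`, `b` separated from `x` by `M`, let `Φ a b` be
the class, in the factor of `M`, of a short path from the gate of `a` to that of `b`, closed up by
rays; let it be `1` if no piece separates. This is multiplicative on small triangles, since it is so
in each factor and each side involves at most one factor (`exists_cocycle`). Such a cocycle has a
holonomy on homotopy classes of paths (`exists_holonomy`). The holonomy is `1` on combing lines and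
reads off the class of any path inside a piece, so it undoes the homomorphism on every factor. -/

section Geodesics

open Set

variable {X : Type*} [MetricSpace X]

/-! ### Geodesics -/

/-- `f` is a geodesic from `a` to `b`, parametrized by arc length on `[0, dist a b]`. -/
structure IsGeod (f : ℝ → X) (a b : X) : Prop where
  isGeodesicOn : IsGeodesicOn f 0 (dist a b)
  map_zero : f 0 = a
  map_dist : f (dist a b) = b

theorem IsGeodesicOn.continuousOn {f : ℝ → X} {a b : ℝ} (hf : IsGeodesicOn f a b) :
    ContinuousOn f (Icc a b) := by
  have : LipschitzOnWith 1 f (Icc a b) :=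
    LipschitzOnWith.of_dist_le_mul fun u hu v hv => by simp [hf u hu v hv, Real.dist_eq]
  exact this.continuousOn

namespace IsGeod

variable {f g : ℝ → X} {a b c : X} {s t : ℝ}

theorem dist_eq (hf : IsGeod f a b) (hs : s ∈ Icc 0 (dist a b)) (ht : t ∈ Icc 0 (dist a b)) :
    dist (f s) (f t) = |s - t| := hf.isGeodesicOn s hs t ht

theorem dist_of_le (hf : IsGeod f a b) (hs : 0 ≤ s) (hst : s ≤ t) (ht : t ≤ dist a b) :
    dist (f s) (f t) = t - s := by
  rw [hf.dist_eq ⟨hs, hst.trans ht⟩ ⟨hs.trans hst, ht⟩, abs_sub_comm, abs_of_nonneg (by linarith)]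

theorem dist_left (hf : IsGeod f a b) (hs : s ∈ Icc 0 (dist a b)) : dist a (f s) = s := by
  have := hf.dist_of_le le_rfl hs.1 hs.2
  rwa [hf.map_zero, sub_zero] at this

theorem dist_right (hf : IsGeod f a b) (hs : s ∈ Icc 0 (dist a b)) :
    dist (f s) b = dist a b - s := by
  have := hf.dist_of_le hs.1 hs.2 le_rfl
  rwa [hf.map_dist] at this

theorem injOn (hf : IsGeod f a b) : InjOn f (Icc 0 (dist a b)) := fun s hs t ht h => by
  rw [← hf.dist_left hs, h, hf.dist_left ht]

theorem continuousOn (hf : IsGeod f a b) : ContinuousOn f (Icc 0 (dist a b)) :=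
  hf.isGeodesicOn.continuousOn

theorem sub (hf : IsGeod f a b) (hs : 0 ≤ s) (hst : s ≤ t) (ht : t ≤ dist a b) :
    IsGeod (fun r => f (s + r)) (f s) (f t) := by
  have h := hf.dist_of_le hs hst ht
  refine ⟨fun u hu v hv => ?_, by simp, by simp [h]⟩
  rw [h] at hu hv
  rw [hf.dist_eq ⟨by linarith [hu.1], by linarith [hu.2]⟩ ⟨by linarith [hv.1], by linarith [hv.2]⟩]
  congr 1; ring

theorem rev (hf : IsGeod f a b) : IsGeod (fun r => f (dist a b - r)) b a := by
  refine ⟨fun u hu v hv => ?_, by simp [hf.map_dist], by simp [dist_comm b a, hf.map_zero]⟩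
  rw [dist_comm b a] at hu hv
  rw [hf.dist_eq ⟨by linarith [hu.2], by linarith [hu.1]⟩ ⟨by linarith [hv.2], by linarith [hv.1]⟩,
    abs_sub_comm]
  congr 1; ring

/-- A `1`-Lipschitz map of `[0, dist a b]` taking the ends to `a` and `b` is a geodesic. -/
theorem of_dist_le (h0 : f 0 = a) (h1 : f (dist a b) = b)
    (h : ∀ s t, 0 ≤ s → s ≤ t → t ≤ dist a b → dist (f s) (f t) ≤ t - s) : IsGeod f a b := by
  have key : ∀ s t, 0 ≤ s → s ≤ t → t ≤ dist a b → dist (f s) (f t) = t - s := by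
    intro s t hs hst ht
    refine le_antisymm (h s t hs hst ht) ?_
    have h2 := h 0 s le_rfl hs (hst.trans ht)
    have h3 := h t _ (hs.trans hst) ht le_rfl
    rw [h0] at h2
    rw [h1] at h3
    linarith [dist_triangle4 a (f s) (f t) b]
  refine ⟨fun u hu v hv => ?_, h0, h1⟩
  rcases le_total u v with huv | huv
  · rw [key u v hu.1 huv hv.2, abs_sub_comm, abs_of_nonneg (by linarith)]
  · rw [dist_comm, key v u hv.1 huv hu.2, abs_of_nonneg (by linarith)]

theorem concat (hf : IsGeod f a b) (hg : IsGeod g b c) (h : dist a c = dist a b + dist b c) :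
    IsGeod (fun r => if r ≤ dist a b then f r else g (r - dist a b)) a c := by
  have hab := dist_nonneg (x := a) (y := b)
  have hbc := dist_nonneg (x := b) (y := c)
  refine of_dist_le ?_ ?_ ?_
  · simp [hf.map_zero]
  · rcases le_or_gt (dist a c) (dist a b) with h' | h'
    · have h0 : b = c := dist_eq_zero.1 (le_antisymm (by linarith) hbc)
      rw [if_pos h', ← h0, hf.map_dist]
    · rw [if_neg h'.not_ge, h, add_sub_cancel_left, hg.map_dist]
  · intro s t hs hst ht
    by_cases h1 : t ≤ dist a b
    · simp only [hst.trans h1, h1, if_true]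
      exact (hf.dist_of_le hs hst h1).le
    · by_cases h2 : s ≤ dist a b
      · simp only [h1, h2, if_true, if_false]
        have e1 := hf.dist_right ⟨hs, h2⟩
        have e2 := hg.dist_left (s := t - dist a b) ⟨by linarith, by linarith⟩
        linarith [dist_triangle (f s) b (g (t - dist a b))]
      · simp only [h1, h2, if_false]
        rw [hg.dist_of_le (by linarith) (by linarith) (by linarith)]
        linarith

theorem congr (hf : IsGeod f a b) (h : EqOn g f (Icc 0 (dist a b))) : IsGeod g a b := by
  refine ⟨fun u hu v hv => ?_, ?_, ?_⟩
  · rw [h hu, h hv, hf.dist_eq hu hv]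
  · rw [h ⟨le_rfl, dist_nonneg⟩, hf.map_zero]
  · rw [h ⟨dist_nonneg, le_rfl⟩, hf.map_dist]

/-- Every geodesic extends to a continuous map on the line. -/
theorem clamp (hf : IsGeod f a b) :
    IsGeod (fun r => f (projIcc 0 (dist a b) dist_nonneg r)) a b :=
  hf.congr fun r hr => by simp [projIcc_of_mem _ hr]

theorem continuous_clamp (hf : IsGeod f a b) :
    Continuous (fun r => f (projIcc 0 (dist a b) dist_nonneg r)) :=
  hf.continuousOn.comp_continuous (continuous_subtype_val.comp continuous_projIcc)
    fun r => (projIcc 0 (dist a b) dist_nonneg r).2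

end IsGeod

/-! ### First and last points in a closed set -/

theorem ContinuousOn.exists_first {Y : Type*} [TopologicalSpace Y] {f : ℝ → Y} {a b : ℝ}
    (hf : ContinuousOn f (Icc a b)) {C : Set Y} (hC : IsClosed C) (h : ∃ s ∈ Icc a b, f s ∈ C) :
    ∃ s ∈ Icc a b, f s ∈ C ∧ ∀ t ∈ Icc a b, f t ∈ C → s ≤ t := by
  have h1 : IsClosed (Icc a b ∩ f ⁻¹' C) := hf.preimage_isClosed_of_isClosed isClosed_Icc hC
  have h2 : IsCompact (Icc a b ∩ f ⁻¹' C) := isCompact_Icc.of_isClosed_subset h1 inter_subset_left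
  obtain ⟨s0, h3, h4⟩ := h
  obtain ⟨s, hs, hs'⟩ := h2.exists_isLeast ⟨s0, h3, h4⟩
  exact ⟨s, hs.1, hs.2, fun t ht ht' => hs' ⟨ht, ht'⟩⟩

theorem ContinuousOn.exists_last {Y : Type*} [TopologicalSpace Y] {f : ℝ → Y} {a b : ℝ}
    (hf : ContinuousOn f (Icc a b)) {C : Set Y} (hC : IsClosed C) (h : ∃ s ∈ Icc a b, f s ∈ C) :
    ∃ s ∈ Icc a b, f s ∈ C ∧ ∀ t ∈ Icc a b, f t ∈ C → t ≤ s := by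
  have h1 : IsClosed (Icc a b ∩ f ⁻¹' C) := hf.preimage_isClosed_of_isClosed isClosed_Icc hC
  have h2 : IsCompact (Icc a b ∩ f ⁻¹' C) := isCompact_Icc.of_isClosed_subset h1 inter_subset_left
  obtain ⟨s0, h3, h4⟩ := h
  obtain ⟨s, hs, hs'⟩ := h2.exists_isGreatest ⟨s0, h3, h4⟩
  exact ⟨s, hs.1, hs.2, fun t ht ht' => hs' ⟨ht, ht'⟩⟩

/-! ### Simple triangles and gates -/

/-- Three geodesics which meet only at the common vertices lie in one piece. -/
theorem IsTreeGraded.exists_piece_of_triangle {P : Set (Set X)} (hP : IsTreeGraded X P)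
    {u v w : X} {f g h : ℝ → X} (hf : IsGeod f u v) (hg : IsGeod g v w) (hh : IsGeod h u w)
    (hfg : ∀ s ∈ Icc 0 (dist u v), ∀ t ∈ Icc 0 (dist v w), f s = g t → f s = v)
    (hgh : ∀ s ∈ Icc 0 (dist v w), ∀ t ∈ Icc 0 (dist u w), g s = h t → g s = w)
    (hfh : ∀ s ∈ Icc 0 (dist u v), ∀ t ∈ Icc 0 (dist u w), f s = h t → f s = u) :
    ∃ M ∈ P, f '' Icc 0 (dist u v) ⊆ M ∧ g '' Icc 0 (dist v w) ⊆ M ∧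
      h '' Icc 0 (dist u w) ⊆ M := by
  set A := dist u v
  set B := dist v w
  set C := dist u w
  have hA : 0 ≤ A := dist_nonneg
  have hB : 0 ≤ B := dist_nonneg
  have hC : 0 ≤ C := dist_nonneg
  set F : ℝ → X := fun r => if r ≤ A then f r else if r ≤ A + B then g (r - A)
    else h (A + B + C - r) with hF
  have F1 : ∀ r, r ≤ A → F r = f r := fun r hr => by simp [hF, hr]
  have F2 : ∀ r, A ≤ r → r ≤ A + B → F r = g (r - A) := by
    intro r hr hr'
    rcases hr.eq_or_lt with rfl | hr
    · simp [hF, hg.map_zero, hf.map_dist, A]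
    · simp [hF, not_le.2 hr, hr']
  have F3 : ∀ r, A + B ≤ r → F r = h (A + B + C - r) := by
    intro r hr
    rcases hr.eq_or_lt with rfl | hr
    · rw [F2 _ (by linarith) le_rfl]
      simp only [add_sub_cancel_left]
      rw [hg.map_dist, hh.map_dist]
    · simp [hF, not_le.2 hr, not_le.2 (lt_of_le_of_lt (by linarith : A ≤ A + B) hr)]
  have tri : IsSimpleGeodesicTriangle F A (A + B) (A + B + C) := by
    refine ⟨hA, by linarith, by linarith, ?_, ?_, ?_, ?_, ?_⟩
    · intro r hr t ht
      rw [F1 _ hr.2, F1 _ ht.2, hf.dist_eq hr ht]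
    · intro r hr t ht
      rw [F2 _ hr.1 hr.2, F2 _ ht.1 ht.2, hg.dist_eq ⟨by linarith [hr.1], by linarith [hr.2]⟩
        ⟨by linarith [ht.1], by linarith [ht.2]⟩]
      congr 1; ring
    · intro r hr t ht
      rw [F3 _ hr.1, F3 _ ht.1, hh.dist_eq ⟨by linarith [hr.2], by linarith [hr.1]⟩
        ⟨by linarith [ht.2], by linarith [ht.1]⟩, abs_sub_comm]
      congr 1; ring
    · rw [F1 _ hA, F3 _ (by linarith)]
      simp [hf.map_zero, hh.map_zero]
    · have key : ∀ r ∈ Ico 0 (A + B + C), ∀ t ∈ Ico 0 (A + B + C), r ≤ t → F r = F t → r = t := by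
        intro r hr t ht hrt e
        rcases le_or_gt r A with r1 | r1
        · rcases le_or_gt t A with t1 | t1
          · rw [F1 _ r1, F1 _ t1] at e
            exact hf.injOn ⟨hr.1, r1⟩ ⟨ht.1, t1⟩ e
          rcases le_or_gt t (A + B) with t2 | t2
          · rw [F1 _ r1, F2 _ t1.le t2] at e
            have e1 := hfg r ⟨hr.1, r1⟩ (t - A) ⟨by linarith, by linarith⟩ e
            have e2 := hf.injOn ⟨hr.1, r1⟩ ⟨hA, le_rfl⟩ (e1.trans hf.map_dist.symm)
            have e3 := hg.injOn (x₁ := t - A) ⟨by linarith, by linarith⟩ ⟨le_rfl, hB⟩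
              ((e.symm.trans e1).trans hg.map_zero.symm)
            linarith
          · rw [F1 _ r1, F3 _ t2.le] at e
            have e1 := hfh r ⟨hr.1, r1⟩ (A + B + C - t) ⟨by linarith [ht.2], by linarith⟩ e
            have e3 := hh.injOn (x₁ := A + B + C - t) ⟨by linarith [ht.2], by linarith⟩ ⟨le_rfl, hC⟩
              ((e.symm.trans e1).trans hh.map_zero.symm)
            -- The sides meet at `u`, so `t = A + B + C`, the end point which the half-open interval
            -- leaves out.
            linarith [ht.2]
        rcases le_or_gt r (A + B) with r2 | r2
        · rcases le_or_gt t (A + B) with t2 | t2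
          · rw [F2 _ r1.le r2, F2 _ (r1.le.trans hrt) t2] at e
            have := hg.injOn (x₁ := r - A) (x₂ := t - A) ⟨by linarith, by linarith⟩
              ⟨by linarith, by linarith⟩ e
            linarith
          · rw [F2 _ r1.le r2, F3 _ t2.le] at e
            have e1 := hgh (r - A) ⟨by linarith, by linarith⟩ (A + B + C - t)
              ⟨by linarith [ht.2], by linarith⟩ e
            have e2 := hg.injOn (x₁ := r - A) ⟨by linarith, by linarith⟩ ⟨hB, le_rfl⟩
              (e1.trans hg.map_dist.symm)
            have e3 := hh.injOn (x₁ := A + B + C - t) ⟨by linarith [ht.2], by linarith⟩ ⟨hC, le_rfl⟩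
              ((e.symm.trans e1).trans hh.map_dist.symm)
            linarith
        · rw [F3 _ r2.le, F3 _ (r2.le.trans hrt)] at e
          have := hh.injOn (x₁ := A + B + C - r) (x₂ := A + B + C - t)
            ⟨by linarith [hr.2], by linarith⟩ ⟨by linarith [ht.2], by linarith⟩ e
          linarith
      intro r hr t ht e
      rcases le_total r t with h | h
      · exact key r hr t ht h e
      · exact (key t ht r hr h e.symm).symm
  obtain ⟨M, hM, hsub⟩ := hP.triangle F _ _ _ tri
  refine ⟨M, hM, ?_, ?_, ?_⟩
  · rintro _ ⟨r, hr, rfl⟩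
    rw [← F1 r hr.2]
    exact hsub ⟨r, ⟨hr.1, by linarith [hr.2]⟩, rfl⟩
  · rintro _ ⟨r, hr, rfl⟩
    have := F2 (r + A) (by linarith [hr.1]) (by linarith [hr.2])
    rw [add_sub_cancel_right] at this
    rw [← this]
    exact hsub ⟨r + A, ⟨by linarith [hr.1], by linarith [hr.2]⟩, rfl⟩
  · rintro _ ⟨r, hr, rfl⟩
    have := F3 (A + B + C - r) (by linarith [hr.2])
    rw [sub_sub_cancel] at this
    rw [← this]
    exact hsub ⟨A + B + C - r, ⟨by linarith [hr.2], by linarith [hr.1]⟩, rfl⟩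

namespace IsTreeGraded

variable {P : Set (Set X)} (hP : IsTreeGraded X P)
include hP

theorem exists_isGeod (a b : X) : ∃ f : ℝ → X, IsGeod f a b := by
  obtain ⟨f, h1, h2, h3, -⟩ := hP.geodesic a (mem_univ _) b (mem_univ _)
  exact ⟨f, h1, h2, h3⟩

theorem exists_isGeod_piece {M : Set X} (hM : M ∈ P) {a b : X} (ha : a ∈ M) (hb : b ∈ M) :
    ∃ f : ℝ → X, IsGeod f a b ∧ ∀ s ∈ Icc 0 (dist a b), f s ∈ M := by
  obtain ⟨f, h1, h2, h3, h4⟩ := hP.geodesic_piece M hM a ha b hb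
  exact ⟨f, ⟨h1, h2, h3⟩, fun s hs => h4 ⟨s, hs, rfl⟩⟩

theorem piece_eq {M N : Set X} (hM : M ∈ P) (hN : N ∈ P) {a b : X} (hab : a ≠ b)
    (haM : a ∈ M) (haN : a ∈ N) (hbM : b ∈ M) (hbN : b ∈ N) : M = N := by
  by_contra h
  exact hab (hP.inter_subsingleton M hM N hN h ⟨haM, haN⟩ ⟨hbM, hbN⟩)

end IsTreeGraded

/-- The point `e` is the gate of `a` in `M`: every point of `M` is reached from `a` through `e`. -/
structure IsGate (M : Set X) (a e : X) : Prop where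
  mem : e ∈ M
  dist_eq : ∀ m ∈ M, dist a m = dist a e + dist e m

namespace IsGate

variable {M : Set X} {a b e e' : X}

theorem eq (h : IsGate M a e) (h' : IsGate M a e') : e = e' := by
  have h1 := h.dist_eq _ h'.mem
  have h2 := h'.dist_eq _ h.mem
  rw [dist_comm e' e] at h2
  exact dist_le_zero.1 (by linarith)

theorem self (h : a ∈ M) : IsGate M a a := ⟨h, fun m _ => by simp⟩

theorem eq_of_mem (h : IsGate M a e) (ha : a ∈ M) : e = a := h.eq (self ha)

/-- Points between `a` and its gate have the same gate. -/
theorem of_between (h : IsGate M a e) (hb : dist a e = dist a b + dist b e) : IsGate M b e := by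
  refine ⟨h.mem, fun m hm => le_antisymm (dist_triangle _ _ _) ?_⟩
  have h1 := h.dist_eq m hm
  linarith [dist_triangle a b m]

end IsGate

namespace IsTreeGraded

variable {P : Set (Set X)} (hP : IsTreeGraded X P)
include hP

/-- All geodesics from `a` to points of `M` enter `M` at the same point. If two entrance points
differed, the segments from the last common point to them and a geodesic of `M` between them would
form a simple triangle. Its piece shares two points with `M`, hence is `M`, and the branching point
would lie in `M` before the first entrance. -/
theorem exists_isGate {M : Set X} (hM : M ∈ P) (hne : M.Nonempty) (a : X) : ∃ e, IsGate M a e := by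
  obtain ⟨m, hm⟩ := hne
  obtain ⟨g, hg⟩ := hP.exists_isGeod a m
  obtain ⟨s₁, hs₁, hs₁M, hs₁'⟩ := hg.continuousOn.exists_first (hP.isClosed_piece M hM)
    ⟨dist a m, ⟨dist_nonneg, le_rfl⟩, by rwa [hg.map_dist]⟩
  refine ⟨g s₁, hs₁M, fun m' hm' => ?_⟩
  obtain ⟨g', hg'⟩ := hP.exists_isGeod a m'
  obtain ⟨s₂, hs₂, hs₂M, hs₂'⟩ := hg'.continuousOn.exists_first (hP.isClosed_piece M hM)
    ⟨dist a m', ⟨dist_nonneg, le_rfl⟩, by rwa [hg'.map_dist]⟩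
  suffices h : g s₁ = g' s₂ by
    rw [h, hg'.dist_left hs₂, hg'.dist_right hs₂]; ring
  by_contra hne
  have hI1 : Icc 0 (min s₁ s₂) ⊆ Icc 0 (dist a m) := Icc_subset_Icc_right (min_le_left _ _|>.trans hs₁.2)
  have hI2 : Icc 0 (min s₁ s₂) ⊆ Icc 0 (dist a m') := Icc_subset_Icc_right (min_le_right _ _|>.trans hs₂.2)
  -- Both geodesics start at `a`, so they pass a common point at the same time; `s₀` is the last
  -- such time.
  obtain ⟨s₀, hs₀, hs₀e, hs₀'⟩ := ContinuousOn.exists_last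
    (f := fun s => (g s, g' s)) (a := 0) (b := min s₁ s₂)
    ((hg.continuousOn.mono hI1).prodMk (hg'.continuousOn.mono hI2)) isClosed_diagonal
    ⟨0, ⟨le_rfl, le_min hs₁.1 hs₂.1⟩, by simp [hg.map_zero, hg'.map_zero]⟩
  simp only [mem_diagonal_iff] at hs₀e hs₀'
  obtain ⟨k, hk, hkM⟩ := hP.exists_isGeod_piece hM hs₁M hs₂M
  have l1 : s₀ ≤ s₁ := hs₀.2.trans (min_le_left _ _)
  have l2 : s₀ ≤ s₂ := hs₀.2.trans (min_le_right _ _)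
  have G1 := hg.sub hs₀.1 l1 hs₁.2
  have G2 := hg'.sub hs₀.1 l2 hs₂.2
  have d1 := hg.dist_of_le hs₀.1 l1 hs₁.2
  have d2 := hg'.dist_of_le hs₀.1 l2 hs₂.2
  rw [← hs₀e] at G2 d2
  obtain ⟨N, hN, n1, n2, n3⟩ := hP.exists_piece_of_triangle G1 hk G2
    (by
      intro s hs t ht e
      rw [d1] at hs
      have := hs₁' (s₀ + s) ⟨by linarith [hs.1, hs₀.1], by linarith [hs.2, hs₁.2]⟩ (e ▸ hkM t ht)
      have : s₀ + s = s₁ := by linarith [hs.2]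
      simp [this])
    (by
      intro s hs t ht e
      rw [d2] at ht
      have := hs₂' (s₀ + t) ⟨by linarith [ht.1, hs₀.1], by linarith [ht.2, hs₂.2]⟩ (e ▸ hkM s hs)
      have : s₀ + t = s₂ := by linarith [ht.2]
      rw [e]
      simp [this])
    (by
      intro s hs t ht e
      rw [d1] at hs
      rw [d2] at ht
      have i1 := hg.dist_left (s := s₀ + s) ⟨by linarith [hs.1, hs₀.1], by linarith [hs.2, hs₁.2]⟩
      have i2 := hg'.dist_left (s := s₀ + t) ⟨by linarith [ht.1, hs₀.1], by linarith [ht.2, hs₂.2]⟩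
      rw [e, i2] at i1
      have hst : s = t := by linarith
      subst hst
      have := hs₀' (s₀ + s) ⟨by linarith [hs.1, hs₀.1], le_min (by linarith [hs.2])
        (by linarith [ht.2])⟩ e
      have : s = 0 := by linarith [hs.1]
      simp [this])
  have e1 : g s₁ ∈ N := n2 ⟨0, ⟨le_rfl, dist_nonneg⟩, hk.map_zero⟩
  have e2 : g' s₂ ∈ N := n2 ⟨_, ⟨dist_nonneg, le_rfl⟩, hk.map_dist⟩
  obtain rfl := hP.piece_eq hM hN hne hs₁M e1 hs₂M e2
  have h0 : g s₀ ∈ M := n1 ⟨0, ⟨le_rfl, dist_nonneg⟩, by simp⟩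
  have h1 := hs₁' s₀ (hI1 hs₀) h0
  have h2 := hs₂' s₀ (hI2 hs₀) (hs₀e ▸ h0)
  have h3 : s₀ = s₁ := le_antisymm l1 h1
  have h4 : s₀ = s₂ := le_antisymm l2 h2
  exact hne (by rw [← h3, ← h4]; exact hs₀e)

end IsTreeGraded

end Geodesics

/-! ### Gates of pairs and triples of points, centres and bigons -/

section Gates

open Set

variable {X : Type*} [MetricSpace X]

namespace IsTreeGraded

variable {P : Set (Set X)} (hP : IsTreeGraded X P)
include hP

/-- A geodesic with ends in a piece lies in the piece. -/
theorem geod_mem_piece {M : Set X} (hM : M ∈ P) {u v : X} (hu : u ∈ M) (hv : v ∈ M) {f : ℝ → X}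
    (hf : IsGeod f u v) {s : ℝ} (hs : s ∈ Icc 0 (dist u v)) : f s ∈ M := by
  obtain ⟨e, he⟩ := hP.exists_isGate hM ⟨u, hu⟩ (f s)
  have h1 := he.dist_eq u hu
  have h2 := he.dist_eq v hv
  rw [dist_comm, hf.dist_left hs] at h1
  rw [hf.dist_right hs] at h2
  -- The ways from `f s` to `u` and to `v` both pass through `e`, so the length of the geodesic is
  -- `2 * dist (f s) e + dist e u + dist e v`, which must not exceed `dist u v`.
  have h3 : dist (f s) e ≤ 0 := by
    linarith [dist_triangle u e v, dist_comm u e, dist_nonneg (x := f s) (y := e)]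
  rw [dist_le_zero.1 h3]
  exact he.mem

/-- Geodesics from `a` to `e` and from `b` to `e'` are disjoint, since their points have different
gates. If `k` missed `M`, the part of `k` between its last point on the first and its next point on
the second would close a simple triangle through `e` and `e'`: going on from `e` to `e'` inside `M`
keeps the first side geodesic. The piece of this triangle is `M`, so `k` meets `M` after all. -/
theorem exists_mem_of_gate_ne {M : Set X} (hM : M ∈ P) {a b e e' : X} (ha : IsGate M a e)
    (hb : IsGate M b e') (hne : e ≠ e') {k : ℝ → X} (hk : IsGeod k a b) :
    ∃ s ∈ Icc 0 (dist a b), k s ∈ M := by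
  by_contra! hkM
  obtain ⟨f, hf⟩ := hP.exists_isGeod a e
  obtain ⟨f', hf'⟩ := hP.exists_isGeod b e'
  have gf : ∀ s ∈ Icc 0 (dist a e), IsGate M (f s) e := fun s hs => ha.of_between (by
    rw [hf.dist_left hs, hf.dist_right hs]; ring)
  have gf' : ∀ s ∈ Icc 0 (dist b e'), IsGate M (f' s) e' := fun s hs => hb.of_between (by
    rw [hf'.dist_left hs, hf'.dist_right hs]; ring)
  have hdisj : ∀ s ∈ Icc 0 (dist a e), ∀ t ∈ Icc 0 (dist b e'), f s ≠ f' t := fun s hs t ht h =>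
    hne ((gf s hs).eq (h ▸ gf' t ht))
  have cf : IsClosed (f '' Icc 0 (dist a e)) :=
    (isCompact_Icc.image_of_continuousOn hf.continuousOn).isClosed
  have cf' : IsClosed (f' '' Icc 0 (dist b e')) :=
    (isCompact_Icc.image_of_continuousOn hf'.continuousOn).isClosed
  obtain ⟨u₀, hu₀, ⟨s, hs, hsu⟩, hu₀'⟩ := hk.continuousOn.exists_last cf
    ⟨0, ⟨le_rfl, dist_nonneg⟩, 0, ⟨le_rfl, dist_nonneg⟩, by rw [hf.map_zero, hk.map_zero]⟩
  obtain ⟨u₁, hu₁, ⟨s', hs', hsu'⟩, hu₁'⟩ :=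
    (hk.continuousOn.mono (Icc_subset_Icc_left hu₀.1)).exists_first cf'
    ⟨dist a b, ⟨hu₀.2, le_rfl⟩, 0, ⟨le_rfl, dist_nonneg⟩, by rw [hf'.map_zero, hk.map_dist]⟩
  have hu₁0 : u₁ ∈ Icc 0 (dist a b) := ⟨hu₀.1.trans hu₁.1, hu₁.2⟩
  obtain ⟨h, hh, hhM⟩ := hP.exists_isGeod_piece hM ha.mem hb.mem
  have F := hf.sub hs.1 hs.2 le_rfl
  have dF := hf.dist_of_le hs.1 hs.2 le_rfl
  rw [hf.map_dist] at F dF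
  have FF := F.concat hh ((gf s hs).dist_eq _ hb.mem)
  have dFF := (gf s hs).dist_eq _ hb.mem
  have G := hf'.rev.sub (s := 0) (t := dist b e' - s') le_rfl (by linarith [hs'.2])
    (by rw [dist_comm e' b]; linarith [hs'.1])
  simp only [zero_add, sub_zero, sub_sub_cancel, hf'.map_dist] at G
  have dG : dist e' (f' s') = dist b e' - s' := by rw [dist_comm]; exact hf'.dist_right hs'
  have H := hk.sub hu₀.1 hu₁.1 hu₁.2
  have dH := hk.dist_of_le hu₀.1 hu₁.1 hu₁.2
  rw [← hsu', ← hsu] at H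
  rw [← hsu', ← hsu] at dH
  obtain ⟨N, hN, n1, n2, n3⟩ := hP.exists_piece_of_triangle FF G H
    (by
      intro r hr t ht e0
      rw [dG] at ht
      split_ifs at e0 ⊢ with hrle
      · exact (hdisj (s + r) ⟨by linarith [hr.1, hs.1], by linarith⟩ (dist b e' - t)
          ⟨by linarith [ht.2, hs'.1], by linarith [ht.1]⟩ e0).elim
      · have hm := hhM (r - dist (f s) e) ⟨by linarith, by linarith [hr.2]⟩
        rw [e0] at hm ⊢
        exact ((gf' (dist b e' - t) ⟨by linarith [ht.2, hs'.1], by linarith [ht.1]⟩).eq_of_mem hm).symm)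
    (by
      intro r hr t ht e0
      rw [dG] at hr
      rw [dH] at ht
      have := hu₁' (u₀ + t) ⟨by linarith [ht.1], by linarith [ht.2, hu₁.2]⟩
        ⟨dist b e' - r, ⟨by linarith [hr.2, hs'.1], by linarith [hr.1]⟩, e0⟩
      have : u₀ + t = u₁ := by linarith [ht.2]
      rw [e0, this, hsu'])
    (by
      intro r hr t ht e0
      rw [dH] at ht
      have hk1 : u₀ + t ∈ Icc 0 (dist a b) := ⟨by linarith [ht.1, hu₀.1], by linarith [ht.2, hu₁.2]⟩
      rw [e0]
      split_ifs at e0 with hrle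
      · have := hu₀' (u₀ + t) hk1 ⟨s + r, ⟨by linarith [hr.1, hs.1], by linarith⟩, e0⟩
        have : t = 0 := by linarith [ht.1]
        simp [this, hsu]
      · have hm := hhM (r - dist (f s) e) ⟨by linarith, by linarith [hr.2]⟩
        rw [e0] at hm
        exact (hkM _ hk1 hm).elim)
  have e1 : e ∈ N := n1 ⟨dist (f s) e, ⟨dist_nonneg, by rw [dFF]; linarith [dist_nonneg (x := e) (y := e')]⟩, by
    simp [dF, hf.map_dist]⟩
  have e2 : e' ∈ N := n2 ⟨0, ⟨le_rfl, dist_nonneg⟩, by simp [hf'.map_dist]⟩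
  obtain rfl := hP.piece_eq hM hN hne ha.mem e1 hb.mem e2
  exact hkM u₀ hu₀ (n3 ⟨0, ⟨le_rfl, dist_nonneg⟩, by simp⟩)

/-- A geodesic between points with different gates in a piece passes through the first gate. -/
theorem geod_gate {M : Set X} (hM : M ∈ P) {a b e e' : X} (ha : IsGate M a e)
    (hb : IsGate M b e') (hne : e ≠ e') {k : ℝ → X} (hk : IsGeod k a b) :
    dist a e ≤ dist a b ∧ k (dist a e) = e := by
  obtain ⟨s, hs, hsM, hs'⟩ := hk.continuousOn.exists_first (hP.isClosed_piece M hM)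
    (hP.exists_mem_of_gate_ne hM ha hb hne hk)
  have key : k s = e := by
    rcases hs.1.eq_or_lt with h0 | h0
    · rw [← h0, hk.map_zero] at hsM ⊢
      exact (ha.eq_of_mem hsM).symm
    -- Before time `s` the geodesic has not met `M`, so its points still have the gate `e`; hence
    -- `e` is within `s - t` of `k s` for every `t < s`.
    · refine (dist_le_zero.1 (le_of_forall_pos_le_add fun ε hε => ?_)).symm
      set t := max 0 (s - ε)
      have ht0 : 0 ≤ t := le_max_left _ _
      have hts : t < s := max_lt h0 (by linarith)
      have htε : s - ε ≤ t := le_max_right _ _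
      obtain ⟨e₁, he₁⟩ := hP.exists_isGate hM ⟨e, ha.mem⟩ (k t)
      have hk' := hk.sub le_rfl ht0 (hts.le.trans hs.2)
      simp only [hk.map_zero, zero_add] at hk'
      have he : e = e₁ := by
        by_contra hne'
        obtain ⟨r, hr, hrM⟩ := hP.exists_mem_of_gate_ne hM ha he₁ hne' hk'
        have hd := hk.dist_left ⟨ht0, hts.le.trans hs.2⟩
        rw [hd] at hr
        linarith [hs' r ⟨hr.1, by linarith [hr.2, hs.2]⟩ hrM, hr.2]
      subst he
      have h1 := he₁.dist_eq _ hsM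
      rw [hk.dist_of_le ht0 hts.le hs.2] at h1
      linarith [dist_nonneg (x := k t) (y := e)]
  have hd := hk.dist_left hs
  rw [key] at hd
  rw [hd]
  exact ⟨hs.2, key⟩

theorem dist_gate {M : Set X} (hM : M ∈ P) {a b e e' : X} (ha : IsGate M a e)
    (hb : IsGate M b e') (hne : e ≠ e') : dist a b = dist a e + dist e e' + dist e' b := by
  obtain ⟨k, hk⟩ := hP.exists_isGeod a b
  obtain ⟨h1, h2⟩ := hP.geod_gate hM ha hb hne hk
  have h3 := hk.dist_right ⟨dist_nonneg, h1⟩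
  rw [h2] at h3
  have h4 := hb.dist_eq e ha.mem
  rw [dist_comm b e, dist_comm b e', dist_comm e' e] at h4
  linarith

theorem dist_gate_le {M : Set X} (hM : M ∈ P) {a b e e' : X} (ha : IsGate M a e)
    (hb : IsGate M b e') : dist e e' ≤ dist a b := by
  by_cases h : e = e'
  · simp [h]
  · linarith [hP.dist_gate hM ha hb h, dist_nonneg (x := a) (y := e), dist_nonneg (x := e') (y := b)]

/-- A piece has only one gate in another piece. -/
theorem gate_eq_of_mem_piece {M N : Set X} (hM : M ∈ P) (hN : N ∈ P) (hMN : M ≠ N) {a b e e' : X}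
    (haN : a ∈ N) (hbN : b ∈ N) (ha : IsGate M a e) (hb : IsGate M b e') : e = e' := by
  by_contra hne
  obtain ⟨k, hk⟩ := hP.exists_isGeod a b
  obtain ⟨h1, h2⟩ := hP.geod_gate hM ha hb hne hk
  obtain ⟨h3, h4⟩ := hP.geod_gate hM hb ha (Ne.symm hne) hk.rev
  have m1 := hP.geod_mem_piece hN haN hbN hk ⟨dist_nonneg, h1⟩
  have m2 := hP.geod_mem_piece hN hbN haN hk.rev ⟨dist_nonneg, h3⟩
  rw [h2] at m1
  rw [h4] at m2
  exact hMN (hP.piece_eq hM hN hne ha.mem m1 hb.mem m2)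

/-- Of any two pieces, one has the same gate for `a` as for the other piece. -/
theorem gate_eq_or {M N : Set X} (hM : M ∈ P) (hN : N ∈ P) (hMN : M ≠ N) {a m n p q c c' : X}
    (hp : IsGate M a p) (hq : IsGate N a q) (hn : n ∈ N) (hc : IsGate M n c) (hm : m ∈ M)
    (hc' : IsGate N m c') : p = c ∨ q = c' := by
  by_contra! h
  obtain ⟨cq, hcq⟩ := hP.exists_isGate hM ⟨p, hp.mem⟩ q
  obtain rfl := hP.gate_eq_of_mem_piece hM hN hMN hq.mem hn hcq hc
  obtain ⟨cp, hcp⟩ := hP.exists_isGate hN ⟨q, hq.mem⟩ p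
  obtain rfl := hP.gate_eq_of_mem_piece hN hM (Ne.symm hMN) hp.mem hm hcp hc'
  have h1 := hP.dist_gate hM hp hcq h.1
  have h2 := hcp.dist_eq q hq.mem
  have h3 := hq.dist_eq cp hcp.mem
  have h4 := hcq.dist_eq p hp.mem
  -- The way from `a` to `q` leads through `p` and then through `cp`, while the way from `a` to `cp`
  -- leads through `q`.
  have h5 : dist cp q ≤ 0 := by
    linarith [dist_triangle a p cp, dist_comm q cp, dist_comm q p, dist_comm p cq, dist_comm q cq]
  exact h.2 (dist_le_zero.1 h5).symm

/-- Two different pieces cannot both separate the same three points. -/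
theorem piece_unique {M N : Set X} (hM : M ∈ P) (hN : N ∈ P) {a₁ a₂ a₃ p₁ p₂ p₃ q₁ q₂ q₃ : X}
    (hp₁ : IsGate M a₁ p₁) (hp₂ : IsGate M a₂ p₂) (hp₃ : IsGate M a₃ p₃)
    (hq₁ : IsGate N a₁ q₁) (hq₂ : IsGate N a₂ q₂) (hq₃ : IsGate N a₃ q₃)
    (p12 : p₁ ≠ p₂) (p13 : p₁ ≠ p₃) (p23 : p₂ ≠ p₃)
    (q12 : q₁ ≠ q₂) (q13 : q₁ ≠ q₃) (q23 : q₂ ≠ q₃) : M = N := by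
  by_contra hMN
  obtain ⟨c, hc⟩ := hP.exists_isGate hM ⟨_, hp₁.mem⟩ q₁
  obtain ⟨c', hc'⟩ := hP.exists_isGate hN ⟨_, hq₁.mem⟩ p₁
  have h1 := hP.gate_eq_or hM hN hMN hp₁ hq₁ hq₁.mem hc hp₁.mem hc'
  have h2 := hP.gate_eq_or hM hN hMN hp₂ hq₂ hq₁.mem hc hp₁.mem hc'
  have h3 := hP.gate_eq_or hM hN hMN hp₃ hq₃ hq₁.mem hc hp₁.mem hc'
  -- Pigeonhole: two of the three points take the same alternative and so share a gate.
  grind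

/-- Every triple of points spans a tripod whose centre is replaced by a triangle in a piece. -/
theorem exists_center (x a b : X) : ∃ M ∈ P, ∃ u ∈ M, ∃ v ∈ M, ∃ w ∈ M,
    dist x a = dist x u + dist u v + dist v a ∧ dist x b = dist x u + dist u w + dist w b ∧
      dist a b = dist a v + dist v w + dist w b := by
  obtain ⟨f, hf⟩ := hP.exists_isGeod x a
  obtain ⟨f', hf'⟩ := hP.exists_isGeod x b
  obtain ⟨k, hk⟩ := hP.exists_isGeod a b
  set A := dist x a
  set B := dist x b
  have hI1 : Icc 0 (min A B) ⊆ Icc 0 A := Icc_subset_Icc_right (min_le_left _ _)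
  have hI2 : Icc 0 (min A B) ⊆ Icc 0 B := Icc_subset_Icc_right (min_le_right _ _)
  obtain ⟨s₀, hs₀, hs₀e, hs₀'⟩ := ContinuousOn.exists_last
    (f := fun s => (f s, f' s)) (a := 0) (b := min A B)
    ((hf.continuousOn.mono hI1).prodMk (hf'.continuousOn.mono hI2)) isClosed_diagonal
    ⟨0, ⟨le_rfl, le_min dist_nonneg dist_nonneg⟩, by simp [hf.map_zero, hf'.map_zero]⟩
  simp only [mem_diagonal_iff] at hs₀e hs₀'
  have l1 : s₀ ≤ A := hs₀.2.trans (min_le_left _ _)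
  have l2 : s₀ ≤ B := hs₀.2.trans (min_le_right _ _)
  have inter : ∀ s ∈ Icc s₀ A, ∀ t ∈ Icc s₀ B, f s = f' t → s = s₀ ∧ t = s₀ := by
    intro s hs t ht e
    have i1 := hf.dist_left ⟨hs₀.1.trans hs.1, hs.2⟩
    rw [e, hf'.dist_left ⟨hs₀.1.trans ht.1, ht.2⟩] at i1
    subst i1
    have := hs₀' t ⟨hs₀.1.trans ht.1, le_min hs.2 ht.2⟩ e
    have : t = s₀ := le_antisymm this ht.1
    exact ⟨this, this⟩
  have cf : IsClosed (f '' Icc s₀ A) := (isCompact_Icc.image_of_continuousOn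
    (hf.continuousOn.mono (Icc_subset_Icc_left hs₀.1))).isClosed
  have cf' : IsClosed (f' '' Icc s₀ B) := (isCompact_Icc.image_of_continuousOn
    (hf'.continuousOn.mono (Icc_subset_Icc_left hs₀.1))).isClosed
  -- The third geodesic is cut at its last point on `f` beyond the branching and at its next point
  -- on `f'`; with the segments of `f` and `f'` back to the branching point this is a simple
  -- triangle.
  obtain ⟨u₀, hu₀, ⟨s, hs, hsu⟩, hu₀'⟩ := hk.continuousOn.exists_last cf
    ⟨0, ⟨le_rfl, dist_nonneg⟩, A, ⟨l1, le_rfl⟩, by rw [hf.map_dist, hk.map_zero]⟩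
  obtain ⟨u₁, hu₁, ⟨s', hs', hsu'⟩, hu₁'⟩ :=
    (hk.continuousOn.mono (Icc_subset_Icc_left hu₀.1)).exists_first cf'
    ⟨dist a b, ⟨hu₀.2, le_rfl⟩, B, ⟨l2, le_rfl⟩, by rw [hf'.map_dist, hk.map_dist]⟩
  have hs0 : s ∈ Icc 0 A := ⟨hs₀.1.trans hs.1, hs.2⟩
  have hs0' : s' ∈ Icc 0 B := ⟨hs₀.1.trans hs'.1, hs'.2⟩
  have hu₁0 : u₁ ∈ Icc 0 (dist a b) := ⟨hu₀.1.trans hu₁.1, hu₁.2⟩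
  have F := hf.sub hs₀.1 hs.1 hs.2
  have dF := hf.dist_of_le hs₀.1 hs.1 hs.2
  have G := hk.sub hu₀.1 hu₁.1 hu₁.2
  have dG := hk.dist_of_le hu₀.1 hu₁.1 hu₁.2
  have H := hf'.sub hs₀.1 hs'.1 hs'.2
  have dH := hf'.dist_of_le hs₀.1 hs'.1 hs'.2
  rw [← hsu', ← hsu] at G dG
  rw [← hs₀e] at H dH
  obtain ⟨M, hM, n1, n2, n3⟩ := hP.exists_piece_of_triangle F G H
    (by
      intro r hr t ht e0
      rw [dF] at hr
      rw [dG] at ht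
      have := hu₀' (u₀ + t) ⟨by linarith [ht.1, hu₀.1], by linarith [ht.2, hu₁.2]⟩
        ⟨s₀ + r, ⟨by linarith [hr.1], by linarith [hr.2, hs.2]⟩, e0⟩
      have : t = 0 := by linarith [ht.1]
      rw [e0, this]
      simp [hsu])
    (by
      intro r hr t ht e0
      rw [dG] at hr
      rw [dH] at ht
      have := hu₁' (u₀ + r) ⟨by linarith [hr.1], by linarith [hr.2, hu₁.2]⟩
        ⟨s₀ + t, ⟨by linarith [ht.1], by linarith [ht.2, hs'.2]⟩, e0.symm⟩
      have : u₀ + r = u₁ := by linarith [hr.2]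
      rw [this, hsu'])
    (by
      intro r hr t ht e0
      rw [dF] at hr
      rw [dH] at ht
      have := (inter (s₀ + r) ⟨by linarith [hr.1], by linarith [hr.2, hs.2]⟩
        (s₀ + t) ⟨by linarith [ht.1], by linarith [ht.2, hs'.2]⟩ e0).1
      rw [this])
  refine ⟨M, hM, f s₀, n1 ⟨0, ⟨le_rfl, dist_nonneg⟩, by simp⟩, f s,
    n2 ⟨0, ⟨le_rfl, dist_nonneg⟩, by simp [hsu]⟩, f' s',
    n2 ⟨_, ⟨dist_nonneg, le_rfl⟩, by simp only [dG]; rw [add_sub_cancel, hsu']⟩, ?_, ?_, ?_⟩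
  · rw [hf.dist_left (hI1 hs₀), hf.dist_of_le hs₀.1 hs.1 hs.2, hf.dist_right hs0]; ring
  · rw [hf.dist_left (hI1 hs₀), dH, hf'.dist_right hs0']; ring
  · rw [dG, hsu, hk.dist_left hu₀, hsu', hk.dist_right hu₁0]; ring

/-- A bigon of two geodesics which meet only at the ends lies in one piece. -/
theorem exists_piece_of_bigon {f g : ℝ → X} {L l r : ℝ} (hf : IsGeodesicOn f 0 L)
    (hg : IsGeodesicOn g 0 L) (h0 : f 0 = g 0) (hl : 0 ≤ l) (hlr : l ≤ r) (hr : r ≤ L)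
    (hfl : f l = g l) (hfr : f r = g r) (hne : ∀ s ∈ Ioo l r, f s ≠ g s) :
    ∃ M ∈ P, ∀ s ∈ Icc l r, f s ∈ M ∧ g s ∈ M := by
  have hL : 0 ≤ L := by linarith
  have dL : dist (f 0) (f L) = L := by
    rw [hf 0 ⟨le_rfl, hL⟩ L ⟨hL, le_rfl⟩, zero_sub, abs_neg, abs_of_nonneg hL]
  have dL' : dist (g 0) (g L) = L := by
    rw [hg 0 ⟨le_rfl, hL⟩ L ⟨hL, le_rfl⟩, zero_sub, abs_neg, abs_of_nonneg hL]
  have hf' : IsGeod f (f 0) (f L) := ⟨by rwa [dL], rfl, by rw [dL]⟩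
  have hg' : IsGeod g (g 0) (g L) := ⟨by rwa [dL'], rfl, by rw [dL']⟩
  -- Cutting the side `f` at its midpoint turns the bigon into a triangle.
  set m := (l + r) / 2 with hm
  have F := hf'.sub hl (by linarith : l ≤ m) (by linarith)
  have dF := hf'.dist_of_le hl (by linarith : l ≤ m) (by linarith)
  have G := hf'.sub (by linarith : 0 ≤ m) (by linarith : m ≤ r) (by linarith)
  have dG := hf'.dist_of_le (by linarith : 0 ≤ m) (by linarith : m ≤ r) (by linarith)
  have H := hg'.sub hl hlr (by linarith)
  have dH := hg'.dist_of_le hl hlr (by linarith)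
  rw [← hfl, ← hfr] at H dH
  have same : ∀ s ∈ Icc l r, ∀ t ∈ Icc l r, f s = g t → s = t := by
    intro s hs t ht e
    have e1 := hf'.dist_left (s := s) ⟨by linarith [hs.1], by linarith [hs.2]⟩
    rw [e, h0, hg'.dist_left (s := t) ⟨by linarith [ht.1], by linarith [ht.2]⟩] at e1
    exact e1.symm
  obtain ⟨M, hM, n1, n2, n3⟩ := hP.exists_piece_of_triangle F G H
    (by
      intro s hs t ht e
      rw [dF] at hs
      rw [dG] at ht
      have := hf'.injOn (x₁ := l + s) (x₂ := m + t) ⟨by linarith [hs.1], by linarith [hs.2]⟩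
        ⟨by linarith [ht.1], by linarith [ht.2]⟩ e
      have : l + s = m := by linarith [hs.2, ht.1]
      rw [this])
    (by
      intro s hs t ht e
      rw [dG] at hs
      rw [dH] at ht
      have h1 := same (m + s) ⟨by linarith [hs.1], by linarith [hs.2]⟩ (l + t)
        ⟨by linarith [ht.1], by linarith [ht.2]⟩ e
      by_cases h2 : m + s = r
      · rw [h2]
      by_cases h3 : l = r
      · rw [show m + s = r by linarith [hs.1, hs.2]]
      have h4 : l < r := lt_of_le_of_ne hlr h3
      refine (hne (m + s) ⟨by linarith [hs.1], lt_of_le_of_ne (by linarith [hs.2]) h2⟩ ?_).elim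
      rw [e, h1])
    (by
      intro s hs t ht e
      rw [dF] at hs
      rw [dH] at ht
      have h1 := same (l + s) ⟨by linarith [hs.1], by linarith [hs.2]⟩ (l + t)
        ⟨by linarith [ht.1], by linarith [ht.2]⟩ e
      by_cases h2 : s = 0
      · simp [h2]
      have h5 : 0 < s := lt_of_le_of_ne hs.1 (Ne.symm h2)
      refine (hne (l + s) ⟨by linarith, by linarith [hs.2]⟩ ?_).elim
      rw [e, h1])
  refine ⟨M, hM, fun s hs => ⟨?_, n3 ⟨s - l, ⟨by linarith [hs.1], by linarith [hs.2]⟩, by simp⟩⟩⟩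
  rcases le_total s m with h | h
  · exact n1 ⟨s - l, ⟨by linarith [hs.1], by linarith⟩, by simp⟩
  · exact n2 ⟨s - m, ⟨by linarith, by linarith [hs.2]⟩, by simp⟩

end IsTreeGraded

end Gates

/-! ### Calculus of homotopy classes, and contractibility in terms of paths -/

section HomotopyClasses

open Set
open scoped unitInterval

namespace Path.Homotopic.Quotient

variable {Y : Type*} [TopologicalSpace Y] {a b c : Y}

theorem symm_trans_cancel (p : Homotopic.Quotient a b) (q : Homotopic.Quotient b c) :
    p.symm.trans (p.trans q) = q := by
  rw [← trans_assoc, symm_trans, refl_trans]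

theorem trans_symm_cancel (p : Homotopic.Quotient a b) (q : Homotopic.Quotient a c) :
    p.trans (p.symm.trans q) = q := by
  rw [← trans_assoc, trans_symm, refl_trans]

theorem symm_eq_of_trans_eq {p : Homotopic.Quotient a b} {q : Homotopic.Quotient b a}
    (h : p.trans q = refl a) : p.symm = q := by
  rw [← symm_trans_cancel p q, h, trans_refl]

theorem map_trans {Z : Type*} [TopologicalSpace Z] (p : Homotopic.Quotient a b)
    (q : Homotopic.Quotient b c) (f : C(Y, Z)) : (p.trans q).map f = (p.map f).trans (q.map f) := by
  induction p with | mk p =>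
  induction q with | mk q =>
  simp only [← mk_trans, ← mk_map, Path.map_trans]

theorem map_symm {Z : Type*} [TopologicalSpace Z] (p : Homotopic.Quotient a b) (f : C(Y, Z)) :
    p.symm.map f = (p.map f).symm := by
  induction p with | mk p => rfl

theorem symm_refl (a : Y) : (refl a).symm = refl a :=
  symm_eq_of_trans_eq (refl_trans _)

theorem symm_symm (p : Homotopic.Quotient a b) : p.symm.symm = p :=
  symm_eq_of_trans_eq (symm_trans _)

theorem trans_symm_rev (p : Homotopic.Quotient a b) (q : Homotopic.Quotient b c) :
    (p.trans q).symm = q.symm.trans p.symm :=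
  symm_eq_of_trans_eq (by rw [trans_assoc, trans_symm_cancel, trans_symm])

/-- In the application `E` is the combing line to the gate of `x` in a piece, and `K`, `A`, `B` are
the rays to the base point and to the ends of `C`. Conjugation by the path to the base point cancels
`K`. -/
theorem conj_map_eq {Z : Type*} [TopologicalSpace Z] {d : Y} {z : Z} (f : C(Y, Z)) (E : Homotopic.Quotient z (f a))
    (K : Homotopic.Quotient a b) (A : Homotopic.Quotient a c) (C : Homotopic.Quotient c d)
    (B : Homotopic.Quotient a d) :
    (E.trans (K.map f)).trans (((((K.symm.trans A).trans C).trans (K.symm.trans B).symm).map f).trans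
      (E.trans (K.map f)).symm) =
      ((E.trans (A.map f)).trans (C.map f)).trans (E.trans (B.map f)).symm := by
  simp only [trans_symm_rev, symm_symm, map_trans, map_symm, trans_assoc, trans_symm_cancel]

end Path.Homotopic.Quotient

open Path.Homotopic.Quotient

section Seg

variable {Y Z : Type*} [TopologicalSpace Y] [TopologicalSpace Z] {a b c : Y}

/-- The path traced by `f` on the interval from `s` to `t`. -/
def segPath (f : ℝ → Y) (hf : Continuous f) (s t : ℝ) (hs : f s = a) (ht : f t = b) : Path a b where
  toFun r := f (s + r * (t - s))
  continuous_toFun := by fun_prop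
  source' := by simp [hs]
  target' := by simp [ht]

/-- The homotopy class of the path traced by `f` on the interval from `s` to `t`. -/
def seg (f : ℝ → Y) (hf : Continuous f) (s t : ℝ) (hs : f s = a) (ht : f t = b) :
    Path.Homotopic.Quotient a b := mk (segPath f hf s t hs ht)

variable {f : ℝ → Y} {hf : Continuous f} {s t u : ℝ}

/-- Paths on the line with the same ends have homotopic images. -/
theorem mk_map_eq_seg (φ : Path s t) (h : C(ℝ, Y)) :
    mk (φ.map h.continuous) = seg h h.continuous s t rfl rfl := by
  have : Path.Homotopic φ (segPath id continuous_id s t rfl rfl) :=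
    SimplyConnectedSpace.paths_homotopic _ _
  exact Path.Homotopic.Quotient.eq.2 (this.map h)

theorem seg_self {hs : f s = a} {ht : f s = a} : seg f hf s s hs ht = refl a := by
  subst hs
  exact congrArg mk (Path.ext (funext fun r => by simp [segPath]))

theorem seg_trans {hs : f s = a} {ht : f t = b} {hu : f u = c} :
    (seg f hf s t hs ht).trans (seg f hf t u ht hu) = seg f hf s u hs hu := by
  subst hs ht hu
  have := mk_map_eq_seg ((segPath id continuous_id s t rfl rfl).trans
    (segPath id continuous_id t u rfl rfl)) ⟨f, hf⟩
  rw [Path.map_trans] at this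
  exact this

theorem seg_symm {hs : f s = a} {ht : f t = b} :
    (seg f hf s t hs ht).symm = seg f hf t s ht hs :=
  symm_eq_of_trans_eq (by rw [seg_trans, seg_self])

theorem seg_comp {φ : ℝ → ℝ} (hφ : Continuous φ) {hs : f (φ s) = a} {ht : f (φ t) = b} :
    seg (fun r => f (φ r)) (hf.comp hφ) s t hs ht = seg f hf (φ s) (φ t) hs ht := by
  subst hs ht
  exact mk_map_eq_seg ((segPath id continuous_id s t rfl rfl).map hφ) ⟨f, hf⟩

theorem seg_congr {g : ℝ → Y} {hg : Continuous g} {hs : f s = a} {ht : f t = b} {hs' : g s = a}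
    {ht' : g t = b} (h : EqOn f g (uIcc s t)) : seg f hf s t hs ht = seg g hg s t hs' ht' := by
  refine congrArg mk (Path.ext (funext fun r => h ?_))
  have h0 := r.2.1
  have h1 := r.2.2
  rcases le_total s t with hst | hst
  · rw [uIcc_of_le hst]
    constructor <;> nlinarith
  · rw [uIcc_of_ge hst]
    constructor <;> nlinarith

theorem seg_map (h : C(Y, Z)) {hs : f s = a} {ht : f t = b} :
    (seg f hf s t hs ht).map h =
      seg (fun r => h (f r)) (h.continuous.comp hf) s t (congrArg h hs) (congrArg h ht) := rfl

theorem mk_eq_seg (p : Path a b) :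
    mk p = seg p.extend p.continuous_extend 0 1 p.extend_zero p.extend_one := by
  refine congrArg mk (Path.ext (funext fun r => ?_))
  simp [segPath]

theorem range_segPath {hs : f s = a} {ht : f t = b} (hst : s ≤ t) (r : I) :
    ∃ v ∈ Icc s t, segPath f hf s t hs ht r = f v := by
  have h0 := r.2.1
  have h1 := r.2.2
  exact ⟨s + r * (t - s), ⟨by nlinarith, by nlinarith⟩, rfl⟩

end Seg

/-- A homotopy in `X` with values in `S` is a homotopy in `S`. -/
theorem homotopic_of_homotopy_mem {X : Type*} [TopologicalSpace X] {S : Set X} {a b : S}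
    {p q : Path a b} (F : (p.map continuous_subtype_val).Homotopy (q.map continuous_subtype_val))
    (hF : ∀ z, F z ∈ S) : p.Homotopic q := by
  refine ⟨⟨⟨⟨fun z => ⟨F z, hF z⟩, by fun_prop⟩, fun r => ?_, fun r => ?_⟩, fun t r hr => ?_⟩⟩
  · exact Subtype.ext (F.apply_zero r)
  · exact Subtype.ext (F.apply_one r)
  · exact Subtype.ext (F.eq_fst t hr)

/-- The path `p` as a path in a subset containing its range. -/
def Path.restrictCod {X : Type*} [TopologicalSpace X] {a b : X} (p : Path a b) (S : Set X)
    (h : ∀ t, p t ∈ S) : Path (⟨a, by simpa using h 0⟩ : S) ⟨b, by simpa using h 1⟩ where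
  toFun t := ⟨p t, h t⟩
  source' := Subtype.ext p.source
  target' := Subtype.ext p.target

/-- A homotopy from `f` to a constant moves the ends, but its naturality square identifies the image
of any path from `a` to `b`, followed by the track of `b`, with the track of `a` followed by a
constant path. The result does not depend on the path, and the track of `b` cancels. -/
theorem nullhomotopic_map_homotopic {Y Z : Type*} [TopologicalSpace Y] [TopologicalSpace Z]
    {f : C(Y, Z)} (hf : f.Nullhomotopic) {a b : Y} (p q : Path a b) :
    (p.map f.continuous).Homotopic (q.map f.continuous) := by
  obtain ⟨z, ⟨H⟩⟩ := hf
  have hp := Path.Homotopic.map_trans_evalAt H p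
  have hq := Path.Homotopic.map_trans_evalAt H q
  rw [← Path.Homotopic.Quotient.eq] at hp hq ⊢
  simp only [mk_trans] at hp hq
  have e : mk (p.map (ContinuousMap.const Y z).continuous)
    = mk (q.map (ContinuousMap.const Y z).continuous) := rfl
  rw [e, ← hq] at hp
  have := congrArg (fun r => r.trans (mk (H.evalAt b)).symm) hp
  simpa only [trans_assoc, trans_symm, trans_refl] using this

/-- The form in which contractibility is used: homotopies relative to the ends, inside one piece,
with size controlled uniformly over all pieces. -/
theorem LocallyUniformlyContractible.exists_homotopy {X : Type*} [MetricSpace X] {P : Set (Set X)}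
    (hc : LocallyUniformlyContractible (fun M : P => (M : Set X))) {ε : ℝ} (hε : 0 < ε) :
    ∃ δ, 0 < δ ∧ δ ≤ ε ∧ ∀ M ∈ P, ∀ m ∈ M, ∀ (a b : X) (p q : Path a b),
      (∀ t, p t ∈ M ∧ dist (p t) m < δ) → (∀ t, q t ∈ M ∧ dist (q t) m < δ) →
        ∃ F : p.Homotopy q, ∀ z, F z ∈ M ∧ dist (F z) m < ε := by
  obtain ⟨δ, hδ, hle, h⟩ := hc ε hε
  refine ⟨δ, hδ, hle, fun M hM m hm a b p q hp hq => ?_⟩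
  have h1 := h ⟨M, hM⟩ ⟨m, hm⟩
  have hpa := hp 0
  have hpb := hp 1
  rw [p.source] at hpa
  rw [p.target] at hpb
  let B := Metric.ball (⟨m, hm⟩ : M) δ
  let p' : Path (⟨⟨a, hpa.1⟩, hpa.2⟩ : B) ⟨⟨b, hpb.1⟩, hpb.2⟩ :=
    (p.restrictCod M fun t => (hp t).1).restrictCod B fun t => (hp t).2
  let q' : Path (⟨⟨a, hpa.1⟩, hpa.2⟩ : B) ⟨⟨b, hpb.1⟩, hpb.2⟩ :=
    (q.restrictCod M fun t => (hq t).1).restrictCod B fun t => (hq t).2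
  obtain ⟨F⟩ := nullhomotopic_map_homotopic h1 p' q'
  let ι : C(Metric.ball (⟨m, hm⟩ : M) ε, X) := ⟨fun z => ((z : M) : X), by fun_prop⟩
  exact ⟨F.map ι, fun z => ⟨(F z).1.2, (F z).2⟩⟩

end HomotopyClasses

/-! ### Simultaneous small choices, and gluing of homotopies over gaps -/

section Gaps

open Set
open scoped unitInterval
open Path.Homotopic.Quotient

/-- If objects of small size admit good choices, then there is a uniform choice which is good for
all objects of small size. -/
theorem exists_controlled_choice {α : Type*} {β : α → Type*} [∀ a, Nonempty (β a)] (size : α → ℝ)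
    (hpos : ∀ a, 0 < size a) (good : ∀ a, β a → ℝ → Prop)
    (mono : ∀ a b ε ε', good a b ε → ε ≤ ε' → good a b ε')
    (h : ∀ ε > 0, ∃ δ > 0, ∀ a, size a < δ → ∃ b, good a b ε) :
    ∃ F : ∀ a, β a, ∀ ε > 0, ∃ δ > 0, ∀ a, size a < δ → good a (F a) ε := by
  -- The choice is optimal up to the slack `size a`: the slack is positive, so the infimum need not
  -- be attained, and it vanishes in the limit of small objects.
  have key : ∀ a, ∃ b : β a, ∀ ε > 0, (∃ b', good a b' ε) → good a b (ε + size a) := by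
    intro a
    let S : Set ℝ := {ε | 0 < ε ∧ ∃ b, good a b ε}
    by_cases hS : S.Nonempty
    · obtain ⟨η, ⟨-, b, hb⟩, hη⟩ := Real.lt_sInf_add_pos hS (hpos a)
      refine ⟨b, fun ε hε hε' => mono _ _ _ _ hb (hη.le.trans ?_)⟩
      have : sInf S ≤ ε := csInf_le ⟨0, fun x hx => hx.1.le⟩ ⟨hε, hε'⟩
      linarith
    · exact ⟨Classical.arbitrary _, fun ε hε hε' => (hS ⟨ε, hε, hε'⟩).elim⟩
  choose F hF using key
  refine ⟨F, fun ε hε => ?_⟩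
  obtain ⟨δ, hδ, hδ'⟩ := h (ε / 2) (by linarith)
  refine ⟨min δ (ε / 2), lt_min hδ (by linarith), fun a ha => ?_⟩
  refine mono _ _ _ _ (hF a (ε / 2) (by linarith) (hδ' a (ha.trans_le (min_le_left _ _)))) ?_
  linarith [ha.trans_le (min_le_right δ (ε / 2))]

section Bigon

/-- A maximal interval on which `f` and `g` differ. -/
structure IsGap {X : Type*} (f g : ℝ → X) (L l r : ℝ) : Prop where
  nonneg : 0 ≤ l
  lt : l < r
  le : r ≤ L
  left : f l = g l
  right : f r = g r
  ne : ∀ s ∈ Ioo l r, f s ≠ g s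

section

variable {X : Type*} {f g : ℝ → X} {L : ℝ}

theorem IsGap.le_of_eq {l r s t : ℝ} (h : IsGap f g L l r) (ht : t ∈ Ioo l r) (hs : f s = g s) :
    (s ≤ t → s ≤ l) ∧ (t ≤ s → r ≤ s) := by
  constructor
  · intro hst
    by_contra! h'
    exact h.ne s ⟨h', hst.trans_lt ht.2⟩ hs
  · intro hst
    by_contra! h'
    exact h.ne s ⟨ht.1.trans_le hst, h'⟩ hs

theorem IsGap.unique {l r l' r' s : ℝ} (h : IsGap f g L l r) (h' : IsGap f g L l' r')
    (hs : s ∈ Ioo l r) (hs' : s ∈ Ioo l' r') : l = l' ∧ r = r' :=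
  ⟨le_antisymm ((h'.le_of_eq hs' h.left).1 hs.1.le) ((h.le_of_eq hs h'.left).1 hs'.1.le),
    le_antisymm ((h.le_of_eq hs h'.right).2 hs'.2.le) ((h'.le_of_eq hs' h.right).2 hs.2.le)⟩

end

variable {X : Type*} [MetricSpace X] {f g : ℝ → X} {L : ℝ}

theorem exists_isGap (hf : Continuous f) (hg : Continuous g) (h0 : f 0 = g 0) (hL : f L = g L)
    {s : ℝ} (hs : s ∈ Icc 0 L) (hne : f s ≠ g s) : ∃ l r, IsGap f g L l r ∧ s ∈ Ioo l r := by
  have hc : Continuous fun s => (f s, g s) := hf.prodMk hg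
  obtain ⟨l, hl, hle, hl'⟩ := (hc.continuousOn (s := Icc 0 s)).exists_last isClosed_diagonal
    ⟨0, ⟨le_rfl, hs.1⟩, h0⟩
  obtain ⟨r, hr, hre, hr'⟩ := (hc.continuousOn (s := Icc s L)).exists_first isClosed_diagonal
    ⟨L, ⟨hs.2, le_rfl⟩, hL⟩
  simp only [mem_diagonal_iff] at hle hl' hre hr'
  have h1 : l < s := lt_of_le_of_ne hl.2 (by rintro rfl; exact hne hle)
  have h2 : s < r := lt_of_le_of_ne hr.1 (by rintro rfl; exact hne hre)
  refine ⟨l, r, ⟨hl.1, h1.trans h2, hr.2, hle, hre, fun t ht e => ?_⟩, h1, h2⟩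
  rcases le_total t s with h | h
  · linarith [ht.1, hl' t ⟨hl.1.trans ht.1.le, h⟩ e]
  · linarith [ht.2, hr' t ⟨h, ht.2.le.trans hr.2⟩ e]

/-- Homotopies over the gaps glue to a homotopy if they are small over small gaps. -/
theorem exists_homotopy_of_gaps {a b : X} (hf : Continuous f) (hg : Continuous g) (hfa : f 0 = a)
    (hfb : f L = b) (hga : g 0 = a) (hgb : g L = b) (hL0 : 0 ≤ L) (K : ℝ → ℝ → I × ℝ → X)
    (Kcont : ∀ l r, IsGap f g L l r → Continuous (K l r))
    (Kleft : ∀ l r, IsGap f g L l r → ∀ t, K l r (t, l) = f l)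
    (Kright : ∀ l r, IsGap f g L l r → ∀ t, K l r (t, r) = f r)
    (Kzero : ∀ l r, IsGap f g L l r → ∀ s ∈ Icc l r, K l r (0, s) = f s)
    (Kone : ∀ l r, IsGap f g L l r → ∀ s ∈ Icc l r, K l r (1, s) = g s)
    (Ksmall : ∀ ε > 0, ∃ δ > 0, ∀ l r, IsGap f g L l r → r - l < δ →
      ∀ t, ∀ s ∈ Icc l r, dist (K l r (t, s)) (f l) < ε) {S : Set X} (hS : ∀ s ∈ Icc 0 L, f s ∈ S)
    (KS : ∀ l r, IsGap f g L l r → ∀ t, ∀ s ∈ Icc l r, K l r (t, s) ∈ S) :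
    ∃ F : (segPath f hf 0 L hfa hfb).Homotopy (segPath g hg 0 L hga hgb), ∀ z, F z ∈ S := by
  classical
  have h0 : f 0 = g 0 := hfa.trans hga.symm
  have hL : f L = g L := hfb.trans hgb.symm
  -- The given homotopy over each gap, and the constant one where `f` and `g` agree.
  let D : I × ℝ → X := fun z =>
    if h : ∃ o : ℝ × ℝ, IsGap f g L o.1 o.2 ∧ z.2 ∈ Ioo o.1 o.2 then K h.choose.1 h.choose.2 z
      else f z.2
  have Dgap' : ∀ l r, IsGap f g L l r → ∀ z : I × ℝ, z.2 ∈ Ioo l r → D z = K l r z := by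
    intro l r ho z hz
    have h : ∃ o : ℝ × ℝ, IsGap f g L o.1 o.2 ∧ z.2 ∈ Ioo o.1 o.2 := ⟨(l, r), ho, hz⟩
    have e := h.choose_spec.1.unique ho h.choose_spec.2 hz
    simp only [D, dif_pos h, e.1, e.2]
  have Deq : ∀ z : I × ℝ, f z.2 = g z.2 → D z = f z.2 := by
    intro z hz
    have h : ¬ ∃ o : ℝ × ℝ, IsGap f g L o.1 o.2 ∧ z.2 ∈ Ioo o.1 o.2 := by
      rintro ⟨o, ho, hzo⟩
      exact ho.ne _ hzo hz
    simp only [D, dif_neg h]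
  have Dgap : ∀ l r, IsGap f g L l r → ∀ z : I × ℝ, z.2 ∈ Icc l r → D z = K l r z := by
    rintro l r ho ⟨t, s⟩ hz
    rcases hz.1.eq_or_lt with rfl | h1
    · rw [Deq (t, l) ho.left, Kleft l r ho]
    rcases hz.2.eq_or_lt with rfl | h2
    · rw [Deq (t, s) ho.right, Kright l _ ho]
    exact Dgap' l r ho _ ⟨h1, h2⟩
  have Dcont : ContinuousOn D (univ ×ˢ Icc 0 L) := by
    rintro ⟨t₀, s₀⟩ ⟨-, hs₀⟩
    by_cases hne : f s₀ = g s₀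
    swap
    · obtain ⟨l, r, ho, hsr⟩ := exists_isGap hf hg h0 hL hs₀ hne
      refine ContinuousAt.continuousWithinAt ?_
      refine (Kcont l r ho).continuousAt.congr ?_
      have : ∀ᶠ z : I × ℝ in nhds (t₀, s₀), z.2 ∈ Ioo l r :=
        continuous_snd.continuousAt.eventually (Ioo_mem_nhds hsr.1 hsr.2)
      filter_upwards [this] with z hz
      exact (Dgap' l r ho z hz).symm
    refine Metric.tendsto_nhds.2 fun ε hε => ?_
    simp only [Deq (t₀, s₀) hne]
    obtain ⟨δ, hδ, hsmall⟩ := Ksmall (ε / 2) (by linarith)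
    obtain ⟨η, hη, hfη⟩ := Metric.continuous_iff.1 hf s₀ (ε / 2) (by linarith)
    have hgapright : ∀ᶠ z : I × ℝ in nhds (t₀, s₀),
        z.2 ∈ Icc 0 L → s₀ ≤ z.2 → dist (D z) (f s₀) < ε := by
      have ev : ∀ v, s₀ < v → ∀ᶠ z : I × ℝ in nhds (t₀, s₀), z.2 < v := fun v hv =>
        continuous_snd.continuousAt.eventually (Iio_mem_nhds hv)
      -- Either a coincidence time follows within `δ`, so that all gaps between it and `s₀` are
      -- short and their homotopies small, or (unless `s₀ = L`) `s₀` is the left end of a gap and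
      -- the continuity of that single homotopy suffices.
      by_cases he : ∃ e ∈ Ioo s₀ (s₀ + δ), f e = g e
      · obtain ⟨e, he, hfe⟩ := he
        filter_upwards [ev e he.1, ev (s₀ + η) (by linarith)] with z hz hzη hzL hz0
        by_cases hzne : f z.2 = g z.2
        · rw [Deq z hzne]
          have := hfη z.2 (by rw [Real.dist_eq, abs_of_nonneg (by linarith)]; linarith)
          linarith
        · obtain ⟨l, r, ho, hzo⟩ := exists_isGap hf hg h0 hL hzL hzne
          have h1 := (ho.le_of_eq hzo hne).1 hz0
          have h2 := (ho.le_of_eq hzo hfe).2 hz.le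
          rw [Dgap' l r ho z hzo]
          have h3 := hsmall l r ho (by linarith [he.2]) z.1 z.2 ⟨hzo.1.le, hzo.2.le⟩
          have h4 := hfη l (by rw [Real.dist_eq, abs_of_nonneg (by linarith)]; linarith [hzo.1])
          linarith [dist_triangle (K l r z) (f l) (f s₀)]
      · push Not at he
        rcases hs₀.2.eq_or_lt with hsL | hsL
        · refine Filter.Eventually.of_forall fun z hz hz0 => ?_
          have : z.2 = s₀ := le_antisymm (hz.2.trans hsL.ge) hz0
          rw [Deq z (by rw [this]; exact hne), this, dist_self]
          exact hε
        · set s₁ := min (s₀ + δ / 2) L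
          have h1 : s₀ < s₁ := lt_min (by linarith) hsL
          have h2 : s₁ < s₀ + δ := (min_le_left _ _).trans_lt (by linarith)
          obtain ⟨l, r, ho, hzo⟩ := exists_isGap hf hg h0 hL (s := s₁)
            ⟨hs₀.1.trans h1.le, min_le_right _ _⟩ (he s₁ ⟨h1, h2⟩)
          have h3 := (ho.le_of_eq hzo hne).1 h1.le
          have h4 : s₀ = l := by
            by_contra h
            exact he l ⟨lt_of_le_of_ne h3 h, hzo.1.trans h2⟩ ho.left
          subst h4
          have h5 : ∀ᶠ z in nhds (t₀, s₀), dist (K s₀ r z) (K s₀ r (t₀, s₀)) < ε :=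
            Metric.tendsto_nhds.1 (Kcont s₀ r ho).continuousAt ε hε
          rw [Kleft s₀ r ho] at h5
          filter_upwards [h5, ev r ho.lt] with z hz hzr hzL hz0
          rwa [Dgap s₀ r ho z ⟨hz0, hzr.le⟩]
    have hgapleft : ∀ᶠ z : I × ℝ in nhds (t₀, s₀),
        z.2 ∈ Icc 0 L → z.2 ≤ s₀ → dist (D z) (f s₀) < ε := by
      have ev : ∀ v, v < s₀ → ∀ᶠ z : I × ℝ in nhds (t₀, s₀), v < z.2 := fun v hv =>
        continuous_snd.continuousAt.eventually (Ioi_mem_nhds hv)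
      -- Homotopies over short gaps are close to `f l`. On this side of `s₀` the point `l` is the
      -- far end of the gap, so it too must be within `η` of `s₀`.
      set δ' := min δ η
      have hδ' : 0 < δ' := lt_min hδ hη
      by_cases he : ∃ e ∈ Ioo (s₀ - δ') s₀, f e = g e
      · obtain ⟨e, he, hfe⟩ := he
        filter_upwards [ev e he.2, ev (s₀ - η) (by linarith)] with z hz hzη hzL hz0
        by_cases hzne : f z.2 = g z.2
        · rw [Deq z hzne]
          have := hfη z.2 (by rw [Real.dist_eq, abs_of_nonpos (by linarith)]; linarith)
          linarith
        · obtain ⟨l, r, ho, hzo⟩ := exists_isGap hf hg h0 hL hzL hzne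
          have h1 := (ho.le_of_eq hzo hne).2 hz0
          have h2 := (ho.le_of_eq hzo hfe).1 hz.le
          rw [Dgap' l r ho z hzo]
          have h3 := hsmall l r ho (by linarith [he.1, min_le_left δ η]) z.1 z.2
            ⟨hzo.1.le, hzo.2.le⟩
          have h4 := hfη l (by
            rw [Real.dist_eq, abs_of_nonpos (by linarith [ho.lt])]
            linarith [he.1, min_le_right δ η])
          linarith [dist_triangle (K l r z) (f l) (f s₀)]
      · push Not at he
        rcases hs₀.1.eq_or_lt with hsL | hsL
        · refine Filter.Eventually.of_forall fun z hz hz0 => ?_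
          have : z.2 = s₀ := le_antisymm hz0 (hsL.ge.trans hz.1)
          rw [Deq z (by rw [this]; exact hne), this, dist_self]
          exact hε
        · set s₁ := max (s₀ - δ' / 2) 0
          have h1 : s₁ < s₀ := max_lt (by linarith) hsL
          have h2 : s₀ - δ' < s₁ := lt_of_lt_of_le (by linarith) (le_max_left _ _)
          obtain ⟨l, r, ho, hzo⟩ := exists_isGap hf hg h0 hL (s := s₁)
            ⟨le_max_right _ _, h1.le.trans hs₀.2⟩ (he s₁ ⟨h2, h1⟩)
          have h3 := (ho.le_of_eq hzo hne).2 h1.le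
          have h4 : s₀ = r := by
            by_contra h
            exact he r ⟨h2.trans hzo.2, lt_of_le_of_ne h3 (Ne.symm h)⟩ ho.right
          subst h4
          have h5 : ∀ᶠ z in nhds (t₀, s₀), dist (K l s₀ z) (K l s₀ (t₀, s₀)) < ε :=
            Metric.tendsto_nhds.1 (Kcont l s₀ ho).continuousAt ε hε
          rw [Kright l s₀ ho] at h5
          filter_upwards [h5, ev l ho.lt] with z hz hzr hzL hz0
          rwa [Dgap l s₀ ho z ⟨hzr.le, hz0⟩]
    filter_upwards [nhdsWithin_le_nhds hgapright, nhdsWithin_le_nhds hgapleft, self_mem_nhdsWithin]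
      with z h1 h2 hz
    rcases le_total s₀ z.2 with h | h
    · exact h1 hz.2 h
    · exact h2 hz.2 h
  have mem : ∀ z : I × I, (z.1, 0 + (z.2 : ℝ) * (L - 0)) ∈ (univ : Set I) ×ˢ Icc 0 L := by
    intro z
    refine ⟨mem_univ _, ?_, ?_⟩
    · simpa using mul_nonneg z.2.2.1 hL0
    · simpa using mul_le_of_le_one_left hL0 z.2.2.2
  have Dzero : ∀ s ∈ Icc 0 L, D (0, s) = f s := by
    intro s hs
    by_cases hne : f s = g s
    · exact Deq (0, s) hne
    · obtain ⟨l, r, ho, hso⟩ := exists_isGap hf hg h0 hL hs hne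
      rw [Dgap' l r ho _ hso, Kzero l r ho s ⟨hso.1.le, hso.2.le⟩]
  have Done : ∀ s ∈ Icc 0 L, D (1, s) = g s := by
    intro s hs
    by_cases hne : f s = g s
    · rw [Deq (1, s) hne, hne]
    · obtain ⟨l, r, ho, hso⟩ := exists_isGap hf hg h0 hL hs hne
      rw [Dgap' l r ho _ hso, Kone l r ho s ⟨hso.1.le, hso.2.le⟩]
  have Dc : Continuous fun z : I × I => D (z.1, 0 + (z.2 : ℝ) * (L - 0)) :=
    Dcont.comp_continuous (by fun_prop) mem
  refine ⟨⟨⟨⟨_, Dc⟩, fun r => ?_, fun r => ?_⟩, ?_⟩, ?_⟩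
  · exact Dzero _ (mem (0, r)).2
  · exact Done _ (mem (0, r)).2
  · rintro t r (rfl | hr)
    · simp [segPath, Deq (t, 0) h0]
    · rw [mem_singleton_iff] at hr
      subst hr
      simp [segPath, Deq (t, L) hL]
  · intro z
    show D (z.1, 0 + (z.2 : ℝ) * (L - 0)) ∈ S
    have hm := (mem z).2
    generalize 0 + (z.2 : ℝ) * (L - 0) = s at hm
    by_cases hne : f s = g s
    · rw [Deq (z.1, s) hne]
      exact hS s hm
    · obtain ⟨l, r, ho, hso⟩ := exists_isGap hf hg h0 hL hm hne
      rw [Dgap' l r ho _ hso]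
      exact KS l r ho _ s ⟨hso.1.le, hso.2.le⟩

end Bigon

end Gaps

/-! ### Homotopy classes of geodesics, and contraction of short bigons -/

section GeodesicClasses

open Set
open scoped unitInterval
open Path.Homotopic.Quotient

section GeodClass

variable {Y : Type*} [MetricSpace Y] {a b c : Y}

/-- The homotopy class of a geodesic. -/
def IsGeodClass (C : Path.Homotopic.Quotient a b) : Prop :=
  ∃ (f : ℝ → Y) (hf : Continuous f) (h : IsGeod f a b),
    C = seg f hf 0 (dist a b) h.map_zero h.map_dist

theorem seg_param {Y : Type*} [TopologicalSpace Y] {a b : Y} {f : ℝ → Y} {hf : Continuous f}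
    {s t s' t' : ℝ} {hs : f s = a} {ht : f t = b} (h1 : s = s') (h2 : t = t') :
    seg f hf s t hs ht = seg f hf s' t' (h1 ▸ hs) (h2 ▸ ht) := by
  subst h1 h2; rfl

theorem IsGeod.isGeodClass_seg {f : ℝ → Y} {hf : Continuous f} (h : IsGeod f a b) :
    IsGeodClass (seg f hf 0 (dist a b) h.map_zero h.map_dist) := ⟨f, hf, h, rfl⟩

theorem IsGeod.isGeodClass_sub {f : ℝ → Y} {hf : Continuous f} (h : IsGeod f a b) {s t : ℝ}
    (hs : 0 ≤ s) (hst : s ≤ t) (ht : t ≤ dist a b) {u v : Y} {hu : f s = u} {hv : f t = v} :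
    IsGeodClass (seg f hf s t hu hv) := by
  subst hu hv
  refine ⟨fun r => f (s + r), by fun_prop, h.sub hs hst ht, ?_⟩
  rw [seg_comp (φ := fun r => s + r) (hf := hf) (by fun_prop)]
  exact seg_param (by simp) (by rw [h.dist_of_le hs hst ht]; ring)

theorem IsGeodClass.symm {C : Path.Homotopic.Quotient a b} (h : IsGeodClass C) :
    IsGeodClass C.symm := by
  obtain ⟨f, hf, h, rfl⟩ := h
  refine ⟨fun r => f (dist a b - r), by fun_prop, h.rev, ?_⟩
  rw [seg_comp (φ := fun r => dist a b - r) (hf := hf) (by fun_prop), seg_symm]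
  exact seg_param (by simp) (by simp [dist_comm b a])

theorem IsGeodClass.trans {C : Path.Homotopic.Quotient a b} {D : Path.Homotopic.Quotient b c}
    (hC : IsGeodClass C) (hD : IsGeodClass D) (h : dist a c = dist a b + dist b c) :
    IsGeodClass (C.trans D) := by
  obtain ⟨f, hf, gf, rfl⟩ := hC
  obtain ⟨g, hg, gg, rfl⟩ := hD
  have hc : Continuous (fun r => if r ≤ dist a b then f r else g (r - dist a b)) :=
    Continuous.if_le hf (hg.comp (continuous_id.sub continuous_const)) continuous_id
      continuous_const fun r hr => by
        simp [show r = dist a b from hr, gf.map_dist, gg.map_zero]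
  have G := gf.concat gg h
  refine ⟨_, hc, G, ?_⟩
  have hm : (fun r => if r ≤ dist a b then f r else g (r - dist a b)) (dist a b) = b := by
    simp [gf.map_dist]
  rw [← seg_trans (t := dist a b) (hf := hc) (ht := hm)]
  congr 1
  · refine seg_congr fun r hr => ?_
    rw [uIcc_of_le dist_nonneg] at hr
    simp [hr.2]
  · have e : seg g hg 0 (dist b c) gg.map_zero gg.map_dist
        = seg (fun r => g (r - dist a b)) (hg.comp (continuous_id.sub continuous_const))
          (dist a b) (dist a c) (by simp [gg.map_zero]) (by simp [h, gg.map_dist]) := by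
      rw [seg_comp (φ := fun r => r - dist a b) (hf := hg) (by fun_prop)]
      exact seg_param (by simp) (by simp [h])
    rw [e]
    refine seg_congr fun r hr => ?_
    rw [uIcc_of_le (by rw [h]; linarith [dist_nonneg (x := b) (y := c)])] at hr
    rcases hr.1.eq_or_lt with rfl | hlt
    · simp [gf.map_dist, gg.map_zero]
    · simp [not_le.2 hlt]

theorem IsGeodClass.eq_refl {C : Path.Homotopic.Quotient a a} (h : IsGeodClass C) : C = refl a := by
  obtain ⟨f, hf, h, rfl⟩ := h
  rw [seg_param rfl (dist_self a), seg_self]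

theorem IsGeodClass.map_val {X : Type*} [MetricSpace X] {S : Set X} {a b : S}
    {C : Path.Homotopic.Quotient a b} (h : IsGeodClass C) :
    IsGeodClass (C.map (⟨Subtype.val, continuous_subtype_val⟩ : C(S, X))) := by
  obtain ⟨f, hf, h, rfl⟩ := h
  exact ⟨fun r => f r, continuous_subtype_val.comp hf,
    ⟨fun u hu v hv => h.isGeodesicOn u hu v hv, congrArg _ h.map_zero, congrArg _ h.map_dist⟩, rfl⟩

end GeodClass

variable {X : Type*} [MetricSpace X]

namespace IsTreeGraded

variable {P : Set (Set X)} (hP : IsTreeGraded X P)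
include hP

theorem exists_continuous_isGeod (a b : X) : ∃ f : ℝ → X, Continuous f ∧ IsGeod f a b ∧
    ∀ r, ∃ s ∈ Icc 0 (dist a b), f r = f s := by
  obtain ⟨f, hf⟩ := hP.exists_isGeod a b
  refine ⟨_, hf.continuous_clamp, hf.clamp, fun r => ⟨projIcc 0 (dist a b) dist_nonneg r,
    (projIcc 0 (dist a b) dist_nonneg r).2, ?_⟩⟩
  simp

theorem exists_continuous_isGeod_subtype {S : Set X} {a b : S}
    (hS : ∀ m, dist (a : X) m + dist m b = dist a b → m ∈ S) :
    ∃ f : ℝ → S, Continuous f ∧ IsGeod f a b := by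
  obtain ⟨f, hf, h, hr⟩ := hP.exists_continuous_isGeod (a : X) b
  have hm : ∀ r, f r ∈ S := fun r => by
    obtain ⟨s, hs, e⟩ := hr r
    rw [e]
    refine hS _ ?_
    rw [h.dist_left hs, h.dist_right hs, Subtype.dist_eq]
    ring
  exact ⟨fun r => ⟨f r, hm r⟩, hf.subtype_mk hm, fun u hu v hv => h.isGeodesicOn u hu v hv,
    Subtype.ext h.map_zero, Subtype.ext h.map_dist⟩

theorem exists_isGeodClass (a b : X) : ∃ C : Path.Homotopic.Quotient a b, IsGeodClass C := by
  obtain ⟨f, hf, h, -⟩ := hP.exists_continuous_isGeod a b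
  exact ⟨_, f, hf, h, rfl⟩

theorem between_mem_piece {M : Set X} (hM : M ∈ P) {u v m : X} (hu : u ∈ M) (hv : v ∈ M)
    (h : dist u m + dist m v = dist u v) : m ∈ M := by
  obtain ⟨f, hf⟩ := hP.exists_isGeod u m
  obtain ⟨g, hg⟩ := hP.exists_isGeod m v
  have := hP.geod_mem_piece hM hu hv (hf.concat hg h.symm) (s := dist u m)
    ⟨dist_nonneg, by linarith [dist_nonneg (x := m) (y := v)]⟩
  simpa [hf.map_dist] using this

theorem exists_isGeodClass_piece {M : Set X} (hM : M ∈ P) (a b : M) :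
    ∃ C : Path.Homotopic.Quotient a b, IsGeodClass C := by
  obtain ⟨f, hf, h⟩ := hP.exists_continuous_isGeod_subtype (a := a) (b := b)
    fun m => hP.between_mem_piece hM a.2 b.2
  exact ⟨_, f, hf, h, rfl⟩

/-- Short geodesics with the same ends are homotopic by small homotopies. -/
theorem exists_bigon_homotopy (hc : LocallyUniformlyContractible (fun M : P => (M : Set X)))
    {ε : ℝ} (hε : 0 < ε) :
    ∃ δ, 0 < δ ∧ δ ≤ ε ∧ ∀ (a b : X) (f g : ℝ → X) (cf : Continuous f) (cg : Continuous g)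
      (hf : IsGeod f a b) (hg : IsGeod g a b), dist a b < δ →
      ∃ F : (segPath f cf 0 (dist a b) hf.map_zero hf.map_dist).Homotopy
        (segPath g cg 0 (dist a b) hg.map_zero hg.map_dist), ∀ z, dist (F z) a < ε := by
  obtain ⟨δ₀, hδ₀, -, h₀⟩ := hc.exists_homotopy (half_pos hε)
  refine ⟨min δ₀ (ε / 2), lt_min hδ₀ (by linarith), (min_le_right _ _).trans (by linarith), ?_⟩
  intro a b f g cf cg hf hg hlt
  have hL1 : dist a b < δ₀ := hlt.trans_le (min_le_left _ _)
  have hL2 : dist a b < ε / 2 := hlt.trans_le (min_le_right _ _)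
  have e0 : f 0 = g 0 := hf.map_zero.trans hg.map_zero.symm
  -- The bound `ε / 2` is built into the admissible fillings, so that large gaps too are filled near
  -- `a`; smallness over small gaps is achieved by the controlled choice.
  let β : {o : ℝ × ℝ // IsGap f g (dist a b) o.1 o.2} → Type _ := fun o =>
    {F : (segPath f cf o.1.1 o.1.2 rfl rfl).Homotopy
      (segPath g cg o.1.1 o.1.2 o.2.left.symm o.2.right.symm) //
        ∀ z, dist (F z) (f o.1.1) < ε / 2}
  have fill : ∀ η > 0, ∃ δ > 0, ∀ o : {o : ℝ × ℝ // IsGap f g (dist a b) o.1 o.2},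
      o.1.2 - o.1.1 < δ → ∃ F : (segPath f cf o.1.1 o.1.2 rfl rfl).Homotopy
      (segPath g cg o.1.1 o.1.2 o.2.left.symm o.2.right.symm), ∀ z, dist (F z) (f o.1.1) < η := by
    intro η hη
    obtain ⟨δ, hδ, -, h⟩ := hc.exists_homotopy hη
    refine ⟨δ, hδ, ?_⟩
    rintro ⟨⟨l, r⟩, o⟩ hsize
    simp only at hsize ⊢
    obtain ⟨M, hM, hMm⟩ := hP.exists_piece_of_bigon hf.isGeodesicOn hg.isGeodesicOn e0
      o.nonneg o.lt.le o.le o.left o.right o.ne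
    have d1 : ∀ s ∈ Icc l r, dist (f s) (f l) < δ := fun s hs => by
      rw [dist_comm, hf.dist_of_le o.nonneg hs.1 (hs.2.trans o.le)]; linarith [hs.2]
    have d2 : ∀ s ∈ Icc l r, dist (g s) (f l) < δ := fun s hs => by
      rw [o.left, dist_comm, hg.dist_of_le o.nonneg hs.1 (hs.2.trans o.le)]; linarith [hs.2]
    obtain ⟨F, hF⟩ := h M hM (f l) (hMm l ⟨le_rfl, o.lt.le⟩).1 _ _
      (segPath f cf l r rfl rfl) (segPath g cg l r o.left.symm o.right.symm)
      (fun t => by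
        obtain ⟨v, hv, e⟩ := range_segPath (hf := cf) (hs := rfl) (ht := rfl) o.lt.le t
        rw [e]
        exact ⟨(hMm v hv).1, d1 v hv⟩)
      (fun t => by
        obtain ⟨v, hv, e⟩ := range_segPath (hf := cg) (hs := o.left.symm) (ht := o.right.symm)
          o.lt.le t
        rw [e]
        exact ⟨(hMm v hv).2, d2 v hv⟩)
    exact ⟨F, fun z => (hF z).2⟩
  have fill₀ : ∀ o : {o : ℝ × ℝ // IsGap f g (dist a b) o.1 o.2}, Nonempty (β o) := by
    rintro ⟨⟨l, r⟩, o⟩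
    obtain ⟨M, hM, hMm⟩ := hP.exists_piece_of_bigon hf.isGeodesicOn hg.isGeodesicOn e0
      o.nonneg o.lt.le o.le o.left o.right o.ne
    have d1 : ∀ s ∈ Icc l r, dist (f s) (f l) < δ₀ := fun s hs => by
      rw [dist_comm, hf.dist_of_le o.nonneg hs.1 (hs.2.trans o.le)]
      linarith [hs.2, o.nonneg, o.le]
    have d2 : ∀ s ∈ Icc l r, dist (g s) (f l) < δ₀ := fun s hs => by
      rw [o.left, dist_comm, hg.dist_of_le o.nonneg hs.1 (hs.2.trans o.le)]
      linarith [hs.2, o.nonneg, o.le]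
    obtain ⟨F, hF⟩ := h₀ M hM (f l) (hMm l ⟨le_rfl, o.lt.le⟩).1 _ _
      (segPath f cf l r rfl rfl) (segPath g cg l r o.left.symm o.right.symm)
      (fun t => by
        obtain ⟨v, hv, e⟩ := range_segPath (hf := cf) (hs := rfl) (ht := rfl) o.lt.le t
        rw [e]
        exact ⟨(hMm v hv).1, d1 v hv⟩)
      (fun t => by
        obtain ⟨v, hv, e⟩ := range_segPath (hf := cg) (hs := o.left.symm) (ht := o.right.symm)
          o.lt.le t
        rw [e]
        exact ⟨(hMm v hv).2, d2 v hv⟩)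
    exact ⟨⟨F, fun z => (hF z).2⟩⟩
  obtain ⟨F, hF⟩ := exists_controlled_choice (β := β) (fun o => o.1.2 - o.1.1)
    (fun o => sub_pos.2 o.2.lt) (fun o F η => ∀ z, dist (F.1 z) (f o.1.1) < η)
    (fun o F η η' h hle z => (h z).trans_le hle)
    (by
      intro η hη
      -- The minimum with `ε / 2` makes the small filling an admissible one.
      obtain ⟨δ, hδ, h⟩ := fill (min η (ε / 2)) (lt_min hη (by linarith))
      refine ⟨δ, hδ, fun o ho => ?_⟩
      obtain ⟨F, hF⟩ := h o ho
      exact ⟨⟨F, fun z => (hF z).trans_le (min_le_right _ _)⟩,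
        fun z => (hF z).trans_le (min_le_left _ _)⟩)
  dsimp only [β] at F hF
  classical
  let K : ℝ → ℝ → I × ℝ → X := fun l r z =>
    if h : IsGap f g (dist a b) l r then
      (F ⟨(l, r), h⟩).1 (z.1, projIcc 0 1 zero_le_one ((z.2 - l) / (r - l))) else a
  have K1 : ∀ l r (h : IsGap f g (dist a b) l r), K l r = fun z =>
      (F ⟨(l, r), h⟩).1 (z.1, projIcc 0 1 zero_le_one ((z.2 - l) / (r - l))) := fun l r h => by
    funext z; simp only [K, dif_pos h]
  have hproj : ∀ l r (_ : IsGap f g (dist a b) l r) (s : ℝ), s ∈ Icc l r →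
      l + (projIcc (0 : ℝ) 1 zero_le_one ((s - l) / (r - l)) : ℝ) * (r - l) = s := by
    intro l r h s hs
    have hrl := sub_pos.2 h.lt
    rw [projIcc_of_mem zero_le_one ⟨div_nonneg (by linarith [hs.1]) hrl.le,
      (div_le_one hrl).2 (by linarith [hs.2])⟩]
    field_simp
    ring
  obtain ⟨H, hH⟩ := exists_homotopy_of_gaps (S := {z | dist z a < ε}) cf cg hf.map_zero
    hf.map_dist hg.map_zero hg.map_dist dist_nonneg K
    (fun l r h => by rw [K1 l r h]; fun_prop)
    (fun l r h t => by rw [K1 l r h]; simp)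
    (fun l r h t => by
      rw [K1 l r h]
      simp [div_self (sub_pos.2 h.lt).ne'])
    (fun l r h s hs => by
      rw [K1 l r h]
      simp only [ContinuousMap.HomotopyWith.apply_zero]
      exact congrArg f (hproj l r h s hs))
    (fun l r h s hs => by
      rw [K1 l r h]
      simp only [ContinuousMap.HomotopyWith.apply_one]
      exact congrArg g (hproj l r h s hs))
    (fun η hη => by
      obtain ⟨δ, hδ, h⟩ := hF η hη
      refine ⟨δ, hδ, fun l r ho hlr t s hs => ?_⟩
      rw [K1 l r ho]
      exact h ⟨(l, r), ho⟩ hlr _)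
    (fun s hs => by
      show dist (f s) a < ε
      rw [dist_comm, hf.dist_left hs]
      linarith [hs.2])
    (fun l r h t s hs => by
      rw [K1 l r h]
      show dist _ a < ε
      have h1 := (F ⟨(l, r), h⟩).2 (t, projIcc 0 1 zero_le_one ((s - l) / (r - l)))
      have h2 := hf.dist_left (s := l) ⟨h.nonneg, h.lt.le.trans h.le⟩
      simp only at h1 ⊢
      linarith [dist_triangle ((F ⟨(l, r), h⟩).1 (t, projIcc 0 1 zero_le_one ((s - l) / (r - l))))
        (f l) a, dist_comm a (f l), h.lt, h.le])
  exact ⟨H, hH⟩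

end IsTreeGraded

end GeodesicClasses

/-! ### Contraction of short triangles -/

section Triangles

open Set
open scoped unitInterval
open Path.Homotopic.Quotient

variable {X : Type*} [MetricSpace X]

namespace IsTreeGraded

variable {P : Set (Set X)} (hP : IsTreeGraded X P)
include hP

/-- Short geodesic triangles are null-homotopic by small homotopies. -/
theorem exists_triangle_homotopy (hc : LocallyUniformlyContractible (fun M : P => (M : Set X)))
    {ε : ℝ} (hε : 0 < ε) :
    ∃ δ, 0 < δ ∧ ∀ (a b c : X) (f g h : ℝ → X) (cf : Continuous f) (cg : Continuous g)
      (ch : Continuous h) (hf : IsGeod f a c) (hg : IsGeod g a b) (hh : IsGeod h b c),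
      dist a b < δ → dist a c < δ →
      ∃ F : (segPath f cf 0 (dist a c) hf.map_zero hf.map_dist).Homotopy
        ((segPath g cg 0 (dist a b) hg.map_zero hg.map_dist).trans
          (segPath h ch 0 (dist b c) hh.map_zero hh.map_dist)), ∀ z, dist (F z) a < ε := by
  obtain ⟨δ₁, hδ₁, -, bigon⟩ := hP.exists_bigon_homotopy hc (half_pos hε)
  obtain ⟨δ₂, hδ₂, -, contr⟩ := hc.exists_homotopy (half_pos hε)
  -- All vertices will be within `η` of `a`; the factor `8` leaves room for the few triangle
  -- inequalities below.
  obtain ⟨η, hη, h1, h2, h3⟩ : ∃ η, 0 < η ∧ 8 * η < δ₁ ∧ 8 * η < δ₂ ∧ 8 * η < ε := by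
    refine ⟨min (min δ₁ δ₂) ε / 9, by positivity, ?_, ?_, ?_⟩ <;>
      linarith [min_le_left (min δ₁ δ₂) ε, min_le_right (min δ₁ δ₂) ε, min_le_left δ₁ δ₂,
        min_le_right δ₁ δ₂, lt_min (lt_min hδ₁ hδ₂) hε]
  refine ⟨η, hη, ?_⟩
  intro a b c f g h cf cg ch hf hg hh hab hac
  obtain ⟨M, hM, u, huM, v, hvM, w, hwM, e1, e2, e3⟩ := hP.exists_center a b c
  -- All classes are taken in this ball, so that the algebra of classes produces a homotopy which
  -- stays near `a`.
  let S : Set X := Metric.ball a ε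
  have near : ∀ {p q : X}, dist p a < η → dist q a < η → dist p q < 2 * η := by
    intro p q hp hq
    linarith [dist_triangle_right p q a]
  have mem : ∀ {p q r : X}, dist p a < η → dist q a < η → dist p r + dist r q = dist p q →
      r ∈ S := by
    intro p q r hp hq hr
    have := near hp hq
    show dist r a < ε
    linarith [dist_triangle r p a, dist_comm r p, dist_nonneg (x := r) (y := q)]
  have uniq : ∀ {p q : S}, dist (p : X) a < η → dist (q : X) a < η →
      ∀ {C D : Path.Homotopic.Quotient p q}, IsGeodClass C → IsGeodClass D → C = D := by
    rintro p q hp hq C D ⟨f, cf, hf, rfl⟩ ⟨g, cg, hg, rfl⟩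
    have vf : IsGeod (fun r => (f r : X)) p q := ⟨fun u hu v hv => hf.isGeodesicOn u hu v hv,
      congrArg _ hf.map_zero, congrArg _ hf.map_dist⟩
    have vg : IsGeod (fun r => (g r : X)) p q := ⟨fun u hu v hv => hg.isGeodesicOn u hu v hv,
      congrArg _ hg.map_zero, congrArg _ hg.map_dist⟩
    obtain ⟨F, hF⟩ := bigon p q _ _ (continuous_subtype_val.comp cf)
      (continuous_subtype_val.comp cg) vf vg (by linarith [near hp hq])
    exact Path.Homotopic.Quotient.eq.2 (homotopic_of_homotopy_mem F fun z => by
      have h4 := hF z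
      have h5 := dist_triangle (F z) p a
      exact lt_of_le_of_lt h5 (by linarith))
  have ex : ∀ {p q : S}, dist (p : X) a < η → dist (q : X) a < η →
      ∃ C : Path.Homotopic.Quotient p q, IsGeodClass C := by
    intro p q hp hq
    obtain ⟨f, hf, h⟩ := hP.exists_continuous_isGeod_subtype (a := p) (b := q)
      fun m hm => mem hp hq hm
    exact ⟨_, f, hf, h, rfl⟩
  have piece : ∀ {p q r : S}, (p : X) ∈ M → (q : X) ∈ M → (r : X) ∈ M → dist (p : X) a < η →
      dist (q : X) a < η → dist (r : X) a < η → ∀ {C : Path.Homotopic.Quotient p q}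
      {D : Path.Homotopic.Quotient q r} {E : Path.Homotopic.Quotient p r}, IsGeodClass C →
      IsGeodClass D → IsGeodClass E → C.trans D = E := by
    rintro p q r hpM hqM hrM hp hq hr C D E ⟨f, cf, hf, rfl⟩ ⟨g, cg, hg, rfl⟩ ⟨k, ck, hk, rfl⟩
    have aux : ∀ {p' q' : S}, (p' : X) ∈ M → (q' : X) ∈ M → dist (p' : X) a < η →
        dist (q' : X) a < η → ∀ {f : ℝ → S} {cf : Continuous f} (hf : IsGeod f p' q') (t : I),
        ((segPath f cf 0 (dist p' q') hf.map_zero hf.map_dist t : S) : X) ∈ M ∧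
        dist ((segPath f cf 0 (dist p' q') hf.map_zero hf.map_dist t : S) : X) p < δ₂ := by
      intro p' q' hpM hqM hp' hq' f cf hf t
      obtain ⟨s, hs, e⟩ := range_segPath (hf := cf) (hs := hf.map_zero) (ht := hf.map_dist)
        dist_nonneg t
      have vf : IsGeod (fun r => (f r : X)) p' q' := ⟨fun u hu v hv => hf.isGeodesicOn u hu v hv,
        congrArg _ hf.map_zero, congrArg _ hf.map_dist⟩
      rw [e]
      refine ⟨hP.geod_mem_piece hM hpM hqM vf hs, ?_⟩
      have d1 := vf.dist_left hs
      have d2 : s ≤ dist (p' : X) q' := hs.2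
      linarith [dist_triangle (f s : X) p' p, near hp' hp, near hp' hq', dist_comm (f s : X) p']
    refine Path.Homotopic.Quotient.eq.2 ?_
    obtain ⟨F, hF⟩ := contr M hM p hpM p r
      (((segPath f cf 0 (dist p q) hf.map_zero hf.map_dist).trans
          (segPath g cg 0 (dist q r) hg.map_zero hg.map_dist)).map continuous_subtype_val)
      ((segPath k ck 0 (dist p r) hk.map_zero hk.map_dist).map continuous_subtype_val)
      (fun t => by
        have ht : ((segPath f cf 0 (dist p q) hf.map_zero hf.map_dist).trans
          (segPath g cg 0 (dist q r) hg.map_zero hg.map_dist)) t ∈ _ := mem_range_self t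
        rw [Path.trans_range] at ht
        simp only [Path.map_coe, Function.comp]
        rcases ht with ⟨t', e⟩ | ⟨t', e⟩
        · rw [← e]; exact aux hpM hqM hp hq hf t'
        · rw [← e]; exact aux hqM hrM hq hr hg t')
      (fun t => aux hpM hrM hp hr hk t)
    refine homotopic_of_homotopy_mem F fun z => ?_
    have h4 := (hF z).2
    have h5 := dist_triangle (F z) p a
    exact lt_of_le_of_lt h5 (by linarith)
  have na : dist a a < η := by simpa using hη
  have nb : dist b a < η := by rwa [dist_comm]
  have nc : dist c a < η := by rwa [dist_comm]
  have nu : dist u a < η := by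
    linarith [dist_comm u a, dist_nonneg (x := u) (y := v), dist_nonneg (x := v) (y := b)]
  have nv : dist v a < η := by
    linarith [dist_comm v a, dist_triangle a u v, dist_nonneg (x := v) (y := b)]
  have nw : dist w a < η := by
    linarith [dist_comm w a, dist_triangle a u w, dist_nonneg (x := w) (y := c)]
  have toS : ∀ {p : X}, dist p a < η → p ∈ S := fun hp => by
    show dist _ a < ε
    linarith
  let A : S := ⟨a, toS na⟩
  let B : S := ⟨b, toS nb⟩
  let C : S := ⟨c, toS nc⟩
  let U : S := ⟨u, toS nu⟩
  let V : S := ⟨v, toS nv⟩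
  let W : S := ⟨w, toS nw⟩
  have inS : ∀ {p q : S} (hp : dist (p : X) a < η) (hq : dist (q : X) a < η) {f : ℝ → X}
      (cf : Continuous f) (hf : IsGeod f p q) (t : I),
      segPath f cf 0 (dist (p : X) q) hf.map_zero hf.map_dist t ∈ S := by
    intro p q hp hq f cf hf t
    obtain ⟨s, hs, e⟩ := range_segPath (hf := cf) (hs := hf.map_zero) (ht := hf.map_dist)
      dist_nonneg t
    rw [e]
    exact mem hp hq (by rw [hf.dist_left hs, hf.dist_right hs]; ring)
  have cls : ∀ {p q : S} (hp : dist (p : X) a < η) (hq : dist (q : X) a < η) {f : ℝ → X}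
      (cf : Continuous f) (hf : IsGeod f p q),
      IsGeodClass (a := p) (b := q)
        (Path.Homotopic.Quotient.mk ((segPath f cf 0 (dist (p : X) q) hf.map_zero hf.map_dist).restrictCod S
          (inS hp hq cf hf))) := by
    intro p q hp hq f cf hf
    have hm : ∀ r, f (projIcc 0 (dist (p : X) q) dist_nonneg r) ∈ S := fun r => by
      have hs := (projIcc 0 (dist (p : X) q) dist_nonneg r).2
      exact mem hp hq (by rw [hf.dist_left hs, hf.dist_right hs]; ring)
    refine ⟨fun r => ⟨f (projIcc 0 (dist (p : X) q) dist_nonneg r), hm r⟩,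
      hf.continuous_clamp.subtype_mk hm, ⟨fun u hu v hv => hf.clamp.isGeodesicOn u hu v hv,
        Subtype.ext hf.clamp.map_zero, Subtype.ext hf.clamp.map_dist⟩, ?_⟩
    refine congrArg Path.Homotopic.Quotient.mk (Path.ext (funext fun t => Subtype.ext ?_))
    show f (0 + t * (dist (p : X) q - 0)) = f (projIcc 0 (dist (p : X) q) dist_nonneg
      (0 + t * (dist (p : X) q - 0)))
    rw [projIcc_of_mem]
    exact ⟨by simpa using mul_nonneg t.2.1 dist_nonneg,
      by simpa using mul_le_of_le_one_left dist_nonneg t.2.2⟩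
  have gAC := cls (p := A) (q := C) na nc cf hf
  have gAB := cls (p := A) (q := B) na nb cg hg
  have gBC := cls (p := B) (q := C) nb nc ch hh
  obtain ⟨AU, gAU⟩ := ex (p := A) (q := U) na nu
  obtain ⟨UV, gUV⟩ := ex (p := U) (q := V) nu nv
  obtain ⟨VB, gVB⟩ := ex (p := V) (q := B) nv nb
  obtain ⟨UW, gUW⟩ := ex (p := U) (q := W) nu nw
  obtain ⟨WC, gWC⟩ := ex (p := W) (q := C) nw nc
  obtain ⟨VW, gVW⟩ := ex (p := V) (q := W) nv nw
  have split : ∀ {p q r s : S}, dist (p : X) a < η → dist (s : X) a < η →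
      ∀ {C₁ : Path.Homotopic.Quotient p q} {C₂ : Path.Homotopic.Quotient q r}
      {C₃ : Path.Homotopic.Quotient r s} {D : Path.Homotopic.Quotient p s}, IsGeodClass C₁ →
      IsGeodClass C₂ → IsGeodClass C₃ → IsGeodClass D →
      dist (p : X) s = dist (p : X) q + dist (q : X) r + dist (r : X) s →
      D = C₁.trans (C₂.trans C₃) := by
    intro p q r s hp hs C₁ C₂ C₃ D g1 g2 g3 gD e
    have i1 := dist_triangle (p : X) q s
    have i2 := dist_triangle (q : X) r s
    refine uniq hp hs gD (g1.trans (g2.trans g3 ?_) ?_)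
    · show dist (q : X) s = dist (q : X) r + dist (r : X) s
      linarith
    · show dist (p : X) s = dist (p : X) q + dist (q : X) s
      linarith
  have s1 := split na nb gAU gUV gVB gAB e1
  have s2 := split na nc gAU gUW gWC gAC e2
  have s3 := split nb nc gVB.symm gVW gWC gBC (by
    show dist b c = dist b v + dist v w + dist w c
    exact e3)
  have s4 := piece (p := U) (q := V) (r := W) huM hvM hwM nu nv nw gUV gVW gUW
  obtain ⟨F⟩ := Path.Homotopic.Quotient.exact (show Path.Homotopic.Quotient.mk ((segPath f cf 0 (dist a c) hf.map_zero
      hf.map_dist).restrictCod S (inS (p := A) (q := C) na nc cf hf)) =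
      Path.Homotopic.Quotient.mk (((segPath g cg 0 (dist a b) hg.map_zero hg.map_dist).restrictCod S
        (inS (p := A) (q := B) na nb cg hg)).trans ((segPath h ch 0 (dist b c) hh.map_zero
          hh.map_dist).restrictCod S (inS (p := B) (q := C) nb nc ch hh))) by
    rw [mk_trans]
    -- `AB · BC = AU · UV · VB · VB⁻¹ · VW · WC`, where `VB` cancels and `UV · VW = UW` in the
    -- piece.
    refine s2.trans ?_
    refine Eq.trans ?_ (congrArg₂ Path.Homotopic.Quotient.trans s1 s3).symm
    rw [← s4]
    simp only [trans_assoc, trans_symm_cancel])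
  refine ⟨(F.map (⟨Subtype.val, continuous_subtype_val⟩ : C(S, X))).cast ?_ ?_, ?_⟩
  · rfl
  · rw [Path.map_trans]; rfl
  · intro z
    exact (F z).2

end IsTreeGraded

end Triangles

/-! ### Dyadic subdivision: small paths are homotopic to geodesics -/

section SmallPaths

open Set
open scoped unitInterval
open Path.Homotopic.Quotient

/-- The point of the unit interval given by the fractional part. -/
noncomputable def fractI (s : ℝ) : I := ⟨Int.fract s, Int.fract_nonneg s, (Int.fract_lt_one s).le⟩

theorem locallyFinite_Icc_int : LocallyFinite fun k : ℤ => Icc (k : ℝ) (k + 1) := by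
  intro s
  refine ⟨Ioo (s - 1) (s + 1), Ioo_mem_nhds (by linarith) (by linarith), ?_⟩
  refine (finite_Icc (⌊s⌋ - 2) (⌊s⌋ + 2)).subset ?_
  rintro k ⟨r, hr, hr'⟩
  have h1 := Int.floor_le s
  have h2 := Int.lt_floor_add_one s
  constructor
  · have : ((⌊s⌋ - 2 : ℤ) : ℝ) ≤ k := by push_cast; linarith [hr.2, hr'.1]
    exact_mod_cast this
  · have : (k : ℝ) ≤ ((⌊s⌋ + 2 : ℤ) : ℝ) := by push_cast; linarith [hr.1, hr'.2]
    exact_mod_cast this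

/-- Maps on `Z × [k, k + 1]` which agree on the common boundaries glue to a map on `Z × ℝ`. -/
theorem continuous_glue_int {Y Z : Type*} [TopologicalSpace Y] [TopologicalSpace Z]
    (φ : ℤ → Z × I → Y) (hφ : ∀ k, Continuous (φ k)) (h : ∀ k z, φ k (z, 1) = φ (k + 1) (z, 0)) :
    Continuous fun z : Z × ℝ => φ ⌊z.2⌋ (z.1, fractI z.2) := by
  have lf : LocallyFinite fun k : ℤ => (Prod.snd : Z × ℝ → ℝ) ⁻¹' Icc (k : ℝ) (k + 1) :=
    locallyFinite_Icc_int.preimage_continuous continuous_snd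
  refine lf.continuous ?_ (fun k => isClosed_Icc.preimage continuous_snd) fun k => ?_
  · refine eq_univ_of_forall fun z => mem_iUnion.2 ⟨⌊z.2⌋, Int.floor_le _, (Int.lt_floor_add_one _).le⟩
  · have : Continuous fun z : Z × ℝ => φ k (z.1, projIcc 0 1 zero_le_one (z.2 - k)) := by
      have := hφ k
      fun_prop
    refine this.continuousOn.congr fun z hz => ?_
    rcases hz.2.eq_or_lt with e | hlt
    · have e1 : ⌊z.2⌋ = k + 1 := by rw [e]; exact_mod_cast Int.floor_intCast (k + 1)
      have e2 : fractI z.2 = 0 := Subtype.ext (by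
        show Int.fract z.2 = 0
        rw [e]; exact_mod_cast Int.fract_intCast (k + 1))
      simp only [e1, e2, ← h]
      congr 2
      rw [e, add_sub_cancel_left, projIcc_right]
      rfl
    · have e1 : ⌊z.2⌋ = k := Int.floor_eq_iff.2 ⟨hz.1, hlt⟩
      simp only [e1]
      congr 2
      refine Subtype.ext ?_
      rw [projIcc_of_mem zero_le_one ⟨by linarith [hz.1], by linarith⟩]
      show Int.fract z.2 = _
      rw [Int.fract, e1]

section Polygon

variable {X : Type*} [MetricSpace X]

/-- A path is homotopic to the geodesic joining its ends, if the geodesic polygons inscribed in it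
can be subdivided by homotopies which are small on short arcs. -/
theorem homotopic_of_subdivision {a b : X} (p : Path a b) (ρ : ∀ a b : X, Path a b) (q : ℝ → X)
    (uq : UniformContinuous q) (hq : ∀ s : I, q s = p s)
    (T : ∀ o : {o : ℝ × ℝ // o.1 < o.2}, (ρ (q o.1.1) (q o.1.2)).Homotopy
      ((ρ (q o.1.1) (q ((o.1.1 + o.1.2) / 2))).trans (ρ (q ((o.1.1 + o.1.2) / 2)) (q o.1.2))))
    (hT : ∀ ε > 0, ∃ δ > 0, ∀ o : {o : ℝ × ℝ // o.1 < o.2}, o.1.2 - o.1.1 < δ →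
      ∀ z, dist (T o z) (q o.1.1) < ε) : (ρ a b).Homotopic p := by
  have cq : Continuous q := uq.continuous
  let V : ℝ → ℝ → I → X := fun s t r => ρ (q s) (q t) r
  classical
  let W : ℝ → ℝ → I × I → X := fun s t z => if h : s < t then T ⟨(s, t), h⟩ z else q s
  have W_eq : ∀ {s t} (h : s < t), W s t = T ⟨(s, t), h⟩ := fun h => by
    funext z; simp only [W, dif_pos h]
  have W_cont : ∀ {s t}, s < t → Continuous (W s t) := fun h => by
    rw [W_eq h]; exact (T _).continuous
  have W_zero : ∀ {s t}, s < t → ∀ r, W s t (0, r) = V s t r := fun h r => by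
    rw [W_eq h]; exact (T _).apply_zero r
  have W_one : ∀ {s t}, s < t → ∀ r, W s t (1, r) =
      if h : (r : ℝ) ≤ 1 / 2 then
        V s ((s + t) / 2) ⟨2 * r, (unitInterval.mul_pos_mem_iff zero_lt_two).2 ⟨r.2.1, h⟩⟩
      else V ((s + t) / 2) t
        ⟨2 * r - 1, unitInterval.two_mul_sub_one_mem_iff.2 ⟨(not_le.1 h).le, r.2.2⟩⟩ := fun h r => by
    rw [W_eq h]
    refine ((T _).apply_one r).trans ?_
    exact Path.trans_apply _ _ _
  have W_left : ∀ {s t}, s < t → ∀ u, W s t (u, 0) = q s := fun h u => by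
    rw [W_eq h]; exact (T _).source u
  have W_right : ∀ {s t}, s < t → ∀ u, W s t (u, 1) = q t := fun h u => by
    rw [W_eq h]; exact (T _).target u
  have cell : ∀ (n : ℕ) (k : ℤ), (k : ℝ) / 2 ^ n < ((k + 1 : ℤ) : ℝ) / 2 ^ n := fun n k => by
    push_cast
    gcongr
    linarith
  -- Stage `n` deforms, over each dyadic cell of length `1 / 2 ^ n`, the chord of `q` into the two
  -- chords over the halves of the cell.
  let G : ℕ → I × ℝ → X := fun n z =>
    W ((⌊2 ^ n * z.2⌋ : ℝ) / 2 ^ n) (((⌊2 ^ n * z.2⌋ + 1 : ℤ) : ℝ) / 2 ^ n) (z.1, fractI (2 ^ n * z.2))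
  have G_cont : ∀ n, Continuous (G n) := by
    intro n
    have := continuous_glue_int (fun (k : ℤ) (z : I × I) =>
        W ((k : ℝ) / 2 ^ n) (((k + 1 : ℤ) : ℝ) / 2 ^ n) z) (fun k => W_cont (cell n k))
      (fun k u => by rw [W_right (cell n k), W_left (cell n (k + 1))])
    exact this.comp (continuous_fst.prodMk (continuous_const.mul continuous_snd))
  have G_step : ∀ n s, G n (1, s) = G (n + 1) (0, s) := by
    intro n s
    simp only [G]
    rw [W_one (cell n _), W_zero (cell (n + 1) _)]
    set x : ℝ := 2 ^ n * s
    have hx : (2 : ℝ) ^ (n + 1) * s = 2 * x := by simp only [x]; ring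
    rw [hx]
    have f1 := Int.floor_add_fract x
    have hm : ((⌊x⌋ : ℝ) / 2 ^ n + ((⌊x⌋ + 1 : ℤ) : ℝ) / 2 ^ n) / 2
        = ((2 * ⌊x⌋ + 1 : ℤ) : ℝ) / 2 ^ (n + 1) := by
      push_cast; field_simp; ring
    have hl : (⌊x⌋ : ℝ) / 2 ^ n = ((2 * ⌊x⌋ : ℤ) : ℝ) / 2 ^ (n + 1) := by
      push_cast; field_simp; ring
    have hr : ((⌊x⌋ + 1 : ℤ) : ℝ) / 2 ^ n = ((2 * ⌊x⌋ + 1 + 1 : ℤ) : ℝ) / 2 ^ (n + 1) := by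
      push_cast; field_simp; ring
    have hval : ((fractI x : I) : ℝ) = Int.fract x := rfl
    have f2 := Int.fract_nonneg x
    have f3 := Int.fract_lt_one x
    rw [hm, hr, hl]
    rcases lt_or_ge (Int.fract x) (1 / 2) with hlt | hge
    · have e1 : ⌊2 * x⌋ = 2 * ⌊x⌋ := Int.floor_eq_iff.2 ⟨by push_cast; linarith, by
        push_cast; linarith⟩
      rw [dif_pos (by rw [hval]; exact hlt.le), e1]
      congr 1
      refine Subtype.ext ?_
      show 2 * Int.fract x = Int.fract (2 * x)
      rw [Int.fract, Int.fract, e1]; push_cast; ring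
    · have e1 : ⌊2 * x⌋ = 2 * ⌊x⌋ + 1 := Int.floor_eq_iff.2 ⟨by push_cast; linarith, by
        push_cast; linarith⟩
      have e2 : Int.fract (2 * x) = 2 * Int.fract x - 1 := by
        rw [Int.fract, Int.fract, e1]; push_cast; ring
      rw [e1]
      -- At the midpoint of a cell the concatenation is still at the end of its first half, while
      -- the floor already selects the start of the second; both are the same point of `q`.
      rcases hge.eq_or_lt with heq | hgt
      · rw [dif_pos (by rw [hval]; exact heq.ge)]
        have i1 : (⟨2 * (fractI x : ℝ), (unitInterval.mul_pos_mem_iff zero_lt_two).2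
          ⟨(fractI x).2.1, by rw [hval]; exact heq.ge⟩⟩ : I) = 1 := Subtype.ext (by
            show 2 * Int.fract x = 1; linarith)
        have i2 : fractI (2 * x) = 0 := Subtype.ext (by
          show Int.fract (2 * x) = 0; linarith)
        rw [i1, i2]
        simp [V]
      · rw [dif_neg (by rw [hval]; linarith)]
        congr 1
        refine Subtype.ext ?_
        show 2 * Int.fract x - 1 = Int.fract (2 * x)
        exact e2.symm
  have G_small : ∀ ε > 0, ∃ N, ∀ n ≥ N, ∀ u s, dist (G n (u, s)) (q s) < ε := by
    intro ε hε
    obtain ⟨δ, hδ, h⟩ := hT (ε / 2) (by linarith)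
    obtain ⟨η, hη, h'⟩ := Metric.uniformContinuous_iff.1 uq (ε / 2) (by linarith)
    obtain ⟨N, hN⟩ := exists_pow_lt_of_lt_one (lt_min hδ hη) (by norm_num : (1 / 2 : ℝ) < 1)
    refine ⟨N, fun n hn u s => ?_⟩
    have hsm : (1 / 2 : ℝ) ^ n < min δ η :=
      (pow_le_pow_of_le_one (by norm_num) (by norm_num) hn).trans_lt hN
    have h2 : (0 : ℝ) < 2 ^ n := by positivity
    have hlen : ((⌊2 ^ n * s⌋ + 1 : ℤ) : ℝ) / 2 ^ n - (⌊2 ^ n * s⌋ : ℝ) / 2 ^ n = (1 / 2) ^ n := by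
      push_cast; rw [one_div_pow]; ring
    have d1 : dist (G n (u, s)) (q ((⌊2 ^ n * s⌋ : ℝ) / 2 ^ n)) < ε / 2 := by
      simp only [G]
      rw [W_eq (cell n _)]
      exact h ⟨(_, _), cell n _⟩ (by rw [hlen]; exact hsm.trans_le (min_le_left _ _)) _
    have d2 : dist (q ((⌊2 ^ n * s⌋ : ℝ) / 2 ^ n)) (q s) < ε / 2 := by
      refine h' ?_
      have f1 := Int.floor_add_fract (2 ^ n * s)
      have f2 := Int.fract_nonneg (2 ^ n * s)
      have f3 := Int.fract_lt_one (2 ^ n * s)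
      have e : s - (⌊2 ^ n * s⌋ : ℝ) / 2 ^ n = Int.fract (2 ^ n * s) * (1 / 2) ^ n := by
        rw [Int.fract, one_div_pow]; field_simp
      rw [dist_comm, Real.dist_eq, e, abs_of_nonneg (by positivity)]
      calc Int.fract (2 ^ n * s) * (1 / 2) ^ n ≤ 1 * (1 / 2) ^ n := by gcongr
        _ < η := by rw [one_mul]; exact hsm.trans_le (min_le_right _ _)
    linarith [dist_triangle (G n (u, s)) (q ((⌊2 ^ n * s⌋ : ℝ) / 2 ^ n)) (q s)]
  -- The stages are continued by a constant one to negative indices, since the gluing is over all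
  -- integers.
  let φ : ℤ → ℝ × I → X := fun n z => if 0 ≤ n then G n.toNat (z.2, z.1) else G 0 (0, z.1)
  have φ_cont : ∀ n, Continuous (φ n) := by
    intro n
    by_cases hn : 0 ≤ n
    · simp only [φ, if_pos hn]
      exact (G_cont _).comp (continuous_snd.prodMk continuous_fst)
    · simp only [φ, if_neg hn]
      exact (G_cont 0).comp (continuous_const.prodMk continuous_fst)
  have φ_step : ∀ n s, φ n (s, 1) = φ (n + 1) (s, 0) := by
    intro n s
    rcases lt_trichotomy n (-1) with hn | rfl | hn
    · simp only [φ, if_neg (by lia : ¬ 0 ≤ n), if_neg (by lia : ¬ 0 ≤ n + 1)]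
    · simp [φ]
    · have h1 : 0 ≤ n := by lia
      simp only [φ, if_pos h1, if_pos (by lia : 0 ≤ n + 1)]
      rw [G_step, show (n + 1).toNat = n.toNat + 1 by lia]
  let H : ℝ × ℝ → X := fun z => φ ⌊z.2⌋ (z.1, fractI z.2)
  have H_cont : Continuous H := continuous_glue_int φ φ_cont φ_step
  have H_nonneg : ∀ s τ, 0 ≤ τ → H (s, τ) = G ⌊τ⌋.toNat (fractI τ, s) := by
    intro s τ hτ
    simp only [H, φ, if_pos (Int.floor_nonneg.2 hτ)]
  -- The infinitely many stages are run through in unit time by `τ = t / (1 - t)`, with `q` as the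
  -- limit at `t = 1`; continuity there is the uniform convergence `G_small`.
  let D : I × I → X := fun z =>
    if (z.1 : ℝ) < 1 then H (z.2, (z.1 : ℝ) / (1 - z.1)) else q z.2
  have D_cont : Continuous D := by
    refine continuous_iff_continuousAt.2 ?_
    rintro ⟨t₀, s₀⟩
    rcases t₀.2.2.lt_or_eq with hlt | heq
    · have ev : ∀ᶠ z : I × I in nhds (t₀, s₀), (z.1 : ℝ) < 1 :=
        (continuous_subtype_val.comp continuous_fst).continuousAt.eventually (Iio_mem_nhds hlt)
      have hc : ContinuousAt (fun z : I × I => H (z.2, (z.1 : ℝ) / (1 - z.1))) (t₀, s₀) := by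
        refine H_cont.continuousAt.comp (ContinuousAt.prodMk (by fun_prop) ?_)
        refine ContinuousAt.div (by fun_prop) (by fun_prop) ?_
        simp only
        linarith
      refine hc.congr ?_
      filter_upwards [ev] with z hz
      simp only [D, if_pos hz]
    · have hD0 : D (t₀, s₀) = q s₀ := by simp only [D, heq, lt_irrefl, if_false]
      refine Metric.tendsto_nhds.2 fun ε hε => ?_
      rw [hD0]
      obtain ⟨N, hN⟩ := G_small (ε / 2) (by linarith)
      have hqc : Continuous fun z : I × I => q z.2 := by fun_prop
      have ev1 : ∀ᶠ z : I × I in nhds (t₀, s₀), dist (q z.2) (q s₀) < ε / 2 :=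
        Metric.tendsto_nhds.1 (hqc.tendsto (t₀, s₀)) _ (by linarith)
      have hN0 : (0 : ℝ) < N + 1 := by positivity
      have ev2 : ∀ᶠ z : I × I in nhds (t₀, s₀), 1 - 1 / ((N : ℝ) + 1) < (z.1 : ℝ) := by
        refine (continuous_subtype_val.comp continuous_fst).continuousAt.eventually
          (Ioi_mem_nhds ?_)
        simp only [Function.comp, heq]
        have : 0 < 1 / ((N : ℝ) + 1) := by positivity
        linarith
      filter_upwards [ev1, ev2] with z h1 h2
      by_cases hz : (z.1 : ℝ) < 1
      · simp only [D, if_pos hz]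
        have hz' : 0 < 1 - (z.1 : ℝ) := by linarith
        have hτ : (N : ℝ) ≤ (z.1 : ℝ) / (1 - z.1) := by
          rw [le_div_iff₀ hz']
          have h3 : (1 - (z.1 : ℝ)) * (N + 1) < 1 := by
            have : 1 - (z.1 : ℝ) < 1 / ((N : ℝ) + 1) := by linarith
            rwa [lt_div_iff₀ hN0] at this
          linarith
        rw [H_nonneg _ _ (le_trans (by positivity) hτ)]
        have h4 : N ≤ ⌊(z.1 : ℝ) / (1 - z.1)⌋.toNat := by
          have : (N : ℤ) ≤ ⌊(z.1 : ℝ) / (1 - z.1)⌋ := Int.le_floor.2 (by exact_mod_cast hτ)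
          lia
        have h5 := hN _ h4 (fractI ((z.1 : ℝ) / (1 - z.1))) z.2
        linarith [dist_triangle (G ⌊(z.1 : ℝ) / (1 - z.1)⌋.toNat
          (fractI ((z.1 : ℝ) / (1 - z.1)), (z.2 : ℝ))) (q z.2) (q s₀)]
      · simp only [D, if_neg hz]
        linarith
  have q0 : q 0 = a := (hq 0).trans p.source
  have q1 : q 1 = b := (hq 1).trans p.target
  have fr0 : fractI 0 = 0 := Subtype.ext Int.fract_zero
  have G_left : ∀ n u, G n (u, 0) = a := by
    intro n u
    simp only [G, mul_zero, fr0]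
    rw [W_left (by simp)]
    simp [q0]
  have G_right : ∀ n u, G n (u, 1) = b := by
    intro n u
    have e1 : ⌊(2 : ℝ) ^ n * 1⌋ = 2 ^ n := by rw [mul_one]; exact_mod_cast Int.floor_natCast (2 ^ n)
    have e2 : fractI ((2 : ℝ) ^ n * 1) = 0 := Subtype.ext (by
      show Int.fract ((2 : ℝ) ^ n * 1) = 0
      rw [mul_one]; exact_mod_cast Int.fract_natCast (2 ^ n))
    simp only [G, e1, e2]
    -- The time `1` is the start of the next cell beyond the unit interval, where `q` is defined as
    -- well.
    rw [W_left (by simpa using cell n (2 ^ n))]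
    simp [q1]
  have D_nonneg : ∀ t : I, 0 ≤ (t : ℝ) / (1 - t) := fun t =>
    div_nonneg t.2.1 (by linarith [t.2.2])
  refine ⟨⟨⟨⟨D, D_cont⟩, fun s => ?_, fun s => ?_⟩, ?_⟩⟩
  · show D (0, s) = ρ a b s
    have : D (0, s) = G 0 (0, s) := by
      simp only [D, Icc.coe_zero, zero_lt_one, if_true, zero_div]
      rw [H_nonneg _ _ le_rfl]
      simp [fr0]
    rw [this]
    rcases s.2.2.lt_or_eq with hs | hs
    · have e1 : ⌊(2 : ℝ) ^ 0 * s⌋ = 0 := by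
        rw [pow_zero, one_mul]; exact Int.floor_eq_zero_iff.2 ⟨s.2.1, hs⟩
      have e2 : fractI ((2 : ℝ) ^ 0 * s) = s := Subtype.ext (by
        show Int.fract ((2 : ℝ) ^ 0 * s) = s
        rw [Int.fract, e1]; simp)
      simp only [G, e1, e2]
      rw [W_zero (by simp)]
      have hV : ∀ a' b', a' = a → b' = b → ρ a' b' s = ρ a b s := by rintro _ _ rfl rfl; rfl
      exact hV _ _ (by simp [q0]) (by simp [q1])
    · have e : s = 1 := Subtype.ext hs
      rw [hs, G_right, e, (ρ a b).target]
  · show D (1, s) = p s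
    simp [D, hq]
  · rintro t s (rfl | hs)
    · show D (t, 0) = ρ a b 0
      rw [(ρ a b).source]
      by_cases ht : (t : ℝ) < 1
      · simp only [D, if_pos ht]
        rw [H_nonneg _ _ (D_nonneg t)]
        exact G_left _ _
      · simp only [D, if_neg ht]
        exact q0
    · rw [mem_singleton_iff] at hs
      subst hs
      show D (t, 1) = ρ a b 1
      rw [(ρ a b).target]
      by_cases ht : (t : ℝ) < 1
      · simp only [D, if_pos ht]
        rw [H_nonneg _ _ (D_nonneg t)]
        exact G_right _ _
      · simp only [D, if_neg ht]
        exact q1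

end Polygon

namespace IsTreeGraded

variable {X : Type*} [MetricSpace X] {P : Set (Set X)} (hP : IsTreeGraded X P)
include hP

/-- Local simple connectedness: short geodesics with the same ends are homotopic, and small paths are
homotopic to geodesics. -/
theorem exists_radius (hc : LocallyUniformlyContractible (fun M : P => (M : Set X))) :
    ∃ δ > 0, (∀ (a b : X) (C D : Path.Homotopic.Quotient a b), IsGeodClass C → IsGeodClass D →
        dist a b < δ → C = D) ∧
      ∀ (a b : X) (p : Path a b) (C : Path.Homotopic.Quotient a b), IsGeodClass C →
        (∀ s t, dist (p s) (p t) < δ) → Path.Homotopic.Quotient.mk p = C := by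
  obtain ⟨δ₁, hδ₁, -, h₁⟩ := hP.exists_bigon_homotopy hc one_pos
  obtain ⟨δ₂, hδ₂, h₂⟩ := hP.exists_triangle_homotopy hc one_pos
  have bigon : ∀ (a b : X) (C D : Path.Homotopic.Quotient a b), IsGeodClass C → IsGeodClass D →
      dist a b < δ₁ → C = D := by
    rintro a b C D ⟨f, cf, hf, rfl⟩ ⟨g, cg, hg, rfl⟩ hab
    obtain ⟨F, -⟩ := h₁ a b f g cf cg hf hg hab
    exact Path.Homotopic.Quotient.eq.2 ⟨F⟩
  refine ⟨min δ₁ δ₂, lt_min hδ₁ hδ₂, fun a b C D hC hD hab =>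
    bigon a b C D hC hD (hab.trans_le (min_le_left _ _)), ?_⟩
  intro a b p C hC hp
  choose f cf hf hf' using hP.exists_continuous_isGeod
  let ρ : ∀ a b : X, Path a b := fun a b =>
    segPath (f a b) (cf a b) 0 (dist a b) (hf a b).map_zero (hf a b).map_dist
  have uq : UniformContinuous p.extend := p.uniformContinuous_extend
  have hq : ∀ s : I, p.extend s = p s := fun s => p.extend_apply s.2
  have small : ∀ s t, dist (p.extend s) (p.extend t) < min δ₁ δ₂ := fun s t => hp _ _
  have sub : ∀ ε > 0, ∃ δ > 0, ∀ s m t : ℝ, dist (p.extend s) (p.extend m) < δ →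
      dist (p.extend s) (p.extend t) < δ →
      ∃ F : (ρ (p.extend s) (p.extend t)).Homotopy
        ((ρ (p.extend s) (p.extend m)).trans (ρ (p.extend m) (p.extend t))),
        ∀ z, dist (F z) (p.extend s) < ε := by
    intro ε hε
    obtain ⟨δ, hδ, h⟩ := hP.exists_triangle_homotopy hc hε
    exact ⟨δ, hδ, fun s m t hm ht => h _ _ _ _ _ _ _ _ _ (hf _ _) (hf _ _) (hf _ _) hm ht⟩
  let β : {o : ℝ × ℝ // o.1 < o.2} → Type _ := fun o =>
    (ρ (p.extend o.1.1) (p.extend o.1.2)).Homotopy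
      ((ρ (p.extend o.1.1) (p.extend ((o.1.1 + o.1.2) / 2))).trans
        (ρ (p.extend ((o.1.1 + o.1.2) / 2)) (p.extend o.1.2)))
  -- Over long intervals there is no smallness of the homotopy to achieve, but it exists because the
  -- whole path is small.
  have ne : ∀ o, Nonempty (β o) := fun o => by
    obtain ⟨F, -⟩ := h₂ _ _ _ _ _ _ (cf (p.extend o.1.1) (p.extend o.1.2))
      (cf (p.extend o.1.1) (p.extend ((o.1.1 + o.1.2) / 2)))
      (cf (p.extend ((o.1.1 + o.1.2) / 2)) (p.extend o.1.2)) (hf _ _) (hf _ _) (hf _ _)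
      ((small _ _).trans_le (min_le_right _ _)) ((small _ _).trans_le (min_le_right _ _))
    exact ⟨F⟩
  obtain ⟨T, hT⟩ := exists_controlled_choice (β := β) (fun o => o.1.2 - o.1.1)
    (fun o => sub_pos.2 o.2) (fun o F η => ∀ z, dist (F z) (p.extend o.1.1) < η)
    (fun o F η η' h hle z => (h z).trans_le hle)
    (by
      intro ε hε
      obtain ⟨δ, hδ, h⟩ := sub ε hε
      obtain ⟨η, hη, h'⟩ := Metric.uniformContinuous_iff.1 uq δ hδ
      refine ⟨η, hη, ?_⟩
      rintro ⟨⟨s, t⟩, hst⟩ hlt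
      simp only at hst hlt
      refine h s ((s + t) / 2) t (h' ?_) (h' ?_)
      · rw [Real.dist_eq, abs_of_neg (by linarith)]; linarith
      · rw [Real.dist_eq, abs_of_neg (by linarith)]; linarith)
  have key := homotopic_of_subdivision p ρ p.extend uq hq T hT
  rw [← Path.Homotopic.Quotient.eq.2 key]
  refine bigon a b _ _ ⟨f a b, cf a b, hf a b, rfl⟩ hC ?_
  have := (hp 0 1).trans_le (min_le_left _ _)
  simpa using this

end IsTreeGraded

end SmallPaths

/-! ### Holonomy of a cocycle defined on close pairs of points -/

section CocycleHolonomy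

open Set
open scoped unitInterval

section Holonomy

variable {X G : Type*} [MetricSpace X] [Group G]

/-- The product of the values of `Φ` along the edges of the chain `z`. -/
def chainProd (Φ : X → X → G) (z : ℕ → X) : ℕ → G
  | 0 => 1
  | n + 1 => Φ (z n) (z (n + 1)) * chainProd Φ z n

variable {Φ : X → X → G} {δ : ℝ}

omit [MetricSpace X] in
theorem chainProd_congr {z w : ℕ → X} {n : ℕ} (h : ∀ i ≤ n, z i = w i) :
    chainProd Φ z n = chainProd Φ w n := by
  induction n with
  | zero => rfl
  | succ n ih => rw [chainProd, chainProd, ih fun i hi => h i (by lia), h n (by lia), h _ le_rfl]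

omit [MetricSpace X] in
theorem chainProd_add (z : ℕ → X) (n m : ℕ) :
    chainProd Φ z (n + m) = chainProd Φ (fun i => z (n + i)) m * chainProd Φ z n := by
  induction m with
  | zero => simp [chainProd]
  | succ m ih => rw [← add_assoc, chainProd, ih, chainProd, ← mul_assoc]; rfl

variable (hδ : 0 < δ)
  (hΦ : ∀ a b c, dist a b < δ → dist b c < δ → dist a c < δ → Φ b c * Φ a b = Φ a c)
include hδ hΦ

theorem cocycle_self (a : X) : Φ a a = 1 := by
  have := hΦ a a a (by simpa) (by simpa) (by simpa)
  simpa using this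

theorem chainProd_of_small {z : ℕ → X} {n : ℕ} (h : ∀ i ≤ n, ∀ j ≤ n, dist (z i) (z j) < δ) :
    chainProd Φ z n = Φ (z 0) (z n) := by
  induction n with
  | zero => exact (cocycle_self hδ hΦ _).symm
  | succ n ih =>
    rw [chainProd, ih fun i hi j hj => h i (by lia) j (by lia)]
    exact hΦ _ _ _ (h _ (by lia) _ (by lia)) (h _ (by lia) _ (by lia)) (h _ (by lia) _ (by lia))

/-- Each block of `m` edges has diameter below `δ`, so the cocycle relation collapses it to a single
edge. This makes the product along a path independent of the fineness of the subdivision. -/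
theorem chainProd_mul {z : ℕ → X} {n m : ℕ}
    (h : ∀ i < n, ∀ j ≤ m, ∀ k ≤ m, dist (z (i * m + j)) (z (i * m + k)) < δ) :
    chainProd Φ z (n * m) = chainProd Φ (fun i => z (i * m)) n := by
  induction n with
  | zero => simp [chainProd]
  | succ n ih =>
    rw [Nat.succ_mul, chainProd_add, ih fun i hi => h i (by lia),
      chainProd_of_small hδ hΦ (h n (by lia)), chainProd]
    simp only [Nat.succ_mul, add_zero]

omit hδ in
-- Each square between consecutive rungs is cut by the diagonal from `z i` to `w (i + 1)` into two
-- triangles, to which the cocycle relation applies.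
theorem chainProd_ladder {z w : ℕ → X} {n : ℕ}
    (h : ∀ i < n, dist (z i) (z (i + 1)) < δ ∧ dist (w i) (w (i + 1)) < δ ∧
      dist (z i) (w (i + 1)) < δ) (h' : ∀ i ≤ n, dist (z i) (w i) < δ) :
    chainProd Φ w n * Φ (z 0) (w 0) = Φ (z n) (w n) * chainProd Φ z n := by
  induction n with
  | zero => simp [chainProd]
  | succ n ih =>
    obtain ⟨h1, h2, h3⟩ := h n (by lia)
    rw [chainProd, chainProd, mul_assoc, ih (fun i hi => h i (by lia)) fun i hi => h' i (by lia),
      ← mul_assoc, ← mul_assoc, hΦ _ _ _ (h' n (by lia)) h2 h3, hΦ _ _ _ h1 (h' _ le_rfl) h3]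

/-- The values of `q` at points of distance at most `1 / n` are `δ`-close. -/
def IsFine (δ : ℝ) (q : ℝ → X) (n : ℕ) : Prop :=
  0 < n ∧ ∀ s t : ℝ, |s - t| ≤ 1 / n → dist (q s) (q t) < δ

omit hδ hΦ in
theorem IsFine.mul {q : ℝ → X} {n : ℕ} (h : IsFine δ q n) {m : ℕ} (hm : 0 < m) :
    IsFine δ q (n * m) := by
  refine ⟨Nat.mul_pos h.1 hm, fun s t hst => h.2 s t (hst.trans ?_)⟩
  have : (0 : ℝ) < n := by exact_mod_cast h.1
  have hm' : (1 : ℝ) ≤ m := by exact_mod_cast hm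
  push_cast
  exact one_div_le_one_div_of_le this (by nlinarith)

omit hΦ in
theorem exists_isFine {q : ℝ → X} (hq : UniformContinuous q) : ∃ n, IsFine δ q n := by
  obtain ⟨η, hη, h⟩ := Metric.uniformContinuous_iff.1 hq δ hδ
  obtain ⟨n, hn⟩ := exists_nat_one_div_lt hη
  refine ⟨n + 1, Nat.succ_pos _, fun s t hst => h ?_⟩
  rw [Real.dist_eq]
  refine hst.trans_lt ?_
  push_cast
  exact hn

theorem chainProd_fine_mul {q : ℝ → X} {n : ℕ} (h : IsFine δ q n) {m : ℕ} (hm : 0 < m) :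
    chainProd Φ (fun i => q (i / (n * m : ℕ))) (n * m) = chainProd Φ (fun i => q (i / n)) n := by
  have hn' : (0 : ℝ) < n := by exact_mod_cast h.1
  have hm' : (0 : ℝ) < m := by exact_mod_cast hm
  rw [chainProd_mul hδ hΦ]
  · refine chainProd_congr fun i _ => ?_
    congr 1
    push_cast
    field_simp
  · intro i _ j hj k hk
    refine h.2 _ _ ?_
    have hj' : (j : ℝ) ≤ m := by exact_mod_cast hj
    have hk' : (k : ℝ) ≤ m := by exact_mod_cast hk
    have e : (((i * m + j : ℕ) : ℝ) / (n * m : ℕ) - ((i * m + k : ℕ) : ℝ) / (n * m : ℕ))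
        = ((j : ℝ) - k) / m * (1 / n) := by
      push_cast; field_simp; ring
    rw [e, abs_mul, abs_of_pos (by positivity : (0 : ℝ) < 1 / n)]
    have : |((j : ℝ) - k) / m| ≤ 1 := by
      rw [abs_div, abs_of_pos hm', div_le_one hm', abs_le]
      constructor <;> linarith [Nat.cast_nonneg (α := ℝ) j, Nat.cast_nonneg (α := ℝ) k]
    calc _ ≤ 1 * (1 / (n : ℝ)) := by gcongr
      _ = _ := one_mul _

theorem chainProd_fine_eq {q : ℝ → X} {n m : ℕ} (h : IsFine δ q n) (h' : IsFine δ q m) :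
    chainProd Φ (fun i => q (i / n)) n = chainProd Φ (fun i => q (i / m)) m := by
  rw [← chainProd_fine_mul hδ hΦ h h'.1, ← chainProd_fine_mul hδ hΦ h' h.1, mul_comm]

/-- A cocycle on pairs of close points defines a holonomy of homotopy classes of paths. -/
theorem exists_holonomy : ∃ H : ∀ {a b : X}, Path.Homotopic.Quotient a b → G,
    (∀ {a b c : X} (p : Path.Homotopic.Quotient a b) (q : Path.Homotopic.Quotient b c),
      H (p.trans q) = H q * H p) ∧
    ∀ {a b : X} (p : Path a b), (∀ s t, dist (p s) (p t) < δ) →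
      H (Path.Homotopic.Quotient.mk p) = Φ a b := by
  have ex : ∀ {a b : X} (p : Path a b), ∃ n, IsFine δ p.extend n := fun p =>
    exists_isFine hδ p.uniformContinuous_extend
  let V : ∀ {a b : X}, Path a b → G := fun p =>
    chainProd Φ (fun i => p.extend (i / (ex p).choose)) (ex p).choose
  have V_eq : ∀ {a b : X} (p : Path a b) {n : ℕ}, IsFine δ p.extend n →
      V p = chainProd Φ (fun i => p.extend (i / n)) n := fun p n hn =>
    chainProd_fine_eq hδ hΦ (ex p).choose_spec hn
  have V_inv : ∀ {a b : X} (p q : Path a b), p.Homotopic q → V p = V q := by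
    rintro a b p q ⟨F⟩
    let E : ℝ × ℝ → X := fun z => F (projIcc 0 1 zero_le_one z.1, projIcc 0 1 zero_le_one z.2)
    have uE : UniformContinuous E := (CompactSpace.uniformContinuous_of_continuous
      F.continuous).comp (((LipschitzWith.projIcc _).uniformContinuous.comp
        uniformContinuous_fst).prodMk ((LipschitzWith.projIcc _).uniformContinuous.comp
          uniformContinuous_snd))
    obtain ⟨η, hη, h⟩ := Metric.uniformContinuous_iff.1 uE δ hδ
    obtain ⟨m, hm⟩ := exists_nat_one_div_lt hη
    obtain ⟨n, rfl⟩ : ∃ n, n = m + 1 := ⟨_, rfl⟩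
    have hm' : 1 / ((m + 1 : ℕ) : ℝ) < η := by push_cast; exact hm
    have hpos : (0 : ℝ) < ((m + 1 : ℕ) : ℝ) := by positivity
    generalize m + 1 = n at hm' hpos
    have hn : 0 < n := by exact_mod_cast hpos
    have close : ∀ r s r' s' : ℝ, |r - r'| ≤ 1 / n → |s - s'| ≤ 1 / n →
        dist (E (r, s)) (E (r', s')) < δ := by
      intro r s r' s' h1 h2
      refine h ?_
      rw [Prod.dist_eq, max_lt_iff, Real.dist_eq, Real.dist_eq]
      exact ⟨h1.trans_lt hm', h2.trans_lt hm'⟩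
    have step : ∀ i : ℕ, |((i : ℝ) / n) - ((i + 1 : ℕ) : ℝ) / n| ≤ 1 / n := by
      intro i
      have : ((i : ℝ) / n) - ((i + 1 : ℕ) : ℝ) / n = -(1 / n) := by push_cast; ring
      rw [this, abs_neg, abs_of_pos (by positivity)]
    have zero : ∀ r : ℝ, |r - r| ≤ 1 / n := fun r => by simp
    -- Consecutive rows of a fine grid in the homotopy form a ladder. The homotopy fixes the ends,
    -- so the outer rungs contribute `Φ a a = 1` and `Φ b b = 1`.
    have row : ∀ j : ℕ, chainProd Φ (fun i => E (j / n, i / n)) n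
        = chainProd Φ (fun i => E ((0 : ℕ) / n, i / n)) n := by
      intro j
      induction j with
      | zero => rfl
      | succ j ih =>
        rw [← ih]
        have := chainProd_ladder hΦ (z := fun i => E (j / n, i / n))
          (w := fun i => E ((j + 1 : ℕ) / n, i / n)) (n := n)
          (fun i _ => ⟨close _ _ _ _ (zero _) (step i), close _ _ _ _ (zero _) (step i),
            close _ _ _ _ (step j) (step i)⟩) (fun i _ => close _ _ _ _ (step j) (zero _))
        have e0 : ∀ r : ℝ, E (r, (0 : ℕ) / n) = a := fun r => by simp [E]
        have e1 : ∀ r : ℝ, E (r, n / n) = b := fun r => by simp [E, div_self hpos.ne']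
        simp only [e0, e1, cocycle_self hδ hΦ, one_mul, mul_one] at this
        exact this
    have rp : ∀ s : ℝ, E ((0 : ℕ) / n, s) = p.extend s := fun s => by
      simp only [E, Nat.cast_zero, zero_div, projIcc_left]
      exact F.apply_zero _
    have rq : ∀ s : ℝ, E (n / n, s) = q.extend s := fun s => by
      simp only [E, div_self hpos.ne', projIcc_right]
      exact F.apply_one _
    rw [V_eq p (n := n) ⟨hn, fun s t hst => by
      rw [← rp, ← rp]; exact close _ _ _ _ (zero _) hst⟩, V_eq q (n := n) ⟨hn, fun s t hst => by
      rw [← rq, ← rq]; exact close _ _ _ _ (zero _) hst⟩]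
    have := row n
    simp only [rp, rq] at this
    exact this.symm
  refine ⟨fun {a b} => Quotient.lift (s := Path.Homotopic.setoid a b) V V_inv, ?_, ?_⟩
  · intro a b c p q
    induction p with | mk p =>
    induction q with | mk q =>
    rw [← Path.Homotopic.Quotient.mk_trans]
    show V (p.trans q) = V q * V p
    obtain ⟨n₁, h₁⟩ := ex p
    obtain ⟨n₂, h₂⟩ := ex q
    obtain ⟨n₃, h₃⟩ := ex (p.trans q)
    -- A common multiple `n` serves both paths; their concatenation runs twice as fast and is
    -- divided into `n + n` parts, the first `n` of which trace `p`.
    have f1 : IsFine δ p.extend (n₁ * (n₂ * n₃)) := h₁.mul (Nat.mul_pos h₂.1 h₃.1)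
    have f2 : IsFine δ q.extend (n₁ * (n₂ * n₃)) := by
      have := h₂.mul (Nat.mul_pos h₁.1 h₃.1)
      rwa [show n₂ * (n₁ * n₃) = n₁ * (n₂ * n₃) by ring] at this
    have f3 : IsFine δ (p.trans q).extend (n₁ * (n₂ * n₃) + n₁ * (n₂ * n₃)) := by
      have := h₃.mul (Nat.mul_pos (Nat.mul_pos h₁.1 h₂.1) two_pos)
      rwa [show n₃ * (n₁ * n₂ * 2) = n₁ * (n₂ * n₃) + n₁ * (n₂ * n₃) by ring] at this
    generalize n₁ * (n₂ * n₃) = n at f1 f2 f3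
    have hn : (0 : ℝ) < n := by exact_mod_cast f1.1
    have tr : ∀ r : ℝ, r ∈ Icc (0 : ℝ) 1 → (p.trans q).extend r =
        if r ≤ 1 / 2 then p.extend (2 * r) else q.extend (2 * r - 1) := fun r hr => by
      rw [Path.extend_apply _ hr]; rfl
    rw [V_eq p f1, V_eq q f2, V_eq _ f3, chainProd_add]
    congr 1
    · refine chainProd_congr fun i hi => ?_
      have hi' : (i : ℝ) ≤ n := by exact_mod_cast hi
      have hi0 : (0 : ℝ) ≤ i := Nat.cast_nonneg i
      push_cast
      rw [tr _ ⟨by positivity, by rw [div_le_one (by positivity)]; linarith⟩]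
      -- Only `i = 0` falls into the first branch, where both sides are the common end `b`.
      split_ifs with hle
      · rw [div_le_iff₀ (by positivity)] at hle
        have : (i : ℝ) = 0 := by linarith
        rw [this, add_zero, zero_div, show 2 * ((n : ℝ) / (n + n)) = 1 by field_simp; ring]
        simp
      · congr 1
        field_simp
        ring
    · refine chainProd_congr fun i hi => ?_
      have hi' : (i : ℝ) ≤ n := by exact_mod_cast hi
      have hi0 : (0 : ℝ) ≤ i := Nat.cast_nonneg i
      push_cast
      rw [tr _ ⟨by positivity, by rw [div_le_one (by positivity)]; linarith⟩, if_pos (by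
        rw [div_le_iff₀ (by positivity)]; linarith)]
      congr 1
      field_simp
      ring
  · intro a b p hp
    show V p = Φ a b
    obtain ⟨n, hn⟩ := ex p
    have hn' : (0 : ℝ) < n := by exact_mod_cast hn.1
    rw [V_eq p hn, chainProd_of_small hδ hΦ (z := fun i : ℕ => p.extend (i / n)) fun i _ j _ => hp _ _]
    simp [div_self hn'.ne']

end Holonomy

end CocycleHolonomy

/-! ### The combing of geodesics from `x` -/

section Combing

open Set

/-- A choice of gates in all pieces, and of geodesics in the pieces from the gates of `x`. -/
structure PieceData {X : Type*} [MetricSpace X] (P : Set (Set X)) (x : X) where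
  /-- The gate of a point in a piece. -/
  gate : P → X → X
  isGate : ∀ (M : P) (a : X), IsGate (M : Set X) a (gate M a)
  /-- The geodesic from the gate of `x` to a point of the piece. -/
  geo : P → X → ℝ → X
  isGeod : ∀ M : P, ∀ p ∈ (M : Set X), IsGeod (geo M p) (gate M x) p
  continuous_geo : ∀ M : P, ∀ p ∈ (M : Set X), Continuous (geo M p)
  geo_mem : ∀ M : P, ∀ p ∈ (M : Set X), ∀ r, geo M p r ∈ (M : Set X)

namespace PieceData

variable {X : Type*} [MetricSpace X] {P : Set (Set X)} {x : X} (Q : PieceData P x)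

/-- The time `s` is interior to the passage of a geodesic from `x` to `a` through `M`. -/
def InPiece (M : P) (a : X) (s : ℝ) : Prop :=
  dist x (Q.gate M x) < s ∧ s < dist x a - dist (Q.gate M a) a

/-- The piece `M` separates `x`, `a` and `b`. -/
def Separates (M : P) (a b : X) : Prop :=
  Q.gate M x ≠ Q.gate M a ∧ Q.gate M x ≠ Q.gate M b ∧ Q.gate M a ≠ Q.gate M b

variable {Q}

theorem InPiece.gate_ne {M : P} {a : X} {s : ℝ} (h : Q.InPiece M a s) :
    Q.gate M x ≠ Q.gate M a := by
  intro e
  have h1 := h.1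
  have h2 := h.2
  rw [e] at h1
  linarith [dist_triangle x (Q.gate M a) a]

variable (hP : IsTreeGraded X P)
include hP

theorem dist_eq {M : P} {a : X} (h : Q.gate M x ≠ Q.gate M a) : dist x a =
    dist x (Q.gate M x) + dist (Q.gate M x) (Q.gate M a) + dist (Q.gate M a) a :=
  hP.dist_gate M.2 (Q.isGate M x) (Q.isGate M a) h

theorem Separates.unique {M N : P} {a b : X} (h : Q.Separates M a b) (h' : Q.Separates N a b) :
    M = N :=
  Subtype.ext (hP.piece_unique M.2 N.2 (Q.isGate M x) (Q.isGate M a) (Q.isGate M b)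
    (Q.isGate N x) (Q.isGate N a) (Q.isGate N b) h.1 h.2.1 h.2.2 h'.1 h'.2.1 h'.2.2)

theorem geod_gate_left {M : P} {a : X} (h : Q.gate M x ≠ Q.gate M a) {g : ℝ → X}
    (hg : IsGeod g x a) : g (dist x (Q.gate M x)) = Q.gate M x :=
  (hP.geod_gate M.2 (Q.isGate M x) (Q.isGate M a) h hg).2

theorem geod_gate_right {M : P} {a : X} (h : Q.gate M x ≠ Q.gate M a) {g : ℝ → X}
    (hg : IsGeod g x a) : g (dist x a - dist (Q.gate M a) a) = Q.gate M a := by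
  have := (hP.geod_gate M.2 (Q.isGate M a) (Q.isGate M x) h.symm hg.rev).2
  rwa [dist_comm a] at this

theorem geod_mem {M : P} {a : X} (h : Q.gate M x ≠ Q.gate M a) {g : ℝ → X}
    (hg : IsGeod g x a) {s : ℝ} (h1 : dist x (Q.gate M x) ≤ s)
    (h2 : s ≤ dist x a - dist (Q.gate M a) a) : g s ∈ (M : Set X) := by
  have hd := dist_eq hP h
  have G := hg.sub (s := dist x (Q.gate M x)) (t := dist x a - dist (Q.gate M a) a) dist_nonneg
    (by linarith) (by linarith [dist_nonneg (x := Q.gate M a) (y := a)])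
  rw [geod_gate_left hP h hg, geod_gate_right hP h hg] at G
  have := hP.geod_mem_piece M.2 (Q.isGate M x).mem (Q.isGate M a).mem G
    (s := s - dist x (Q.gate M x)) ⟨by linarith, by linarith⟩
  simpa using this

/-- A geodesic from `x` to `a` has two different points in both pieces, namely those at times `s`
and `t`. -/
theorem piece_eq_of_overlap {M N : P} {a : X} {s t : ℝ} (hst : s < t)
    (hM1 : dist x (Q.gate M x) ≤ s) (hM2 : t ≤ dist x a - dist (Q.gate M a) a)
    (hN1 : dist x (Q.gate N x) ≤ s) (hN2 : t ≤ dist x a - dist (Q.gate N a) a) : M = N := by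
  obtain ⟨g, hg⟩ := hP.exists_isGeod x a
  have hM : Q.gate M x ≠ Q.gate M a := InPiece.gate_ne (s := (s + t) / 2)
    ⟨by linarith, by linarith⟩
  have hN : Q.gate N x ≠ Q.gate N a := InPiece.gate_ne (s := (s + t) / 2)
    ⟨by linarith, by linarith⟩
  refine Subtype.ext (hP.piece_eq M.2 N.2 (a := g s) (b := g t) (fun e => hst.ne ?_)
    (geod_mem hP hM hg hM1 (by linarith)) (geod_mem hP hN hg hN1 (by linarith))
    (geod_mem hP hM hg (by linarith) hM2) (geod_mem hP hN hg (by linarith) hN2))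
  have := dist_nonneg (x := Q.gate M a) (y := a)
  have := dist_nonneg (x := x) (y := Q.gate M x)
  exact hg.injOn ⟨by linarith, by linarith⟩ ⟨by linarith, by linarith⟩ e

theorem InPiece.unique {M N : P} {a : X} {s : ℝ} (h : Q.InPiece M a s) (h' : Q.InPiece N a s) :
    M = N := by
  obtain ⟨t, ht, ht'⟩ := exists_between (lt_min h.2 h'.2)
  exact piece_eq_of_overlap hP ht h.1.le (ht'.le.trans (min_le_left _ _)) h'.1.le
    (ht'.le.trans (min_le_right _ _))

/-- If the entrance into `M` were interior to the passage through `N`, the two passages would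
overlap just after it, so `N = M`; but the entrance is not interior to its own passage. -/
theorem not_inPiece_left {M : P} {a : X} (h : Q.gate M x ≠ Q.gate M a) (N : P) :
    ¬ Q.InPiece N a (dist x (Q.gate M x)) := by
  intro hN
  have hd := dist_eq hP h
  have hpos := dist_pos.2 h
  obtain ⟨t, ht, ht'⟩ := exists_between
    (lt_min hN.2 (show _ < dist x a - dist (Q.gate M a) a by linarith))
  obtain rfl := piece_eq_of_overlap hP ht le_rfl (ht'.le.trans (min_le_right _ _)) hN.1.le
    (ht'.le.trans (min_le_left _ _))
  exact lt_irrefl _ hN.1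

theorem not_inPiece_right {M : P} {a : X} (h : Q.gate M x ≠ Q.gate M a) (N : P) :
    ¬ Q.InPiece N a (dist x a - dist (Q.gate M a) a) := by
  intro hN
  have hd := dist_eq hP h
  have hpos := dist_pos.2 h
  obtain ⟨t, ht, ht'⟩ := exists_between
    (max_lt hN.1 (show dist x (Q.gate M x) < dist x a - dist (Q.gate M a) a by linarith))
  obtain rfl := piece_eq_of_overlap hP ht' ((le_max_right _ _).trans ht.le) le_rfl
    ((le_max_left _ _).trans ht.le) hN.2.le
  exact lt_irrefl _ hN.2

/-- Two geodesics from `x` to `a` can differ only inside pieces. -/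
theorem exists_inPiece_of_ne {a : X} {f g : ℝ → X} (hf : IsGeod f x a) (hg : IsGeod g x a) {s : ℝ}
    (hs : s ∈ Icc 0 (dist x a)) (hne : f s ≠ g s) : ∃ M, Q.InPiece M a s := by
  have aux : ∀ {f : ℝ → X}, IsGeod f x a → ∀ {t : ℝ} (ht : t ∈ Icc 0 (dist x a)),
      f (projIcc 0 (dist x a) dist_nonneg t) = f t := fun _ t ht => by
    rw [projIcc_of_mem _ ht]
  obtain ⟨l, r, ho, hsr⟩ := exists_isGap hf.continuous_clamp hg.continuous_clamp
    (hf.clamp.map_zero.trans hg.clamp.map_zero.symm)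
    (hf.clamp.map_dist.trans hg.clamp.map_dist.symm) hs (by
      rw [aux hf hs, aux hg hs]; exact hne)
  obtain ⟨M, hM, hMm⟩ := hP.exists_piece_of_bigon hf.clamp.isGeodesicOn hg.clamp.isGeodesicOn
    (hf.clamp.map_zero.trans hg.clamp.map_zero.symm) ho.nonneg ho.lt.le ho.le ho.left ho.right ho.ne
  have hl : l ∈ Icc 0 (dist x a) := ⟨ho.nonneg, ho.lt.le.trans ho.le⟩
  have hr : r ∈ Icc 0 (dist x a) := ⟨ho.nonneg.trans ho.lt.le, ho.le⟩
  have m1 := (hMm l ⟨le_rfl, ho.lt.le⟩).1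
  have m2 := (hMm r ⟨ho.lt.le, le_rfl⟩).1
  rw [aux hf hl] at m1
  rw [aux hf hr] at m2
  -- Both ends of the gap lie in `M`, so `M` is entered no later than `l` and left no earlier than
  -- `r`.
  refine ⟨⟨M, hM⟩, ?_, ?_⟩
  · have := (Q.isGate ⟨M, hM⟩ x).dist_eq _ m1
    rw [hf.dist_left hl] at this
    linarith [hsr.1, dist_nonneg (x := Q.gate ⟨M, hM⟩ x) (y := f l)]
  · have := (Q.isGate ⟨M, hM⟩ a).dist_eq _ m2
    rw [dist_comm, hf.dist_right hr] at this
    linarith [hsr.2, dist_nonneg (x := Q.gate ⟨M, hM⟩ a) (y := f r),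
      dist_comm a (Q.gate ⟨M, hM⟩ a)]

omit hP in
open Classical in
/-- The geodesic `g` from `x` to `a`, made to follow the chosen geodesics in all pieces. -/
noncomputable def straighten (Q : PieceData P x) (a : X) (g : ℝ → X) (s : ℝ) : X :=
  if h : ∃ M, Q.InPiece M a s then
    Q.geo h.choose (Q.gate h.choose a) (s - dist x (Q.gate h.choose x)) else g s

theorem straighten_of_inPiece {M : P} {a : X} {g : ℝ → X} {s : ℝ} (h : Q.InPiece M a s) :
    Q.straighten a g s = Q.geo M (Q.gate M a) (s - dist x (Q.gate M x)) := by
  have h' : ∃ M, Q.InPiece M a s := ⟨M, h⟩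
  rw [straighten, dif_pos h', h'.choose_spec.unique hP h]

omit hP in
theorem straighten_of_not {a : X} {g : ℝ → X} {s : ℝ} (h : ∀ M, ¬ Q.InPiece M a s) :
    Q.straighten a g s = g s := by
  rw [straighten, dif_neg (by push Not; exact h)]

/-- The formula extends to both ends of the passage: they are interior to no passage, so `g` is
unchanged there, and it passes through both gates. -/
theorem straighten_eq_geo {M : P} {a : X} {g : ℝ → X} (hg : IsGeod g x a) {s : ℝ}
    (h : Q.gate M x ≠ Q.gate M a) (h1 : dist x (Q.gate M x) ≤ s)
    (h2 : s ≤ dist x a - dist (Q.gate M a) a) :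
    Q.straighten a g s = Q.geo M (Q.gate M a) (s - dist x (Q.gate M x)) := by
  have G := Q.isGeod M _ (Q.isGate M a).mem
  rcases h1.eq_or_lt with rfl | h1
  · rw [straighten_of_not (not_inPiece_left hP h), sub_self, G.map_zero, geod_gate_left hP h hg]
  rcases h2.eq_or_lt with rfl | h2
  · rw [straighten_of_not (not_inPiece_right hP h), geod_gate_right hP h hg]
    have hd := dist_eq hP h
    rw [show dist x a - dist (Q.gate M a) a - dist x (Q.gate M x)
      = dist (Q.gate M x) (Q.gate M a) by linarith, G.map_dist]
  · exact straighten_of_inPiece hP ⟨h1, h2⟩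

/-- It suffices to be 1-Lipschitz. Each time lies in a passage, or is itself a degenerate interval;
on such an interval the new line is isometric, and at its ends it still agrees with `g`. The
distance between times in different intervals is estimated through these ends. -/
theorem isGeod_straighten {a : X} {g : ℝ → X} (hg : IsGeod g x a) :
    IsGeod (Q.straighten a g) x a := by
  have key : ∀ s ∈ Icc 0 (dist x a), ∃ l r, 0 ≤ l ∧ l ≤ s ∧ s ≤ r ∧ r ≤ dist x a ∧
      (∀ M, ¬ Q.InPiece M a l) ∧ (∀ M, ¬ Q.InPiece M a r) ∧ (∀ u ∈ Icc l r, ∀ v ∈ Icc l r,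
        dist (Q.straighten a g u) (Q.straighten a g v) = |u - v|) ∧
      ∀ u ∈ Ioo l r, ∃ M, Q.InPiece M a u := by
    intro s hs
    by_cases h : ∃ M, Q.InPiece M a s
    · obtain ⟨M, h⟩ := h
      have hd := dist_eq hP h.gate_ne
      have G := Q.isGeod M _ (Q.isGate M a).mem
      refine ⟨_, _, dist_nonneg, h.1.le, h.2.le,
        by linarith [dist_nonneg (x := Q.gate M a) (y := a)], not_inPiece_left hP h.gate_ne,
        not_inPiece_right hP h.gate_ne, fun u hu v hv => ?_, fun u hu => ⟨M, hu⟩⟩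
      rw [straighten_eq_geo hP hg h.gate_ne hu.1 hu.2, straighten_eq_geo hP hg h.gate_ne hv.1 hv.2,
        G.dist_eq ⟨by linarith [hu.1], by linarith [hu.2]⟩
          ⟨by linarith [hv.1], by linarith [hv.2]⟩]
      congr 1; ring
    · push Not at h
      refine ⟨s, s, hs.1, le_rfl, le_rfl, hs.2, h, h, fun u hu v hv => ?_, fun u hu =>
        (lt_asymm hu.1 hu.2).elim⟩
      rw [le_antisymm hu.2 hu.1, le_antisymm hv.2 hv.1]
      simp
  have hx0 : ∀ M, ¬ Q.InPiece M a 0 := fun M h => by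
    linarith [h.1, dist_nonneg (x := x) (y := Q.gate M x)]
  have ha0 : ∀ M, ¬ Q.InPiece M a (dist x a) := fun M h => by
    linarith [h.2, dist_nonneg (x := Q.gate M a) (y := a)]
  refine IsGeod.of_dist_le ?_ ?_ ?_
  · rw [straighten_of_not hx0, hg.map_zero]
  · rw [straighten_of_not ha0, hg.map_dist]
  · intro s t hs hst ht
    obtain ⟨l, r, hl, hls, hsr, hr, hnl, hnr, hd, hin⟩ := key s ⟨hs, hst.trans ht⟩
    obtain ⟨l', r', hl', hlt, htr, hr', hnl', hnr', hd', hin'⟩ := key t ⟨hs.trans hst, ht⟩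
    by_cases htr2 : t ≤ r
    · rw [hd s ⟨hls, hsr⟩ t ⟨hls.trans hst, htr2⟩, abs_sub_comm, abs_of_nonneg (by linarith)]
    · push Not at htr2
      have hrl : r ≤ l' := by
        by_contra! h
        obtain ⟨M, hM⟩ := hin' r ⟨h, htr2.trans_le htr⟩
        exact hnr M hM
      have e1 := hd s ⟨hls, hsr⟩ r ⟨hls.trans hsr, le_rfl⟩
      have e2 := hd' l' ⟨le_rfl, hlt.trans htr⟩ t ⟨hlt, htr⟩
      have e3 : dist (Q.straighten a g r) (Q.straighten a g l') = l' - r := by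
        rw [straighten_of_not hnr, straighten_of_not hnl',
          hg.dist_of_le (hs.trans hsr) hrl ((hlt.trans htr).trans hr')]
      rw [abs_sub_comm, abs_of_nonneg (by linarith)] at e1 e2
      linarith [dist_triangle4 (Q.straighten a g s) (Q.straighten a g r) (Q.straighten a g l')
        (Q.straighten a g t)]

/-- The combing of `X` which follows the chosen geodesics in all pieces. -/
theorem exists_comb (Q : PieceData P x) : ∃ c : X → ℝ → X, (∀ a, IsGeod (c a) x a) ∧
    (∀ a, Continuous (c a)) ∧
    ∀ (a : X) (M : P) (s : ℝ), Q.gate M x ≠ Q.gate M a → dist x (Q.gate M x) ≤ s →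
      s ≤ dist x a - dist (Q.gate M a) a →
      c a s = Q.geo M (Q.gate M a) (s - dist x (Q.gate M x)) := by
  choose g hg using fun a => hP.exists_isGeod x a
  have hs := fun a => isGeod_straighten (Q := Q) hP (hg a)
  refine ⟨fun a r => Q.straighten a (g a) (projIcc 0 (dist x a) dist_nonneg r),
    fun a => (hs a).clamp, fun a => (hs a).continuous_clamp, fun a M s h h1 h2 => ?_⟩
  simp only
  rw [projIcc_of_mem _ ⟨dist_nonneg.trans h1,
    h2.trans (by linarith [dist_nonneg (x := Q.gate M a) (y := a)])⟩]
  exact straighten_eq_geo hP (hg a) h h1 h2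

section Comb

variable {c : X → ℝ → X} (hc : ∀ a, IsGeod (c a) x a)
  (hgeo : ∀ (a : X) (M : P) (s : ℝ), Q.gate M x ≠ Q.gate M a → dist x (Q.gate M x) ≤ s →
      s ≤ dist x a - dist (Q.gate M a) a →
      c a s = Q.geo M (Q.gate M a) (s - dist x (Q.gate M x)))
include hc hgeo

/-- Up to the entrance of a piece, the combing line is the combing line of the entrance. -/
theorem comb_prefix {M : P} {a : X} (h : Q.gate M x ≠ Q.gate M a) {s : ℝ} (hs : 0 ≤ s)
    (hs' : s ≤ dist x (Q.gate M x)) : c a s = c (Q.gate M x) s := by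
  have hd := dist_eq hP h
  set e := Q.gate M x with he
  have hle : dist x e ≤ dist x a := by
    linarith [dist_nonneg (x := Q.gate M a) (y := a), dist_nonneg (x := e) (y := Q.gate M a)]
  have G := (hc a).sub le_rfl dist_nonneg hle
  rw [(hc a).map_zero, he, geod_gate_left hP h (hc a), ← he] at G
  simp only [zero_add] at G
  by_contra hne
  obtain ⟨N, hN⟩ := exists_inPiece_of_ne (Q := Q) hP G (hc e) ⟨hs, hs'⟩ hne
  have ge : Q.gate M e = e := (Q.isGate M e).eq_of_mem (Q.isGate M x).mem
  have hMN : (M : Set X) ≠ N := fun h' => by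
    obtain rfl := Subtype.ext h'
    exact hN.gate_ne ge.symm
  -- As `x` and `e` have different gates in `N`, the alternative makes the gate of `x` in `M` that
  -- of `N`. Since `a` has another gate in `M`, its gate in `N` must be that of `e`, so both lines
  -- follow the same chosen geodesic through `N`.
  have o1 := hP.gate_eq_or M.2 N.2 hMN (Q.isGate M a) (Q.isGate N a) (Q.isGate N x).mem
    (Q.isGate M _) (Q.isGate M x).mem (Q.isGate N e)
  have o2 := hP.gate_eq_or M.2 N.2 hMN (Q.isGate M x) (Q.isGate N x) (Q.isGate N x).mem
    (Q.isGate M _) (Q.isGate M x).mem (Q.isGate N e)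
  have e1 := o2.resolve_right hN.gate_ne
  have e2 := o1.resolve_left (fun e' => h (e1.trans e'.symm))
  have hN' : Q.InPiece N a s := ⟨hN.1, by
    rw [e2]
    linarith [hN.2, dist_triangle4 (Q.gate N e) e (Q.gate M a) a]⟩
  rw [hgeo a N s hN'.gate_ne hN'.1.le hN'.2.le, hgeo e N s hN.gate_ne hN.1.le hN.2.le, e2] at hne
  exact hne rfl

omit hc hgeo in
-- The piece of the central triangle does not separate, so two of the three points have the same
-- gate in it. The corresponding two vertices of the triangle then coincide, and the common vertex
-- is a median.
theorem exists_median {a b : X} (hsep : ∀ M, ¬ Q.Separates M a b) :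
    ∃ m, dist x a = dist x m + dist m a ∧ dist x b = dist x m + dist m b ∧
      dist a b = dist a m + dist m b := by
  obtain ⟨M, hM, u, hu, v, hv, w, hw, e1, e2, e3⟩ := hP.exists_center x a b
  have h := hsep ⟨M, hM⟩
  have gx := Q.isGate ⟨M, hM⟩ x
  have ga := Q.isGate ⟨M, hM⟩ a
  have gb := Q.isGate ⟨M, hM⟩ b
  simp only [Separates] at h
  generalize Q.gate ⟨M, hM⟩ x = e at *
  generalize Q.gate ⟨M, hM⟩ a = p at *
  generalize Q.gate ⟨M, hM⟩ b = q at *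
  have x1 := gx.dist_eq u hu
  have a1 := ga.dist_eq v hv
  have b1 := gb.dist_eq w hw
  by_cases h1 : e = p
  · subst h1
    have : dist u v ≤ 0 := by
      linarith [dist_triangle x e a, dist_comm a e, dist_comm a v, dist_nonneg (x := e) (y := u),
        dist_nonneg (x := e) (y := v)]
    obtain rfl := dist_le_zero.1 this
    refine ⟨u, by simpa using e1, ?_, ?_⟩
    · linarith [dist_triangle u w b, dist_triangle x u b]
    · linarith [dist_triangle u w b, dist_triangle a u b]
  by_cases h2 : e = q
  · subst h2
    have : dist u w ≤ 0 := by
      linarith [dist_triangle x e b, dist_comm b e, dist_comm b w, dist_nonneg (x := e) (y := u),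
        dist_nonneg (x := e) (y := w)]
    obtain rfl := dist_le_zero.1 this
    refine ⟨u, ?_, by simpa using e2, ?_⟩
    · linarith [dist_triangle u v a, dist_triangle x u a]
    · linarith [dist_triangle a v u, dist_triangle a u b]
  have h3 : p = q := by
    by_contra h3
    exact h ⟨h1, h2, h3⟩
  subst h3
  have : dist v w ≤ 0 := by
    linarith [dist_triangle a p b, dist_comm b p, dist_comm b w, dist_nonneg (x := p) (y := v),
      dist_nonneg (x := p) (y := w)]
  obtain rfl := dist_le_zero.1 this
  refine ⟨v, ?_, ?_, by simpa using e3⟩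
  · linarith [dist_triangle x u v, dist_triangle x v a]
  · linarith [dist_triangle x u v, dist_triangle x v b]

/-- Combing lines to points which are not separated agree up to the median. -/
theorem exists_comb_common {a b : X} (hsep : ∀ M, ¬ Q.Separates M a b) :
    ∃ s, 0 ≤ s ∧ s ≤ dist x a ∧ s ≤ dist x b ∧ (dist x a - s) + (dist x b - s) = dist a b ∧
      ∀ r ∈ Icc 0 s, c a r = c b r := by
  obtain ⟨m, e1, e2, e3⟩ := exists_median hP hsep
  have na := dist_nonneg (x := m) (y := a)
  have nb := dist_nonneg (x := m) (y := b)
  refine ⟨dist x m, dist_nonneg, by linarith, by linarith, by linarith [dist_comm a m],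
    fun r hr => ?_⟩
  have aux : ∀ a b : X, dist x a = dist x m + dist m a → dist x b = dist x m + dist m b →
      dist a b = dist a m + dist m b → (∀ M, ¬ Q.Separates M a b) → ∀ N, Q.InPiece N a r →
      c a r = c b r := by
    intro a b e1 e2 e3 hsep N hN
    have hd := dist_eq hP hN.gate_ne
    have hq : Q.gate N x ≠ Q.gate N b := by
      -- Otherwise the way from `a` to `b` would pass through the entrance of `N`, which is nearer
      -- to `x` than the median by `hN.1` and `hr.2`, and would be too long.
      intro e
      have h1 := hP.dist_gate N.2 (Q.isGate N a) (Q.isGate N b) (fun h => hN.gate_ne (e.trans h.symm))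
      rw [← e] at h1
      linarith [hN.1, hr.2, dist_triangle x (Q.gate N x) b, dist_comm a m,
        dist_comm a (Q.gate N a), dist_comm (Q.gate N x) (Q.gate N a)]
    have hpq : Q.gate N a = Q.gate N b := by
      by_contra h
      exact hsep N ⟨hN.gate_ne, hq, h⟩
    have hd' := dist_eq hP hq
    rw [← hpq] at hd'
    rw [hgeo a N r hN.gate_ne hN.1.le hN.2.le, hgeo b N r hq hN.1.le (by
      rw [← hpq]; linarith [hN.2]), hpq]
  by_cases ha : ∃ N, Q.InPiece N a r
  · obtain ⟨N, hN⟩ := ha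
    exact aux a b e1 e2 e3 hsep N hN
  by_cases hb : ∃ N, Q.InPiece N b r
  · obtain ⟨N, hN⟩ := hb
    exact (aux b a e2 e1 (by rw [dist_comm b a, dist_comm b m, dist_comm m a]; linarith)
      (fun M h => hsep M ⟨h.2.1, h.1, h.2.2.symm⟩) N hN).symm
  -- Outside the passages all geodesics with the same ends agree, so both lines can be replaced by
  -- geodesics through the median with a common beginning `g₀`.
  obtain ⟨g₀, hg₀⟩ := hP.exists_isGeod x m
  obtain ⟨g₁, hg₁⟩ := hP.exists_isGeod m a
  obtain ⟨g₂, hg₂⟩ := hP.exists_isGeod m b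
  have c1 : c a r = g₀ r := by
    by_contra h
    refine ha (exists_inPiece_of_ne hP (hc a) (hg₀.concat hg₁ e1) ⟨hr.1, by linarith [hr.2]⟩ ?_)
    simpa [hr.2] using h
  have c2 : c b r = g₀ r := by
    by_contra h
    refine hb (exists_inPiece_of_ne hP (hc b) (hg₀.concat hg₂ e2) ⟨hr.1, by linarith [hr.2]⟩ ?_)
    simpa [hr.2] using h
  rw [c1, c2]

omit hgeo in
/-- Points of a combing line outside the interiors of the passages through pieces are not
separated by a piece. -/
theorem not_separates_comb {a : X} {s t : ℝ} (hs : 0 ≤ s) (hst : s ≤ t) (ht : t ≤ dist x a)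
    (hsn : ∀ M, ¬ Q.InPiece M a s) (N : P) : ¬ Q.Separates N (c a s) (c a t) := by
  intro h
  have d1 := (hc a).dist_left ⟨hs, hst.trans ht⟩
  have d2 := (hc a).dist_left ⟨hs.trans hst, ht⟩
  have d3 := (hc a).dist_of_le hs hst ht
  have d4 := (hc a).dist_right ⟨hs.trans hst, ht⟩
  have g1 := dist_eq hP h.1
  have g2 := dist_eq hP h.2.1
  have g3 := hP.dist_gate N.2 (Q.isGate N _) (Q.isGate N _) h.2.2
  set z := c a s
  set z' := c a t
  set e := Q.gate N x
  set n := Q.gate N z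
  set n' := Q.gate N z'
  have hpos : 0 < dist n n' := dist_pos.2 h.2.2
  have hpos' : 0 < dist e n := dist_pos.2 h.1
  -- The line would go to `n` and back to `z` before entering the rest of `N`; so `z` lies in `N`,
  -- after the entrance and before the exit, which makes `s` interior to the passage.
  have hn : dist n z ≤ 0 := by linarith [dist_triangle e n n', dist_comm z n]
  have ga := (Q.isGate N a).dist_eq n' (Q.isGate N z').mem
  refine hsn N ⟨by linarith [dist_nonneg (x := n) (y := z)], ?_⟩
  linarith [dist_nonneg (x := z) (y := n), dist_nonneg (x := Q.gate N a) (y := n'), dist_triangle a z' n', dist_comm a z',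
    dist_comm z' n', dist_comm a (Q.gate N a), dist_comm z n]

end Comb

end PieceData

end Combing

/-! ### The cocycle with values in the free product -/

section Cocycle

open Set
open scoped unitInterval
open Path.Homotopic.Quotient
open Monoid (CoprodI)

/-- Induction along a closed subset of an interval, by small steps and by jumps over gaps. -/
theorem closed_step_induction {A : Set ℝ} (hA : IsClosed A) {L δ : ℝ} (hδ : 0 < δ) (hL : 0 ≤ L)
    (h0A : 0 ∈ A) (hLA : L ∈ A) {q : ℝ → Prop} (h0 : q 0)
    (hstep : ∀ s ∈ A, ∀ t ∈ A, 0 ≤ s → s ≤ t → t ≤ L → t - s < δ → q s → q t)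
    (hgap : ∀ s ∈ A, ∀ t ∈ A, 0 ≤ s → s < t → t ≤ L → (∀ r ∈ Ioo s t, r ∉ A) → q s → q t) :
    q L := by
  have key : ∀ (n : ℕ) (s : ℝ), s ∈ A → 0 ≤ s → s ≤ L → L - s ≤ n * (δ / 2) → q s → q L := by
    intro n
    induction n with
    | zero =>
      intro s _ _ hsL h hq
      rwa [le_antisymm hsL (by simpa using h)] at hq
    | succ n ih =>
      intro s hs hs0 hsL h hq
      rcases le_or_gt L (s + δ / 2) with hle | hlt
      · exact hstep s hs L hLA hs0 hsL le_rfl (by linarith) hq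
      -- A small step to the last point `u` of `A` up to `s + δ / 2`, then a jump to the first point
      -- `v` from there on: together an advance of at least `δ / 2`.
      obtain ⟨u, ⟨hu, huA⟩, hu'⟩ := (isCompact_Icc (a := s) (b := s + δ / 2)).inter_right hA
        |>.exists_isGreatest ⟨s, ⟨le_rfl, by linarith⟩, hs⟩
      obtain ⟨v, ⟨hv, hvA⟩, hv'⟩ := (isCompact_Icc (a := s + δ / 2) (b := L)).inter_right hA
        |>.exists_isLeast ⟨L, ⟨hlt.le, le_rfl⟩, hLA⟩
      have hqu := hstep s hs u huA hs0 hu.1 (hu.2.trans hlt.le) (by linarith [hu.2]) hq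
      have hqv : q v := by
        rcases (hu.2.trans hv.1).eq_or_lt with e | hlt'
        · rwa [← e]
        refine hgap u huA v hvA (hs0.trans hu.1) hlt' hv.2 (fun r hr hrA => ?_) hqu
        rcases le_total r (s + δ / 2) with hr' | hr'
        · exact hr.1.not_ge (hu' ⟨⟨hu.1.trans hr.1.le, hr'⟩, hrA⟩)
        · exact hr.2.not_ge (hv' ⟨⟨hr', hr.2.le.trans hv.2⟩, hrA⟩)
      refine ih v hvA (by linarith [hv.1]) hv.2 ?_ hqv
      push_cast at h
      linarith [hv.1]
  obtain ⟨n, hn⟩ := exists_nat_ge (L / (δ / 2))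
  refine key n 0 h0A le_rfl hL ?_ h0
  rw [sub_zero]
  exact (div_le_iff₀ (by linarith)).1 hn

theorem step_induction {L δ : ℝ} (hδ : 0 < δ) (hL : 0 ≤ L) {q : ℝ → Prop} (h0 : q 0)
    (hstep : ∀ s t, 0 ≤ s → s ≤ t → t ≤ L → t - s < δ → q s → q t) : q L :=
  closed_step_induction isClosed_univ hδ hL (mem_univ _) (mem_univ _) h0
    (fun s _ t _ => hstep s t)
    (fun s _ t _ _ hst _ h => (h ((s + t) / 2) ⟨by linarith, by linarith⟩ (mem_univ _)).elim)

section SingleFactor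

variable {ι : Type*} {G : ι → Type*} [∀ i, Group (G i)]

open Classical in
/-- The element of the free product given by a family with at most one nontrivial member. -/
noncomputable def singleFactor (u : ∀ i, G i) : CoprodI G :=
  if h : ∃ i, u i ≠ 1 then CoprodI.of (u h.choose) else 1

theorem singleFactor_eq_of {u : ∀ i, G i} (i : ι) (h : ∀ j, j ≠ i → u j = 1) :
    singleFactor u = CoprodI.of (u i) := by
  rw [singleFactor]
  split_ifs with h'
  · have : h'.choose = i := by
      by_contra hne
      exact h'.choose_spec (h _ hne)
    rw [this]
  · push Not at h'
    rw [h' i, map_one]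

theorem singleFactor_eq_one {u : ∀ i, G i} (h : ∀ i, u i = 1) : singleFactor u = 1 := by
  rw [singleFactor, dif_neg (by push Not; exact h)]

/-- If `u` and `v` were nontrivial at different indices, `w` would be nontrivial at both. So all
three live in one factor, where the relation is given. -/
theorem singleFactor_mul {u v w : ∀ i, G i} (hw : ∀ i, v i * u i = w i)
    (su : ∀ i j, u i ≠ 1 → u j ≠ 1 → i = j) (sv : ∀ i j, v i ≠ 1 → v j ≠ 1 → i = j)
    (sw : ∀ i j, w i ≠ 1 → w j ≠ 1 → i = j) :
    singleFactor v * singleFactor u = singleFactor w := by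
  by_cases hu : ∃ i, u i ≠ 1
  · obtain ⟨i, hi⟩ := hu
    have hu' : ∀ j, j ≠ i → u j = 1 := fun j hj => by
      by_contra h
      exact hj (su j i h hi)
    have hv' : ∀ j, j ≠ i → v j = 1 := fun j hj => by
      by_contra h
      have h1 : v i = 1 := by
        by_contra h1
        exact hj (sv j i h h1)
      refine hj (sw j i ?_ ?_)
      · rwa [← hw j, hu' j hj, mul_one]
      · rwa [← hw i, h1, one_mul]
    rw [singleFactor_eq_of i hu', singleFactor_eq_of i hv', ← map_mul, hw i]
    exact (singleFactor_eq_of i fun j hj => by rw [← hw j, hu' j hj, hv' j hj, one_mul]).symm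
  · push Not at hu
    have : v = w := funext fun i => by rw [← hw i, hu i, mul_one]
    rw [singleFactor_eq_one hu, mul_one, this]

end SingleFactor

namespace PieceData

variable {X : Type*} [MetricSpace X] {P : Set (Set X)} {x : X} (Q : PieceData P x)

/-- The gate of a point in a piece, as a point of the piece. -/
def proj (M : P) (a : X) : (M : Set X) := ⟨Q.gate M a, (Q.isGate M a).mem⟩

/-- The class of the chosen geodesic from the gate of `x` to a point of the piece. -/
def ray {M : P} (p : (M : Set X)) : Path.Homotopic.Quotient (Q.proj M x) p :=
  seg (fun r => (⟨Q.geo M p r, Q.geo_mem M p p.2 r⟩ : (M : Set X)))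
    ((Q.continuous_geo M p p.2).subtype_mk _) 0 (dist (Q.gate M x) p)
    (Subtype.ext (Q.isGeod M p p.2).map_zero) (Subtype.ext (Q.isGeod M p p.2).map_dist)

/-- The path between two points of a piece through the gate of `x` along the chosen geodesics. -/
noncomputable def anchor {M : P} (y p : (M : Set X)) : Path.Homotopic.Quotient y p :=
  (Q.ray y).symm.trans (Q.ray p)

/-- The loop obtained from a path in a piece by joining its ends to the base point. -/
noncomputable def loop {M : P} (y : (M : Set X)) {p q : (M : Set X)} (C : Path.Homotopic.Quotient p q) :
    FundamentalGroup (M : Set X) y :=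
  ((Q.anchor y p).trans C).trans (Q.anchor y q).symm

variable {Q}

theorem isGeodClass_ray {M : P} (p : (M : Set X)) : IsGeodClass (Q.ray p) :=
  IsGeod.isGeodClass_seg (Y := (M : Set X))
    ⟨(Q.isGeod M p p.2).isGeodesicOn, Subtype.ext (Q.isGeod M p p.2).map_zero,
      Subtype.ext (Q.isGeod M p p.2).map_dist⟩

theorem ray_self (M : P) : Q.ray (Q.proj M x) = Path.Homotopic.Quotient.refl _ := (isGeodClass_ray _).eq_refl

theorem anchor_self {M : P} (y : (M : Set X)) : Q.anchor y y = refl y := symm_trans _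

theorem loop_trans {M : P} (y : (M : Set X)) {p q r : (M : Set X)}
    (C : Path.Homotopic.Quotient p q) (D : Path.Homotopic.Quotient q r) :
    Q.loop y (C.trans D) = Q.loop y D * Q.loop y C := by
  -- In `FundamentalGroup` the product `β * α` is the class of `α` followed by `β`; hence the
  -- reversed order here and in all holonomy formulas.
  change _ = (((Q.anchor y p).trans C).trans (Q.anchor y q).symm).trans
    (((Q.anchor y q).trans D).trans (Q.anchor y r).symm)
  simp only [loop, trans_assoc, symm_trans_cancel]

theorem loop_refl {M : P} (y p : (M : Set X)) : Q.loop y (refl p) = 1 := by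
  change _ = refl y
  simp only [loop, trans_refl, trans_symm]

/-- The ends are joined to the base point along the rays themselves. This normalisation makes the
cocycle trivial on pairs one of whose gates is the gate of `x`. -/
theorem loop_ray {M : P} (y p : (M : Set X)) : Q.loop y (Q.ray p) = 1 := by
  change _ = refl y
  simp only [loop, anchor, ray_self, trans_refl, trans_symm]

theorem loop_ray_symm {M : P} (y p : (M : Set X)) : Q.loop y (Q.ray p).symm = 1 := by
  have := loop_trans (Q := Q) y (Q.ray p) (Q.ray p).symm
  rwa [trans_symm, loop_refl, loop_ray, mul_one, eq_comm] at this

theorem loop_self {M : P} (y : (M : Set X)) (C : Path.Homotopic.Quotient y y) :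
    Q.loop y C = C := by
  change ((Q.anchor y y).trans C).trans (Q.anchor y y).symm = C
  rw [anchor_self, symm_refl, trans_refl, refl_trans]

end PieceData

theorem LocallyUniformlyContractible.exists_radius {X : Type*} [MetricSpace X] {P : Set (Set X)}
    (hc : LocallyUniformlyContractible (fun M : P => (M : Set X))) :
    ∃ δ > 0, ∀ (M : P) (a b : (M : Set X)) (p q : Path a b), (∀ t, dist (p t) a < δ) →
      (∀ t, dist (q t) a < δ) → Path.Homotopic.Quotient.mk p = Path.Homotopic.Quotient.mk q := by
  obtain ⟨δ, hδ, -, h⟩ := hc.exists_homotopy one_pos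
  refine ⟨δ, hδ, fun M a b p q hp hq => Path.Homotopic.Quotient.eq.2 ?_⟩
  obtain ⟨F, hF⟩ := h M M.2 a a.2 a b (p.map continuous_subtype_val) (q.map continuous_subtype_val)
    (fun t => ⟨(p t).2, hp t⟩) (fun t => ⟨(q t).2, hq t⟩)
  exact homotopic_of_homotopy_mem F fun z => (hF z).1

/-- A class of geodesics is represented by a path near its start. -/
theorem IsGeodClass.exists_path {Y : Type*} [MetricSpace Y] {a b : Y}
    {C : Path.Homotopic.Quotient a b} (h : IsGeodClass C) :
    ∃ p : Path a b, Path.Homotopic.Quotient.mk p = C ∧ ∀ t, dist (p t) a ≤ dist a b := by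
  obtain ⟨f, hf, hg, rfl⟩ := h
  refine ⟨_, rfl, fun t => ?_⟩
  obtain ⟨v, hv, e⟩ := range_segPath (hf := hf) (hs := hg.map_zero) (ht := hg.map_dist)
    dist_nonneg t
  rw [e, dist_comm, hg.dist_left hv]
  exact hv.2

namespace PieceData

variable {X : Type*} [MetricSpace X] {P : Set (Set X)} {x : X} {Q : PieceData P x}

/-- `φ M` measures the loop in `M` of a short path between gates. It can be nontrivial only if `M`
separates `x`, `a`, `b`: a gate equal to that of `x` makes the path homotopic to a ray or its
inverse, and equal gates make it constant. The separating piece is unique, so at most one factor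
contributes to each pair. -/
theorem exists_cocycle (hP : IsTreeGraded X P)
    (hc : LocallyUniformlyContractible (fun M : P => (M : Set X))) (y : ∀ M : P, (M : Set X)) :
    ∃ δ > 0, ∃ Φ : X → X → CoprodI (fun M : P => FundamentalGroup (M : Set X) (y M)),
      (∀ a b c, dist a b < δ → dist b c < δ → dist a c < δ → Φ b c * Φ a b = Φ a c) ∧
      (∀ a b, dist a b < δ → (∀ M, ¬ Q.Separates M a b) → Φ a b = 1) ∧
      ∀ (M : P) (a b : (M : Set X)) (p : Path a b), (∀ s t, dist (p s) (p t) < δ) →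
        Φ a b = CoprodI.of (i := M) (Q.loop (y M) (Path.Homotopic.Quotient.mk p)) := by
  obtain ⟨δ₀, hδ₀, h⟩ := hc.exists_radius
  have hg : ∀ (M : P) (a b : (M : Set X)), ∃ p : Path a b, ∀ t, dist (p t) a ≤ dist a b := by
    intro M a b
    obtain ⟨C, hC⟩ := hP.exists_isGeodClass_piece M.2 a b
    obtain ⟨p, -, hp⟩ := hC.exists_path
    exact ⟨p, hp⟩
  choose g hg using hg
  set φ : ∀ (M : P) (p q : (M : Set X)), FundamentalGroup (M : Set X) (y M) :=
    fun M p q => Q.loop (y M) (Path.Homotopic.Quotient.mk (g M p q)) with hφ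
  have hsmall : ∀ (M : P) (a b : (M : Set X)) (p : Path a b), dist a b < δ₀ →
      (∀ t, dist (p t) a < δ₀) → φ M a b = Q.loop (y M) (Path.Homotopic.Quotient.mk p) :=
    fun M a b p hab hp => by
      rw [hφ]
      simp only
      rw [h M a b (g M a b) p (fun t => (hg M a b t).trans_lt hab) hp]
  have hclass : ∀ (M : P) (a b : (M : Set X)) (C : Path.Homotopic.Quotient a b), dist a b < δ₀ →
      IsGeodClass C → φ M a b = Q.loop (y M) C := fun M a b C hab hC => by
    obtain ⟨p, rfl, hp⟩ := hC.exists_path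
    exact hsmall M a b p hab fun t => (hp t).trans_lt hab
  have hself : ∀ (M : P) (a : (M : Set X)), φ M a a = 1 := fun M a => by
    rw [hsmall M a a (Path.refl a) (by simpa using hδ₀) (by simpa using hδ₀)]
    exact loop_refl _ _
  -- With sides below `δ₀ / 2`, two chosen paths in succession stay within `δ₀` of `a`.
  have hmul : ∀ (M : P) (a b c : (M : Set X)), dist a b < δ₀ / 2 → dist b c < δ₀ / 2 →
      dist a c < δ₀ / 2 → φ M b c * φ M a b = φ M a c := fun M a b c hab hbc hac => by
    rw [hsmall M a c ((g M a b).trans (g M b c)) (by linarith), mk_trans, loop_trans]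
    intro t
    rw [Path.trans_apply]
    split_ifs
    · exact (hg M a b _).trans_lt (by linarith)
    · exact lt_of_le_of_lt ((dist_triangle _ b _).trans
        (add_le_add (hg M b c _) (dist_comm b a).le)) (by linarith)
  have hproj : ∀ (M : P) (a b : X), dist (Q.proj M a) (Q.proj M b) ≤ dist a b := fun M a b =>
    hP.dist_gate_le M.2 (Q.isGate M a) (Q.isGate M b)
  have hsep : ∀ (M : P) (a b : X), dist a b < δ₀ → φ M (Q.proj M a) (Q.proj M b) ≠ 1 →
      Q.Separates M a b := by
    intro M a b hab hne
    have hd := (hproj M a b).trans_lt hab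
    refine ⟨fun e => hne ?_, fun e => hne ?_, fun e => hne ?_⟩
    · have e' : Q.proj M x = Q.proj M a := Subtype.ext e
      rw [← e'] at hd ⊢
      rw [hclass M _ _ _ hd (isGeodClass_ray _), loop_ray]
    · have e' : Q.proj M x = Q.proj M b := Subtype.ext e
      rw [← e'] at hd ⊢
      rw [hclass M _ _ _ hd (isGeodClass_ray _).symm, loop_ray_symm]
    · have e' : Q.proj M a = Q.proj M b := Subtype.ext e
      rw [e', hself]
  have hsub : ∀ (a b : X), dist a b < δ₀ → ∀ M N, φ M (Q.proj M a) (Q.proj M b) ≠ 1 →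
      φ N (Q.proj N a) (Q.proj N b) ≠ 1 → M = N := fun a b hab M N hM hN =>
    (hsep M a b hab hM).unique hP (hsep N a b hab hN)
  refine ⟨δ₀ / 2, half_pos hδ₀, fun a b => singleFactor fun M => φ M (Q.proj M a) (Q.proj M b),
    fun a b c hab hbc hac => ?_, fun a b hab hn => ?_, fun M a b p hp => ?_⟩
  · exact singleFactor_mul (fun M => hmul M _ _ _ ((hproj M a b).trans_lt hab)
      ((hproj M b c).trans_lt hbc) ((hproj M a c).trans_lt hac)) (hsub a b (by linarith))
      (hsub b c (by linarith)) (hsub a c (by linarith))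
  · refine singleFactor_eq_one fun M => ?_
    by_contra hne
    exact hn M (hsep M a b (by linarith) hne)
  · simp only
    rw [singleFactor_eq_of M]
    · have ha : Q.proj M a = a := Subtype.ext ((Q.isGate M a).eq_of_mem a.2)
      have hb : Q.proj M b = b := Subtype.ext ((Q.isGate M b).eq_of_mem b.2)
      have h0 := hp 0 1
      rw [p.source, p.target] at h0
      rw [ha, hb, hsmall M a b p (by linarith)]
      intro t
      have := hp t 0
      rw [p.source] at this
      linarith
    -- Two points of `M` have the same gate in any other piece, so the other factors do not
    -- contribute.
    · intro N hN
      have e : Q.proj N a = Q.proj N b := Subtype.ext (hP.gate_eq_of_mem_piece N.2 M.2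
        (fun h' => hN (Subtype.ext h')) a.2 b.2 (Q.isGate N a) (Q.isGate N b))
      rw [e, hself]

end PieceData

end Cocycle

/-! ### Holonomy of paths in pieces and of combing lines -/

section HolonomyOfCombing

open Set
open scoped unitInterval
open Path.Homotopic.Quotient
open Monoid (CoprodI)

theorem dist_segPath_lt {Y : Type*} [MetricSpace Y] {f : ℝ → Y} {hf : Continuous f} {s t δ : ℝ}
    {a b : Y} {hs : f s = a} {ht : f t = b} (hst : s ≤ t)
    (h : ∀ u ∈ Icc s t, ∀ v ∈ Icc s t, dist (f u) (f v) < δ) (r r' : I) :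
    dist (segPath f hf s t hs ht r) (segPath f hf s t hs ht r') < δ := by
  obtain ⟨u, hu, e⟩ := range_segPath (hf := hf) (hs := hs) (ht := ht) hst r
  obtain ⟨v, hv, e'⟩ := range_segPath (hf := hf) (hs := hs) (ht := ht) hst r'
  rw [e, e']
  exact h u hu v hv

/-- Short subpaths of a path are small, uniformly. -/
theorem Path.exists_small_segPath {Y : Type*} [MetricSpace Y] {a b : Y} (p : Path a b) {δ : ℝ}
    (hδ : 0 < δ) : ∃ η > 0, ∀ s t, s ≤ t → t - s < η → ∀ r r' : I,
      dist (segPath p.extend p.continuous_extend s t rfl rfl r)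
        (segPath p.extend p.continuous_extend s t rfl rfl r') < δ := by
  obtain ⟨η, hη, h⟩ := Metric.uniformContinuous_iff.1 p.uniformContinuous_extend δ hδ
  refine ⟨η, hη, fun s t hst hlt => dist_segPath_lt hst fun u hu v hv => h ?_⟩
  rw [Real.dist_eq, abs_lt]
  constructor <;> linarith [hu.1, hu.2, hv.1, hv.2]

namespace PieceData

variable {X : Type*} [MetricSpace X] {P : Set (Set X)} {x : X} {Q : PieceData P x}

/-- The inclusion of a subset, as a continuous map. -/
abbrev incl (S : Set X) : C(S, X) := ⟨Subtype.val, continuous_subtype_val⟩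

/-- The cocycle property gives the last formula for small paths in `M`; both sides are
multiplicative, so subdivision extends it to all paths in `M`. -/
theorem exists_hol (hP : IsTreeGraded X P)
    (hc : LocallyUniformlyContractible (fun M : P => (M : Set X))) (y : ∀ M : P, (M : Set X)) :
    ∃ δ > 0, ∃ H : ∀ {a b : X}, Path.Homotopic.Quotient a b →
        CoprodI (fun M : P => FundamentalGroup (M : Set X) (y M)),
      (∀ {a b c : X} (p : Path.Homotopic.Quotient a b) (q : Path.Homotopic.Quotient b c),
        H (p.trans q) = H q * H p) ∧
      (∀ (a b : X) (p : Path a b), (∀ s t, dist (p s) (p t) < δ) → (∀ M, ¬ Q.Separates M a b) →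
        H (Path.Homotopic.Quotient.mk p) = 1) ∧
      ∀ (M : P) (a b : (M : Set X)) (C : Path.Homotopic.Quotient a b),
        H (C.map (incl (M : Set X))) = CoprodI.of (i := M) (Q.loop (y M) C) := by
  obtain ⟨δ, hδ, Φ, h1, h2, h3⟩ := exists_cocycle (Q := Q) hP hc y
  obtain ⟨H, hH, hH'⟩ := exists_holonomy hδ h1
  refine ⟨δ, hδ, H, hH, fun a b p hp hs => ?_, fun M a b C => ?_⟩
  · exact (hH' p hp).trans (h2 a b (by simpa using hp 0 1) hs)
  induction C with | mk p =>
  obtain ⟨η, hη, hsm⟩ := p.exists_small_segPath hδ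
  have hsmall : ∀ s t, s ≤ t → t - s < η →
      H ((seg p.extend p.continuous_extend s t rfl rfl).map (incl (M : Set X))) =
        CoprodI.of (i := M) (Q.loop (y M) (seg p.extend p.continuous_extend s t rfl rfl)) :=
    fun s t hst hlt => by
      rw [seg, ← h3 M _ _ _ (hsm s t hst hlt), ← mk_map]
      exact hH' _ (hsm s t hst hlt)
  have key : H ((seg p.extend p.continuous_extend 0 1 rfl rfl).map (incl (M : Set X))) =
        CoprodI.of (i := M) (Q.loop (y M) (seg p.extend p.continuous_extend 0 1 rfl rfl)) := by
    refine step_induction hη zero_le_one (q := fun t =>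
      H ((seg p.extend p.continuous_extend 0 t rfl rfl).map (incl (M : Set X))) =
        CoprodI.of (i := M) (Q.loop (y M) (seg p.extend p.continuous_extend 0 t rfl rfl)))
      (hsmall 0 0 le_rfl (by simpa using hη)) fun s t _ hst _ hlt hq => ?_
    rw [← seg_trans (ht := rfl) (t := s), map_trans, hH, loop_trans, map_mul, hq, hsmall s t hst hlt]
  have e : ∀ (a' b' : (M : Set X)) (ha : p.extend 0 = a') (hb : p.extend 1 = b'),
      H ((seg p.extend p.continuous_extend 0 1 ha hb).map (incl (M : Set X))) =
        CoprodI.of (i := M) (Q.loop (y M) (seg p.extend p.continuous_extend 0 1 ha hb)) := by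
    rintro _ _ rfl rfl
    exact key
  rw [mk_eq_seg]
  exact e _ _ _ _

section Comb

variable {c : X → ℝ → X} (hP : IsTreeGraded X P) (hc : ∀ a, IsGeod (c a) x a)
  (hcc : ∀ a, Continuous (c a))
  (hgeo : ∀ (a : X) (M : P) (s : ℝ), Q.gate M x ≠ Q.gate M a → dist x (Q.gate M x) ≤ s →
      s ≤ dist x a - dist (Q.gate M a) a →
      c a s = Q.geo M (Q.gate M a) (s - dist x (Q.gate M x)))
include hc hcc

omit hcc hc in
theorem isOpen_inPiece (M : P) (a : X) : IsOpen {s | Q.InPiece M a s} := isOpen_Ioo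

/-- The class of the combing line. -/
noncomputable def combClass (a : X) : Path.Homotopic.Quotient x a :=
  seg (c a) (hcc a) 0 (dist x a) (hc a).map_zero (hc a).map_dist

include hP hgeo

/-- Inside a piece, combing lines follow the chosen geodesics. -/
theorem seg_comb_eq_ray {M : P} {a : X} (h : Q.gate M x ≠ Q.gate M a) :
    seg (c a) (hcc a) (dist x (Q.gate M x)) (dist x a - dist (Q.gate M a) a)
      (geod_gate_left hP h (hc a)) (geod_gate_right hP h (hc a)) =
      (Q.ray (Q.proj M a)).map (incl (M : Set X)) := by
  have hd := dist_eq hP h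
  rw [ray, seg_map]
  have e := seg_comp (f := Q.geo M (Q.gate M a)) (hf := Q.continuous_geo M _ (Q.isGate M a).mem)
    (s := dist x (Q.gate M x)) (t := dist x a - dist (Q.gate M a) a)
    (φ := fun s => s - dist x (Q.gate M x)) (by fun_prop) (a := Q.gate M x) (b := Q.gate M a)
    (hs := by simp [(Q.isGeod M _ (Q.isGate M a).mem).map_zero])
    (ht := by
      rw [show dist x a - dist (Q.gate M a) a - dist x (Q.gate M x)
        = dist (Q.gate M x) (Q.gate M a) by linarith,
        (Q.isGeod M _ (Q.isGate M a).mem).map_dist])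
  refine (seg_congr fun s hs => ?_).trans (e.trans (seg_param (by simp) (by
    change _ = dist (Q.gate M x) (Q.gate M a)
    linarith)))
  rw [uIcc_of_le (by linarith [dist_nonneg (x := Q.gate M x) (y := Q.gate M a)])] at hs
  exact hgeo a M s h hs.1 hs.2

/-- A combing line through a piece is composed of the combing line of its entrance, a chosen
geodesic and a rest. -/
theorem combClass_eq {M : P} {a : X} (h : Q.gate M x ≠ Q.gate M a) :
    combClass hc hcc a = ((combClass hc hcc (Q.gate M x)).trans
      ((Q.ray (Q.proj M a)).map (incl (M : Set X)))).trans
      (seg (c a) (hcc a) (dist x a - dist (Q.gate M a) a) (dist x a)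
        (geod_gate_right hP h (hc a)) (hc a).map_dist) := by
  have : combClass hc hcc (Q.gate M x) = seg (c a) (hcc a) 0 (dist x (Q.gate M x))
      (hc a).map_zero (geod_gate_left hP h (hc a)) :=
    seg_congr fun s hs => by
      rw [uIcc_of_le dist_nonneg] at hs
      exact (comb_prefix hP hc hgeo h hs.1 hs.2).symm
  refine Eq.trans ?_ (congrArg (fun C : Path.Homotopic.Quotient (Q.gate M x) (Q.gate M a) =>
    ((combClass hc hcc (Q.gate M x)).trans C).trans (seg (c a) (hcc a)
      (dist x a - dist (Q.gate M a) a) (dist x a) (geod_gate_right hP h (hc a)) (hc a).map_dist))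
    (seg_comb_eq_ray hP hc hcc hgeo h))
  rw [this, seg_trans, seg_trans, combClass]

/-- A point of `M` is its own gate, so after the passage through `M` a rest of length zero remains.
If the point is the gate of `x`, the ray is trivial instead. -/
theorem combClass_coe {M : P} (p : (M : Set X)) :
    combClass hc hcc (p : X) = (combClass hc hcc (Q.gate M x)).trans
      ((Q.ray p).map (incl (M : Set X))) := by
  have e : Q.proj M p = p := Subtype.ext ((Q.isGate M p).eq_of_mem p.2)
  by_cases h : Q.gate M x = Q.gate M p
  · have e' : p = Q.proj M x := e.symm.trans (Subtype.ext h.symm)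
    rw [e', ray_self]
    exact (trans_refl _).symm
  · rw [combClass_eq hP hc hcc hgeo h]
    have e2 : ∀ q : (M : Set X), q = p → ∀ (C : Path.Homotopic.Quotient (q : X) (p : X)),
        IsGeodClass C → ((combClass hc hcc (Q.gate M x)).trans
          ((Q.ray q).map (incl (M : Set X)))).trans C = (combClass hc hcc (Q.gate M x)).trans
          ((Q.ray p).map (incl (M : Set X))) := by
      rintro q rfl C hC
      rw [hC.eq_refl]
      exact trans_refl _
    exact e2 _ e _ ((hc p).isGeodClass_sub (by
      linarith [dist_eq hP h, dist_nonneg (x := x) (y := Q.gate M x),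
        dist_nonneg (x := Q.gate M x) (y := Q.gate M p)])
      (by linarith [dist_nonneg (x := Q.gate M p) (y := (p : X))]) le_rfl)

theorem combClass_gate_trans {M : P} {a : X} (h : Q.gate M x ≠ Q.gate M a) :
    combClass hc hcc a = (combClass hc hcc (Q.gate M a)).trans
      (seg (c a) (hcc a) (dist x a - dist (Q.gate M a) a) (dist x a)
        (geod_gate_right hP h (hc a)) (hc a).map_dist) := by
  rw [combClass_eq hP hc hcc hgeo h, ← combClass_coe hP hc hcc hgeo (Q.proj M a)]
  rfl

/-- Induction along the closed set of times interior to no passage. Short steps between such times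
are not separated by any piece and contribute `1`; a gap of this set is a full passage through one
piece, where the line is a ray and contributes `1` as well. -/
theorem hol_combClass {G : Type*} [Group G] {H : ∀ {a b : X}, Path.Homotopic.Quotient a b → G}
    (hH : ∀ {a b c : X} (p : Path.Homotopic.Quotient a b) (q : Path.Homotopic.Quotient b c),
      H (p.trans q) = H q * H p) {δ : ℝ} (hδ : 0 < δ)
    (hsmall : ∀ (a b : X) (p : Path a b), (∀ s t, dist (p s) (p t) < δ) →
      (∀ M, ¬ Q.Separates M a b) → H (Path.Homotopic.Quotient.mk p) = 1)
    (hray : ∀ (M : P) (p : (M : Set X)), H ((Q.ray p).map (incl (M : Set X))) = 1) (a : X) :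
    H (combClass hc hcc a) = 1 := by
  have hA : IsClosed {s | ∀ M, ¬ Q.InPiece M a s} := by
    rw [ofPred_forall]
    exact isClosed_iInter fun M => (isOpen_inPiece M a).isClosed_compl
  have key : H (seg (c a) (hcc a) 0 (dist x a) rfl rfl) = 1 := by
    refine closed_step_induction hA hδ dist_nonneg (fun M h => ?_) (fun M h => ?_)
      (q := fun t => H (seg (c a) (hcc a) 0 t rfl rfl) = 1) ?_ ?_ ?_
    · linarith [h.1, dist_nonneg (x := x) (y := Q.gate M x)]
    · linarith [h.2, dist_nonneg (x := Q.gate M a) (y := a)]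
    · have := hH (refl (c a 0)) (refl (c a 0))
      rw [trans_refl] at this
      rw [seg_self]
      exact left_eq_mul.1 this
    · intro s hs t ht hs0 hst htL hlt hq
      rw [← seg_trans (t := s) (ht := rfl), hH, hq, mul_one]
      refine hsmall _ _ _ (dist_segPath_lt hst fun u hu v hv => ?_)
        (not_separates_comb hP hc hs0 hst htL hs)
      rw [(hc a).dist_eq ⟨hs0.trans hu.1, hu.2.trans htL⟩ ⟨hs0.trans hv.1, hv.2.trans htL⟩, abs_lt]
      constructor <;> linarith [hu.1, hu.2, hv.1, hv.2]
    · intro s hs t ht hs0 hst htL hgap hq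
      have hmid : (s + t) / 2 ∈ Ioo s t := ⟨by linarith, by linarith⟩
      have := hgap _ hmid
      simp only [mem_ofPred_eq, not_forall, not_not] at this
      obtain ⟨M, hM⟩ := this
      have hne := hM.gate_ne
      -- The ends of the gap are those of the passage containing its midpoint: neither pair of ends
      -- lies inside the other interval.
      have es : s = dist x (Q.gate M x) := by
        refine le_antisymm ?_ ?_
        · by_contra! h
          exact hs M ⟨h, hmid.1.trans hM.2⟩
        · by_contra! h
          exact hgap _ ⟨h, hM.1.trans hmid.2⟩ (not_inPiece_left hP hne)
      have et : t = dist x a - dist (Q.gate M a) a := by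
        refine le_antisymm ?_ ?_
        · by_contra! h
          exact hgap _ ⟨hmid.1.trans hM.2, h⟩ (not_inPiece_right hP hne)
        · by_contra! h
          exact ht M ⟨hM.1.trans hmid.2, h⟩
      subst es et
      have e : ∀ (u v : X) (hu : c a (dist x (Q.gate M x)) = u)
          (hv : c a (dist x a - dist (Q.gate M a) a) = v),
          H (seg (c a) (hcc a) _ _ hu hv) = H (seg (c a) (hcc a) (dist x (Q.gate M x))
            (dist x a - dist (Q.gate M a) a) rfl rfl) := by
        rintro _ _ rfl rfl
        rfl
      rw [← seg_trans (t := dist x (Q.gate M x)) (ht := rfl), hH, hq, mul_one,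
        ← e _ _ (geod_gate_left hP hne (hc a)) (geod_gate_right hP hne (hc a)),
        seg_comb_eq_ray hP hc hcc hgeo hne]
      exact hray M _
  have e : ∀ (u v : X) (hu : c a 0 = u) (hv : c a (dist x a) = v),
      H (seg (c a) (hcc a) 0 (dist x a) hu hv) = 1 := by
    rintro _ _ rfl rfl
    exact key
  exact e _ _ _ _

end Comb

end PieceData

end HolonomyOfCombing

/-! ### Generation by the pieces, and the isomorphism -/

section FreeProduct

open Set
open scoped unitInterval
open Path.Homotopic.Quotient
open Monoid (CoprodI)

theorem IsTreeGraded.exists_pieceData {X : Type*} [MetricSpace X] {P : Set (Set X)}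
    (hP : IsTreeGraded X P) (hne : ∀ M : P, (M : Set X).Nonempty) (x : X) :
    Nonempty (PieceData P x) := by
  classical
  choose gate hgate using fun (M : P) (a : X) => hP.exists_isGate M.2 (hne M) a
  choose f hf hf' using fun (M : P) (a b : (M : Set X)) =>
    hP.exists_continuous_isGeod_subtype (a := a) (b := b)
      fun m => hP.between_mem_piece M.2 a.2 b.2
  have e : ∀ (M : P) (p : X) (hp : p ∈ (M : Set X)),
      (fun r => if h : p ∈ (M : Set X) then
        (f M ⟨gate M x, (hgate M x).mem⟩ ⟨p, h⟩ r : X) else p) =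
      fun r => (f M ⟨gate M x, (hgate M x).mem⟩ ⟨p, hp⟩ r : X) := fun M p hp => by
    funext r
    rw [dif_pos hp]
  refine ⟨gate, hgate, fun M p r => if h : p ∈ (M : Set X) then
    (f M ⟨gate M x, (hgate M x).mem⟩ ⟨p, h⟩ r : X) else p, fun M p hp => ?_, fun M p hp => ?_,
    fun M p hp r => ?_⟩
  · rw [e M p hp]
    have := hf' M ⟨gate M x, (hgate M x).mem⟩ ⟨p, hp⟩
    exact ⟨this.isGeodesicOn, congrArg _ this.map_zero, congrArg _ this.map_dist⟩
  · rw [e M p hp]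
    exact continuous_subtype_val.comp (hf M _ _)
  · rw [dif_pos hp]
    exact (f M _ _ r).2

theorem piOneInclusion_apply {X : Type*} [TopologicalSpace X] (M : Set X) (y : M) {x : X}
    (γ : Path x (y : X)) (p : Path.Homotopic.Quotient y y) :
    (piOneInclusion M y γ p : Path.Homotopic.Quotient x x) =
      (Path.Homotopic.Quotient.mk γ).trans ((p.map ⟨Subtype.val, continuous_subtype_val⟩).trans
        (Path.Homotopic.Quotient.mk γ).symm) := rfl

namespace PieceData

variable {X : Type*} [MetricSpace X] {P : Set (Set X)} {x : X} {Q : PieceData P x}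
  {c : X → ℝ → X} (hP : IsTreeGraded X P) (hc : ∀ a, IsGeod (c a) x a)
  (hcc : ∀ a, Continuous (c a))
  (hgeo : ∀ (a : X) (M : P) (s : ℝ), Q.gate M x ≠ Q.gate M a → dist x (Q.gate M x) ≤ s →
      s ≤ dist x a - dist (Q.gate M a) a →
      c a s = Q.geo M (Q.gate M a) (s - dist x (Q.gate M x)))

/-- The loop at `x` obtained from a path by joining its ends to `x` by combing lines. -/
noncomputable def combLoop {a b : X} (C : Path.Homotopic.Quotient a b) : FundamentalGroup X x :=
  ((combClass hc hcc a).trans C).trans (combClass hc hcc b).symm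

theorem combLoop_trans {a b d : X} (C : Path.Homotopic.Quotient a b)
    (D : Path.Homotopic.Quotient b d) :
    combLoop hc hcc (C.trans D) = combLoop hc hcc D * combLoop hc hcc C := by
  change _ = (((combClass hc hcc a).trans C).trans (combClass hc hcc b).symm).trans
    (((combClass hc hcc b).trans D).trans (combClass hc hcc d).symm)
  simp only [combLoop, trans_assoc, symm_trans_cancel]

theorem combLoop_refl (a : X) : combLoop hc hcc (Path.Homotopic.Quotient.refl a) = 1 := by
  change _ = Path.Homotopic.Quotient.refl x
  simp only [combLoop, trans_refl, trans_symm]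

theorem combLoop_symm {a b : X} (C : Path.Homotopic.Quotient a b) :
    combLoop hc hcc C.symm = (combLoop hc hcc C)⁻¹ := by
  rw [eq_inv_iff_mul_eq_one, ← combLoop_trans, trans_symm, combLoop_refl]

theorem combLoop_eq_one {a b : X} {C : Path.Homotopic.Quotient a b}
    (h : combClass hc hcc b = (combClass hc hcc a).trans C) : combLoop hc hcc C = 1 := by
  change _ = Path.Homotopic.Quotient.refl x
  rw [combLoop, ← h, trans_symm]

theorem combLoop_self (C : Path.Homotopic.Quotient x x) : combLoop hc hcc C = C := by
  have : combClass hc hcc x = Path.Homotopic.Quotient.refl x :=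
    IsGeodClass.eq_refl (hc x).isGeodClass_seg
  rw [combLoop, this, symm_refl, trans_refl, refl_trans]

include hP hgeo

/-- Combing lines to all points of `M` consist of the line to the gate of `x` and a ray, so joining
a path to the base point inside `M` and then to `x` amounts to joining it to `x` by combing lines.
-/
theorem piOneInclusion_loop_eq_combLoop {M : P} {y : (M : Set X)} {γ : Path x (y : X)}
    (hγ : Path.Homotopic.Quotient.mk γ = combClass hc hcc (y : X)) {p q : (M : Set X)}
    (C : Path.Homotopic.Quotient p q) :
    piOneInclusion (M : Set X) y γ (Q.loop y C) = combLoop hc hcc (C.map (incl (M : Set X))) := by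
  refine (piOneInclusion_apply _ _ _ _).trans ?_
  change _ = ((combClass hc hcc (p : X)).trans _).trans (combClass hc hcc (q : X)).symm
  rw [hγ, combClass_coe hP hc hcc hgeo p, combClass_coe hP hc hcc hgeo q,
    combClass_coe hP hc hcc hgeo y]
  exact conj_map_eq (incl (M : Set X)) _ (Q.ray y) (Q.ray p) C (Q.ray q)

/-- If `M` separates `x`, `a`, `b`, the geodesic can be replaced by one through both gates. Its
outer parts are ends of combing lines and give trivial loops, and its middle part lies in `M`. If no
piece separates, it can be replaced by the two ends of combing lines beyond their common part, and
the loop is trivial. -/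
theorem combLoop_mem_of_short {R : Subgroup (FundamentalGroup X x)}
    (hR : ∀ (M : P) (p q : (M : Set X)) (C : Path.Homotopic.Quotient p q),
      combLoop hc hcc (C.map (incl (M : Set X))) ∈ R) {δ : ℝ}
    (hδ : ∀ (a b : X) (C D : Path.Homotopic.Quotient a b), IsGeodClass C → IsGeodClass D →
        dist a b < δ → C = D) {a b : X} (hab : dist a b < δ) {C : Path.Homotopic.Quotient a b}
    (hC : IsGeodClass C) : combLoop hc hcc C ∈ R := by
  by_cases hsep : ∃ M, Q.Separates M a b
  · obtain ⟨M, h1, h2, h3⟩ := hsep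
    have hd := hP.dist_gate M.2 (Q.isGate M a) (Q.isGate M b) h3
    have ha := dist_eq hP h1
    have hb := dist_eq hP h2
    have nn := fun u v : X => dist_nonneg (x := u) (y := v)
    set ra := seg (c a) (hcc a) (dist x a - dist (Q.gate M a) a) (dist x a)
        (geod_gate_right hP h1 (hc a)) (hc a).map_dist with hra
    set rb := seg (c b) (hcc b) (dist x b - dist (Q.gate M b) b) (dist x b)
        (geod_gate_right hP h2 (hc b)) (hc b).map_dist with hrb
    have gra : IsGeodClass ra := (hc a).isGeodClass_sub
      (by linarith [nn x (Q.gate M x), nn (Q.gate M x) (Q.gate M a)])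
      (by linarith [nn (Q.gate M a) a]) le_rfl
    have grb : IsGeodClass rb := (hc b).isGeodClass_sub
      (by linarith [nn x (Q.gate M x), nn (Q.gate M x) (Q.gate M b)])
      (by linarith [nn (Q.gate M b) b]) le_rfl
    have la : combLoop hc hcc ra = 1 :=
      combLoop_eq_one hc hcc (combClass_gate_trans hP hc hcc hgeo h1)
    have lb : combLoop hc hcc rb = 1 :=
      combLoop_eq_one hc hcc (combClass_gate_trans hP hc hcc hgeo h2)
    obtain ⟨D, gD, lD⟩ : ∃ D : Path.Homotopic.Quotient (Q.gate M a) (Q.gate M b),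
        IsGeodClass D ∧ combLoop hc hcc D ∈ R := by
      obtain ⟨D, hD⟩ := hP.exists_isGeodClass_piece M.2 (Q.proj M a) (Q.proj M b)
      exact ⟨_, hD.map_val, hR M _ _ D⟩
    have e1 : dist a (Q.gate M b) = dist a (Q.gate M a) + dist (Q.gate M a) (Q.gate M b) :=
      (Q.isGate M a).dist_eq _ (Q.isGate M b).mem
    rw [hδ a b C _ hC ((gra.symm.trans gD e1).trans grb (by linarith)) hab, combLoop_trans,
      combLoop_trans, lb, combLoop_symm, la, inv_one, mul_one, one_mul]
    exact lD
  · push Not at hsep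
    obtain ⟨s, hs, hsa, hsb, hd, he⟩ := exists_comb_common hP hc hgeo hsep
    have es := he s ⟨hs, le_rfl⟩
    set ra := seg (c a) (hcc a) s (dist x a) rfl (hc a).map_dist with hra
    set rb := seg (c b) (hcc b) s (dist x b) es.symm (hc b).map_dist with hrb
    have da := (hc a).dist_right ⟨hs, hsa⟩
    have db := (hc b).dist_right ⟨hs, hsb⟩
    rw [← es] at db
    have gra : IsGeodClass ra := (hc a).isGeodClass_sub hs hsa le_rfl
    have grb : IsGeodClass rb := (hc b).isGeodClass_sub hs hsb le_rfl
    have e1 : combClass hc hcc a = (seg (c a) (hcc a) 0 s (hc a).map_zero rfl).trans ra := by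
      rw [hra, seg_trans, combClass]
    have e2 : combClass hc hcc b = (seg (c a) (hcc a) 0 s (hc a).map_zero rfl).trans rb := by
      have : seg (c a) (hcc a) 0 s (hc a).map_zero rfl =
          seg (c b) (hcc b) 0 s (hc b).map_zero es.symm := seg_congr fun r hr => by
        rw [uIcc_of_le hs] at hr
        exact he r hr
      rw [hrb, this, seg_trans, combClass]
    rw [hδ a b C _ hC (gra.symm.trans grb (by rw [dist_comm a (c a s)]; linarith)) hab,
      combLoop_eq_one hc hcc (by rw [e1, e2, trans_assoc, trans_symm_cancel])]
    exact R.one_mem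

/-- Short arcs are homotopic to geodesics, for which the claim is known, and the loop of a
concatenation is a product of loops. -/
theorem combLoop_mem {R : Subgroup (FundamentalGroup X x)}
    (hR : ∀ (M : P) (p q : (M : Set X)) (C : Path.Homotopic.Quotient p q),
      combLoop hc hcc (C.map (incl (M : Set X))) ∈ R)
    (hcon : LocallyUniformlyContractible (fun M : P => (M : Set X))) {a b : X}
    (C : Path.Homotopic.Quotient a b) : combLoop hc hcc C ∈ R := by
  obtain ⟨δ, hδ, h1, h3⟩ := hP.exists_radius hcon
  induction C with | mk p =>
  obtain ⟨η, hη, hsm⟩ := p.exists_small_segPath hδ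
  have hsmall : ∀ s t, s ≤ t → t - s < η →
      combLoop hc hcc (seg p.extend p.continuous_extend s t rfl rfl) ∈ R := fun s t hst hlt => by
    obtain ⟨D, hD⟩ := hP.exists_isGeodClass (p.extend s) (p.extend t)
    rw [seg, h3 _ _ _ D hD (hsm s t hst hlt)]
    have := hsm s t hst hlt 0 1
    rw [Path.source, Path.target] at this
    exact combLoop_mem_of_short hP hc hcc hgeo hR h1 this hD
  have key : combLoop hc hcc (seg p.extend p.continuous_extend 0 1 rfl rfl) ∈ R := by
    refine step_induction hη zero_le_one (q := fun t =>
      combLoop hc hcc (seg p.extend p.continuous_extend 0 t rfl rfl) ∈ R)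
      (hsmall 0 0 le_rfl (by simpa using hη)) fun s t _ hst _ hlt hq => ?_
    rw [← seg_trans (ht := rfl) (t := s), combLoop_trans]
    exact R.mul_mem (hsmall s t hst hlt) hq
  have e : ∀ (a' b' : X) (ha : p.extend 0 = a') (hb : p.extend 1 = b'),
      combLoop hc hcc (seg p.extend p.continuous_extend 0 1 ha hb) ∈ R := by
    rintro _ _ rfl rfl
    exact key
  rw [mk_eq_seg]
  exact e _ _ _ _

end PieceData

theorem mainTheorem12 {X : Type*} [MetricSpace X] (P : Set (Set X)) (hP : IsTreeGraded X P)
    (hc : LocallyUniformlyContractible (fun M : P => (M : Set X)))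
    (x : X) (y : ∀ M : P, (M : Set X)) :
    ∃ γ : ∀ M : P, Path x (y M : X),
      Function.Bijective
        (Monoid.CoprodI.lift (fun M : P => piOneInclusion (M : Set X) (y M) (γ M)) :
          Monoid.CoprodI (fun M : P => FundamentalGroup (M : Set X) (y M)) →*
            FundamentalGroup X x) := by
  obtain ⟨Q⟩ := hP.exists_pieceData (fun M => ⟨_, (y M).2⟩) x
  obtain ⟨c, hcg, hcc, hgeo⟩ := PieceData.exists_comb hP Q
  have hγ : ∀ M : P, ∃ γ : Path x (y M : X),
      Path.Homotopic.Quotient.mk γ = PieceData.combClass hcg hcc (y M : X) := fun M =>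
    Path.Homotopic.Quotient.mk_surjective _
  choose γ hγ using hγ
  refine ⟨γ, ?_, fun C => ?_⟩
  · obtain ⟨δ, hδ, H, hH, h1, h2⟩ := PieceData.exists_hol (Q := Q) hP hc y
    have hcomb : ∀ a, H (PieceData.combClass hcg hcc a) = 1 :=
      PieceData.hol_combClass hP hcg hcc hgeo hH hδ h1 fun M p => by
        rw [h2, PieceData.loop_ray, map_one]
    have hrefl : H (Path.Homotopic.Quotient.refl x) = 1 := by
      have := hH (Path.Homotopic.Quotient.refl x) (Path.Homotopic.Quotient.refl x)
      rw [trans_refl] at this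
      exact left_eq_mul.1 this
    let Hhom : FundamentalGroup X x →* CoprodI (fun M : P => FundamentalGroup (M : Set X) (y M)) :=
      { toFun := fun p => H (p : Path.Homotopic.Quotient x x)
        map_one' := hrefl
        map_mul' := fun p q => hH (q : Path.Homotopic.Quotient x x) p }
    -- Checked on each factor: the conjugating combing lines have holonomy `1`, and the loop in `M`
    -- has its own class as holonomy.
    have hid : Hhom.comp (CoprodI.lift fun M : P => piOneInclusion (M : Set X) (y M) (γ M)) =
        MonoidHom.id _ := by
      refine CoprodI.ext_hom _ _ fun M => MonoidHom.ext fun p => ?_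
      simp only [MonoidHom.comp_apply, CoprodI.lift_of, MonoidHom.id_apply]
      change H ((Path.Homotopic.Quotient.mk (γ M)).trans
        ((Path.Homotopic.Quotient.map p (PieceData.incl (M : Set X))).trans
          (Path.Homotopic.Quotient.mk (γ M)).symm)) = _
      have hs : H (Path.Homotopic.Quotient.mk (γ M)).symm = 1 := by
        have := hH (Path.Homotopic.Quotient.mk (γ M)) (Path.Homotopic.Quotient.mk (γ M)).symm
        rw [trans_symm, hγ, hcomb, mul_one] at this
        rw [hγ, ← this]
        exact hrefl
      rw [hH, hH, hs, hγ, hcomb, h2, PieceData.loop_self, one_mul, mul_one]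
    exact Function.LeftInverse.injective (g := Hhom) fun u => DFunLike.congr_fun hid u
  -- With the range as subgroup: it contains the loops of all paths in pieces, and a loop at `x` is
  -- its own combing loop because the combing line of `x` is constant.
  · have := PieceData.combLoop_mem hP hcg hcc hgeo (R := (CoprodI.lift fun M : P =>
      piOneInclusion (M : Set X) (y M) (γ M)).range) (fun M p q D => ?_) hc C
    · rwa [PieceData.combLoop_self] at this
    · rw [← PieceData.piOneInclusion_loop_eq_combLoop hP hcg hcc hgeo (hγ M) D]
      exact ⟨CoprodI.of (i := M) (Q.loop (y M) D), CoprodI.lift_of ..⟩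

end FreeProduct
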